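/- **Model.** In the congested clique, $n$ nodes (identified with their IDs $1,\dots,n$) proceed in synchronous rounds. In each round every node may send a message of $O(\log n)$ bits to every other node; local computation is free. In the spanner problem each node initially knows $n$, $k$ and its neighbours in a graph $G=(V,E)$, $|V|=n$, and at the end it must know its incident edges of the spanner. Logarithms are to base 2. **Hitting sets.** An instance consists of a number $\Delta\in[1,n]$, sets $V',V''\subseteq V$ and sets $S_u\subseteq V''$ ($u\in V'$) with $|S_u|\ge\Delta$, where $S_u$ is known to node $u$ (and $n,\Delta,V',V''$ to all nodes). A small hitting set, with constant $c>0$, is a set $Z\subseteq V''$ with $Z\cap S_u\neq\emptyset$ for all $u\in V'$ and $|Z|\le c\,|V''|\log n/\Delta$; each node has to learn whether it belongs to $Z$. **Dense region.** Let $k\ge 6$. Put $h=k/2-1$ if $k$ is even and $h=\lfloor k/2\rfloor$ if $k$ is odd (so $h/k=1/2-1/k$ for even $k$). A vertex is heavy if its degree is at least $\sqrt n$, and $G_{light}$ is the subgraph of $G$ induced on the non-heavy vertices. A vertex $v$ is dense if it is heavy, or has a heavy neighbour, or has more than $n^{h/k}$ vertices at distance at most $h$ from it in $G_{light}$. An edge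 of $G$ is dense if both of its endpoints are dense. **Clusterings.** A clustering with center set $Z$ is a family of pairwise disjoint vertex sets (clusters) indexed by the centers $s\in Z$. It has depth $\ell$ in $H$ if for every $s\in Z$ the graph $H$ contains a tree of depth at most $\ell$ that is rooted at $s$ and contains the cluster of $s$. Two vertex sets are adjacent in a graph if it has an edge from one to the other. **Lemma.** Let $\mathcal A$ be a congested clique algorithm that computes small hitting sets with constant $c$ in at most $r_{\mathcal A}=r_{\mathcal A}(n)$ rounds. Then there is a deterministic congested clique algorithm that for all $k\ge 6$, $n\ge 2$ and every $n$-vertex graph $G$ takes $O(\log k+r_{\mathcal A}(n))$ rounds and builds a subgraph $H_{dense}\subseteq G$ such that 1. $\mathrm{dist}(u,v,H_{dense})\le 2k-1$ for every dense edge $(u,v)$ of $G$; 2. $H_{dense}$ has $O(n^{1+1/k}\log^2 n)$ edges; 3. $H_{dense}$ consists of two levels of clustering: there are a clustering $\mathcal C_1$ with centers $Z_1$, of depth $h$ in $H_{dense}$, that covers all dense vertices, with $|Z_1|=O(n^{1-h/k}\log n)$, and a clustering $\mathcal C_2$ with centers $Z_2$ as follows. If $k$ is odd, $\mathcal C_2=\mathcal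 C_1$ and $Z_2=Z_1$. If $k$ is even, $Z_2\subseteq Z_1$, $|Z_2|=O(\sqrt n\log n)$, $\mathcal C_2$ has depth $k/2$ in $H_{dense}$, it covers exactly the dense vertices that are adjacent in $G$ to more than $n^{1/k}\log n$ clusters of $\mathcal C_1$, and every vertex that it covers is adjacent in $G$ to the cluster of $\mathcal C_1$ with the same center. Every dense vertex that $\mathcal C_2$ does not cover is joined by an edge of $H_{dense}$ to each cluster of $\mathcal C_1$ adjacent to it in $G$, and any cluster of $\mathcal C_1$ and cluster of $\mathcal C_2$ that are adjacent in $G$ are joined by an edge of $H_{dense}$. The constant for the number of rounds is absolute, and those in 1–3 depend on $c$ only. If messages of $\mathcal A$ have at most $b\lceil\log n\rceil$ bits, those of the new algorithm have at most $\max(b,\beta)\lceil\log n\rceil$ bits, with $\beta$ absolute. The same holds if $\mathcal A$ is randomized: the new algorithm uses no randomness other than the coin tosses (seeds) of two calls of $\mathcal A$, on an instance that depends on $G$ and on an instance that depends on $G$ and the coin tosses of the first call, and its output is correct for every outcome of the coin tosses for which both calls compute small hitting sets. (In particular it is deterministic if $\mathcal A$ is.) -/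

import Mathlib

namespace CongestedClique

/-- A message: a string of `b * ⌈log₂ n⌉` bits. -/
abbrev Message (b n : ℕ) : Type := Fin (b * Nat.clog 2 n) → Bool

/-- A deterministic algorithm in the congested clique on the `n` nodes `Fin n` (a node's ID is its
index). Local computation is free. In every round each node sends one message to every node, and
updates its state from the messages it receives. After `rounds` rounds each node produces its
output. -/
structure Algorithm (b n : ℕ) (I O : Type) where
  State : Type
  init : Fin n → I → State
  send : State → Fin n → Message b n
  receive : State → (Fin n → Message b n) → State
  output : State → O
  rounds : ℕ

/-- The state of each node after `t` rounds, if node `v` has the local input `x v`. -/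
def Algorithm.stateAfter {b n : ℕ} {I O : Type} (A : Algorithm b n I O) (x : Fin n → I) :
    ℕ → Fin n → A.State
  | 0, v => A.init v (x v)
  | t + 1, v => A.receive (A.stateAfter x t v) (fun u => A.send (A.stateAfter x t u) v)

/-- The output of node `v` at the end of the execution. -/
def Algorithm.run {b n : ℕ} {I O : Type} (A : Algorithm b n I O) (x : Fin n → I) (v : Fin n) : O :=
  A.output (A.stateAfter x A.rounds v)

/-- An instance of the hitting-set problem: sets `S u` for `u ∈ owners`, each with at least `Δ`
elements and contained in `ground`. -/
structure HittingInstance (n : ℕ) where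
  Δ : ℝ
  owners : Set (Fin n)
  ground : Set (Fin n)
  S : Fin n → Set (Fin n)
  one_le : 1 ≤ Δ
  le_card : Δ ≤ n
  large : ∀ u ∈ owners, Δ ≤ ((S u).ncard : ℝ)
  sub : ∀ u ∈ owners, S u ⊆ ground

/-- What node `u` knows of the sets: its own one if it has one, and nothing otherwise. -/
def HittingInstance.localSet {n : ℕ} (P : HittingInstance n) (u : Fin n) : Set (Fin n) :=
  {x | u ∈ P.owners ∧ x ∈ P.S u}

/-- A congested clique algorithm for the hitting-set problem. The number of nodes, `Δ`, the set of
owners and the ground set are known to all nodes; the set `S u` is known to `u` only. Each node has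
a seed (its coin tosses) and says at the end whether it belongs to the hitting set. A deterministic
algorithm is one whose seeds come from a one-point type. -/
abbrev HittingSetAlgorithm (b : ℕ) (Seed : ℕ → Type) : Type 1 :=
  ∀ (n : ℕ), ℝ → Set (Fin n) → Set (Fin n) → Algorithm b n (Set (Fin n) × Seed n) Bool

section Hitting

variable {b : ℕ} {Seed : ℕ → Type}

/-- The algorithm that is executed on the instance `P`. -/
def HittingSetAlgorithm.on (A : HittingSetAlgorithm b Seed) {n : ℕ} (P : HittingInstance n) :
    Algorithm b n (Set (Fin n) × Seed n) Bool :=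
  A n P.Δ P.owners P.ground

/-- The set computed by `A` on the instance `P` with seeds `ρ`. -/
def HittingSetAlgorithm.result (A : HittingSetAlgorithm b Seed) {n : ℕ} (P : HittingInstance n)
    (ρ : Fin n → Seed n) : Set (Fin n) :=
  {v | (HittingSetAlgorithm.on A P).run (fun u => (P.localSet u, ρ u)) v = true}

/-- With seeds `ρ`, the algorithm `A` computes a hitting set for `P` that is contained in the ground
set and has at most `c * |ground| * log n / Δ` elements. -/
def HittingSetAlgorithm.Succeeds (A : HittingSetAlgorithm b Seed) (c : ℝ) {n : ℕ}
    (P : HittingInstance n) (ρ : Fin n → Seed n) : Prop :=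
  HittingSetAlgorithm.result A P ρ ⊆ P.ground ∧
  (∀ u ∈ P.owners, (P.S u ∩ HittingSetAlgorithm.result A P ρ).Nonempty) ∧
  ((HittingSetAlgorithm.result A P ρ).ncard : ℝ) ≤ c * (P.ground.ncard : ℝ) * Real.logb 2 n / P.Δ

/-- `A` takes at most `r n` rounds on `n` nodes. -/
def HittingSetAlgorithm.RunsIn (A : HittingSetAlgorithm b Seed) (r : ℕ → ℕ) : Prop :=
  ∀ (n : ℕ), 2 ≤ n → ∀ P : HittingInstance n, (HittingSetAlgorithm.on A P).rounds ≤ r n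

end Hitting

end CongestedClique

namespace DenseRegion

section Graphs

variable {V : Type}

/-- The ball `Γ_ℓ(v, G)`. -/
def ball (G : SimpleGraph V) (v : V) (ℓ : ℕ) : Set V := {u | G.edist v u ≤ (ℓ : ℕ∞)}

/-- A tree of depth at most `ℓ` in `H`, rooted at `s` and containing all vertices of `X`. -/
def HasRootedTree (H : SimpleGraph V) (ℓ : ℕ) (s : V) (X : Set V) : Prop :=
  ∃ (T : H.Subgraph) (hs : s ∈ T.verts), T.coe.IsTree ∧
    (∀ x : T.verts, T.coe.dist ⟨s, hs⟩ x ≤ ℓ) ∧ X ⊆ T.verts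

/-- A partial map `c` to cluster centers describes the vertex-disjoint clusters
`cluster c s`, for `s` a center. Vertices `v` with `c v = none` are not clustered. -/
def cluster (c : V → Option V) (s : V) : Set V := {v | c v = some s}

/-- The clusters of `c` are centered at the elements of `Z` and each of them has a tree of depth at
most `ℓ` in `H` that is rooted at its center. -/
def IsDepthClustering (H : SimpleGraph V) (ℓ : ℕ) (Z : Set V) (c : V → Option V) : Prop :=
  (∀ v s, c v = some s → s ∈ Z) ∧ ∀ s ∈ Z, HasRootedTree H ℓ s (cluster c s)

/-- `E(X, Y, G) ≠ ∅`. -/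
def Adjacent (G : SimpleGraph V) (X Y : Set V) : Prop := ∃ x ∈ X, ∃ y ∈ Y, G.Adj x y

/-- The centers of the clusters that are adjacent to the vertex `v`. -/
def adjacentCenters (G : SimpleGraph V) (c : V → Option V) (v : V) : Set V :=
  {s | Adjacent G {v} (cluster c s)}

end Graphs

/-- The depth of the first clustering: `k / 2 - 1` for even `k`, and `⌊k / 2⌋` for odd `k`. -/
def depth (k : ℕ) : ℕ := if Even k then k / 2 - 1 else k / 2

section Dense

variable {n : ℕ}

/-- `v` is heavy if its degree is at least `√n`. -/
def IsHeavy (G : SimpleGraph (Fin n)) (v : Fin n) : Prop :=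
  Real.sqrt n ≤ ((G.neighborSet v).ncard : ℝ)

/-- The subgraph of `G` induced on the non-heavy vertices (heavy vertices become isolated). -/
def light (G : SimpleGraph (Fin n)) : SimpleGraph (Fin n) :=
  (G.induce {v | ¬ IsHeavy G v}).spanningCoe

/-- Dense vertices. The exponent `depth k / k` is `1 / 2 - 1 / k` for even `k`. -/
def IsDense (k : ℕ) (G : SimpleGraph (Fin n)) (v : Fin n) : Prop :=
  IsHeavy G v ∨ (∃ u, G.Adj v u ∧ IsHeavy G u) ∨
    (n : ℝ) ^ ((depth k : ℝ) / (k : ℝ)) < ((ball (light G) v (depth k)).ncard : ℝ)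

/-- The two levels of clustering in `H`: the first one has centers `Z₁` and center map `c₁`, the
second one `Z₂` and `c₂`. -/
structure TwoLevelClustering (C : ℝ) (k : ℕ) (G H : SimpleGraph (Fin n)) (Z₁ Z₂ : Set (Fin n))
    (c₁ c₂ : Fin n → Option (Fin n)) : Prop where
  first : IsDepthClustering H (depth k) Z₁ c₁
  covers : ∀ v, IsDense k G v → c₁ v ≠ none
  card_first : (Z₁.ncard : ℝ) ≤ C * (n : ℝ) ^ (1 - (depth k : ℝ) / (k : ℝ)) * Real.logb 2 n
  second_even : Even k → Z₂ ⊆ Z₁ ∧ IsDepthClustering H (k / 2) Z₂ c₂ ∧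
    (∀ v, c₂ v ≠ none ↔ IsDense k G v ∧
      (n : ℝ) ^ (1 / (k : ℝ)) * Real.logb 2 n < ((adjacentCenters G c₁ v).ncard : ℝ)) ∧
    (∀ v s, c₂ v = some s → s ∈ adjacentCenters G c₁ v) ∧
    (Z₂.ncard : ℝ) ≤ C * (n : ℝ) ^ (1 / 2 : ℝ) * Real.logb 2 n
  second_odd : Odd k → Z₂ = Z₁ ∧ c₂ = c₁
  /-- A dense vertex outside the second clustering has an edge to each adjacent first cluster. -/
  unclustered : ∀ v, IsDense k G v → c₂ v = none →
    ∀ s ∈ adjacentCenters G c₁ v, Adjacent H {v} (cluster c₁ s)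
  /-- Adjacent clusters of the two levels are joined by an edge. -/
  connected : ∀ s₁ ∈ Z₁, ∀ s₂ ∈ Z₂, Adjacent G (cluster c₁ s₁) (cluster c₂ s₂) →
    Adjacent H (cluster c₁ s₁) (cluster c₂ s₂)

/-- The nodes' outputs describe a dense-region spanner: node `v` outputs its set of neighbours in
a subgraph `H` of `G` that has stretch at most `2k - 1` for every edge of `G` between dense
vertices, has at most `C * n ^ (1 + 1 / k) * (log n) ^ 2` edges, and consists of two levels of
clustering as above. -/
def IsDenseSpanner (C : ℝ) (k : ℕ) (G : SimpleGraph (Fin n)) (out : Fin n → Set (Fin n)) : Prop :=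
  ∃ H : SimpleGraph (Fin n), (∀ v, out v = H.neighborSet v) ∧ H ≤ G ∧
    (∀ u v, G.Adj u v → IsDense k G u → IsDense k G v → H.edist u v ≤ ((2 * k - 1 : ℕ) : ℕ∞)) ∧
    (H.edgeSet.ncard : ℝ) ≤ C * (n : ℝ) ^ (1 + 1 / (k : ℝ)) * Real.logb 2 n ^ 2 ∧
    ∃ (Z₁ Z₂ : Set (Fin n)) (c₁ c₂ : Fin n → Option (Fin n)),
      TwoLevelClustering C k G H Z₁ Z₂ c₁ c₂

end Dense

end DenseRegion

/-!
The spanner is built from local choices. A first hitting set `Z` of size `O(n ^ (1 - h / k) log n)`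
hits the neighbourhoods of the heavy vertices and the big balls of radius `h = depth k` in the light
graph, so every dense vertex is at distance at most `h` from `Z`, and it joins the cluster of a
center (`firstCenter`) along a path of parents. If `k` is even, a second hitting set `Z' ⊆ Z` hits
the sets of adjacent centers of the crowded vertices, which join the adjacent cluster of an element
of `Z'` (`secondCenter`). Every dense vertex outside the second clustering chooses one edge to each
adjacent cluster, and for each pair of adjacent clusters of the two levels one vertex, the delegate,
chooses an edge. `isDenseSpanner_of_hitting` shows that this is correct: the stretch is bounded by
a detour over the two centers (`edist_le_of_isDense`), and the edges are counted by
`ncard_edgeSet_le`, with `|Z| * |Z'| = O(n ^ (1 + 1 / k) log ^ 2 n)`.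

As local computation is free, an algorithm is described by what the nodes get to know.
`Attains b inp t R` says that after `t` rounds each node `v` can tell apart any two possible worlds
(graphs with coin tosses) that are not related by `R v`. Such states of knowledge are extended by
rounds of communication (`Attains.round`, `Attains.broadcast`, `Attains.hop`) and calls of subroutines
(`Attains.call`, `Attains.call_hittingSet`), and whatever is determined by the knowledge of a node
can be its output (`Attains.exists_algorithm`).

The balls of radius `h` have to be found in `O(log k)` rounds. The radius is doubled in a constant
number of rounds (`Attains.extend_balls`): nodes whose balls are small, with at most `√n` elements,
exchange them with the nodes in them. This is a symmetric relation of degree at most `√n`, along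
which `√n` words per node can be exchanged in 8 rounds (`Attains.exchange`): the pairs of
the relation are distributed over the nodes by a greedy edge colouring of a multigraph on `⌊√n⌋`
classes of nodes, so that the sets of words between any two nodes have constant size.

A node with a big ball does not know this ball in general, so it cannot be an owner of the
hitting-set instance itself. Instead, a node whose ball becomes big at some radius, while no ball of
the previous radius close to it was big, learns its ball and becomes a witness; every big ball
contains that of a witness (`Plan.exists_witnesses`), so it is enough to hit these. Once `Z` is known,
the nearest centers are found by doubling again (`Plan.attains_nearest`): a ball that does not meet
`Z` is small, and the nodes that already have a center announce it to all nodes.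
-/

namespace CongestedClique

/-! ### Composing and simulating algorithms -/

section Compose

variable {b n : ℕ} {I K J O Par : Type}

/-- Run `A₁`, then `A₂` on inputs that each node computes from its output of `A₁`. The state
carries the node's ID and a round counter, so that a node knows when to change over. -/
def Algorithm.andThen (A₁ : Algorithm b n I K) (f : Fin n → K → J) (A₂ : Algorithm b n J O) :
    Algorithm b n I (K × O) where
  State := (Fin n × ℕ × A₁.State) ⊕ (K × A₂.State)
  init v x := Sum.inl (v, 0, A₁.init v x)
  send st w := match st with
    | Sum.inl (v, i, s) => if i < A₁.rounds then A₁.send s w else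
        A₂.send (A₂.init v (f v (A₁.output s))) w
    | Sum.inr p => A₂.send p.2 w
  receive st msg := match st with
    | Sum.inl (v, i, s) => if i < A₁.rounds then Sum.inl (v, i + 1, A₁.receive s msg) else
        Sum.inr (A₁.output s, A₂.receive (A₂.init v (f v (A₁.output s))) msg)
    | Sum.inr p => Sum.inr (p.1, A₂.receive p.2 msg)
  output st := match st with
    | Sum.inl (v, _, s) => (A₁.output s, A₂.output (A₂.init v (f v (A₁.output s))))
    | Sum.inr p => (p.1, A₂.output p.2)
  rounds := A₁.rounds + A₂.rounds

theorem Algorithm.andThen_stateAfter_of_le (A₁ : Algorithm b n I K) (f : Fin n → K → J)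
    (A₂ : Algorithm b n J O) (x : Fin n → I) (i : ℕ) (hi : i ≤ A₁.rounds) (v : Fin n) :
    (A₁.andThen f A₂).stateAfter x i v = Sum.inl (v, i, A₁.stateAfter x i v) := by
  induction i generalizing v with
  | zero => rfl
  | succ i ih =>
    have ih' := ih (by omega)
    simp only [Algorithm.stateAfter, ih']
    have hlt : i < A₁.rounds := by omega
    simp [Algorithm.andThen, hlt]

theorem Algorithm.andThen_stateAfter_add (A₁ : Algorithm b n I K) (f : Fin n → K → J)
    (A₂ : Algorithm b n J O) (x : Fin n → I) (j : ℕ) (v : Fin n) :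
    (A₁.andThen f A₂).stateAfter x (A₁.rounds + (j + 1)) v =
      Sum.inr (A₁.run x v, A₂.stateAfter (fun u => f u (A₁.run x u)) (j + 1) v) := by
  induction j generalizing v with
  | zero =>
    have h := A₁.andThen_stateAfter_of_le f A₂ x A₁.rounds le_rfl
    simp only [Algorithm.stateAfter, h]
    simp [Algorithm.andThen, Algorithm.run]
  | succ j ih =>
    rw [← add_assoc, Algorithm.stateAfter]
    simp only [ih]
    simp [Algorithm.andThen, Algorithm.stateAfter]

theorem Algorithm.andThen_run (A₁ : Algorithm b n I K) (f : Fin n → K → J)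
    (A₂ : Algorithm b n J O) (x : Fin n → I) (v : Fin n) :
    (A₁.andThen f A₂).run x v = (A₁.run x v, A₂.run (fun u => f u (A₁.run x u)) v) := by
  rw [Algorithm.run, show (A₁.andThen f A₂).rounds = A₁.rounds + A₂.rounds from rfl]
  rcases h : A₂.rounds with _ | j
  · rw [add_zero, A₁.andThen_stateAfter_of_le f A₂ x _ le_rfl]
    simp [Algorithm.andThen, Algorithm.run, h, Algorithm.stateAfter]
  · rw [A₁.andThen_stateAfter_add]
    simp [Algorithm.andThen, Algorithm.run, h]

/-- One round in which the input of a node is the list of the messages that it sends, and its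
output the list of the messages that it receives. -/
def Algorithm.transpose (b n : ℕ) : Algorithm b n (Fin n → Message b n) (Fin n → Message b n) where
  State := Fin n → Message b n
  init _ x := x
  send s v := s v
  receive _ msg := msg
  output s := s
  rounds := 1

/-- The same algorithm with longer messages: they are padded with zeros. -/
def Algorithm.widen {b' : ℕ} (hb : b ≤ b') (A : Algorithm b n I O) : Algorithm b' n I O where
  State := A.State
  init := A.init
  send s v := fun i => if h : i.val < b * Nat.clog 2 n then A.send s v ⟨i, h⟩ else false
  receive s msg := A.receive s fun u i => msg u (Fin.castLE (Nat.mul_le_mul_right _ hb) i)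
  output := A.output
  rounds := A.rounds

theorem Algorithm.widen_run {b' : ℕ} (hb : b ≤ b') (A : Algorithm b n I O) (x : Fin n → I) :
    (A.widen hb).run x = A.run x := by
  have h : ∀ t v, (A.widen hb).stateAfter x t v = A.stateAfter x t v := by
    intro t
    induction t with
    | zero => intro v; rfl
    | succ t ih =>
      intro v
      simp only [Algorithm.stateAfter, ih]
      simp [Algorithm.widen]
  funext v
  exact congrArg A.output (h A.rounds v)

/-- A family of algorithms as one algorithm that takes `r` rounds: the parameter is a part of every
node's input, and a node keeps its state once the algorithm with its parameter has come to its
end. -/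
def Algorithm.ofFamily (A : Par → Algorithm b n I O) (r : ℕ) : Algorithm b n (Par × I) O where
  State := Σ p : Par, ℕ × (A p).State
  init v x := ⟨x.1, 0, (A x.1).init v x.2⟩
  send s v := (A s.1).send s.2.2 v
  receive s msg := if s.2.1 < (A s.1).rounds then ⟨s.1, s.2.1 + 1, (A s.1).receive s.2.2 msg⟩ else s
  output s := (A s.1).output s.2.2
  rounds := r

theorem Algorithm.ofFamily_run (A : Par → Algorithm b n I O) {r : ℕ} {p : Par}
    (hr : (A p).rounds ≤ r) (x : Fin n → I) :
    (Algorithm.ofFamily A r).run (fun v => (p, x v)) = (A p).run x := by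
  have h : ∀ t v, (Algorithm.ofFamily A r).stateAfter (fun v => (p, x v)) t v =
      ⟨p, min t (A p).rounds, (A p).stateAfter x (min t (A p).rounds) v⟩ := by
    intro t
    induction t with
    | zero => intro v; simp [Algorithm.stateAfter, Algorithm.ofFamily]
    | succ t ih =>
      intro v
      simp only [Algorithm.stateAfter, ih]
      by_cases ht : t < (A p).rounds
      · have h1 : min t (A p).rounds = t := by omega
        have h2 : min (t + 1) (A p).rounds = t + 1 := by omega
        rw [h1, h2]
        simp [Algorithm.ofFamily, ht, Algorithm.stateAfter]
      · have h1 : min t (A p).rounds = (A p).rounds := by omega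
        have h2 : min (t + 1) (A p).rounds = (A p).rounds := by omega
        rw [h1, h2]
        simp [Algorithm.ofFamily]
  funext v
  have h' := h r v
  rw [min_eq_right hr] at h'
  rw [Algorithm.run, show (Algorithm.ofFamily A r).rounds = r from rfl, h']
  rfl

/-- The same algorithm, followed by a local computation that may depend on the node's ID. -/
def Algorithm.mapOutput (A : Algorithm b n I K) (g : Fin n → K → O) : Algorithm b n I O where
  State := Fin n × A.State
  init v x := (v, A.init v x)
  send s := A.send s.2
  receive s msg := (s.1, A.receive s.2 msg)
  output s := g s.1 (A.output s.2)
  rounds := A.rounds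

theorem Algorithm.mapOutput_run (A : Algorithm b n I K) (g : Fin n → K → O) (x : Fin n → I)
    (v : Fin n) : (A.mapOutput g).run x v = g v (A.run x v) := by
  have h : ∀ t v, (A.mapOutput g).stateAfter x t v = (v, A.stateAfter x t v) := by
    intro t
    induction t with
    | zero => intro v; rfl
    | succ t ih => intro v; simp only [Algorithm.stateAfter, ih]; rfl
  rw [Algorithm.run, h]
  rfl

end Compose

/-! ### Attainable knowledge -/

section Knowledge

variable {b n : ℕ} {Ω I : Type} {inp : Ω → Fin n → I} {t : ℕ} {R : Fin n → Ω → Ω → Prop}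

/-- `Ω` is a set of possible worlds; in the world `ω` the node `v` has the local input `inp ω v`.
`Attains b inp t R` says that some algorithm brings the nodes, in `t` rounds, to a state of
knowledge in which each node `v` can tell two worlds apart unless they are related by `R v`. -/
def Attains (b : ℕ) (inp : Ω → Fin n → I) (t : ℕ) (R : Fin n → Ω → Ω → Prop) : Prop :=
  ∃ (K : Type) (A : Algorithm b n I K), A.rounds = t ∧
    ∀ v ω ω', A.run (inp ω) v = A.run (inp ω') v → R v ω ω'

theorem attains_input (b : ℕ) (inp : Ω → Fin n → I) :
    Attains b inp 0 (fun v ω ω' => inp ω v = inp ω' v) :=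
  ⟨I, { State := I, init := fun _ x => x, send := fun _ _ _ => false, receive := fun s _ => s,
        output := fun s => s, rounds := 0 }, rfl, fun _ _ _ h => h⟩

theorem Attains.weaken {R' : Fin n → Ω → Ω → Prop} (h : Attains b inp t R)
    (hR : ∀ v ω ω', R v ω ω' → R' v ω ω') : Attains b inp t R' := by
  obtain ⟨K, A, ht, hA⟩ := h
  exact ⟨K, A, ht, fun v ω ω' e => hR v ω ω' (hA v ω ω' e)⟩

/-- Whatever is a function of a node's knowledge can be its output. -/
theorem Attains.exists_algorithm {O : Type} [Nonempty O] (h : Attains b inp t R)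
    (out : Ω → Fin n → O) (hout : ∀ v ω ω', R v ω ω' → out ω v = out ω' v) :
    ∃ A : Algorithm b n I O, A.rounds = t ∧ ∀ ω, A.run (inp ω) = out ω := by
  obtain ⟨K, A, ht, hA⟩ := h
  have key : ∀ v, ∃ g : K → O, ∀ ω, g (A.run (inp ω) v) = out ω v := by
    intro v
    have hf : (fun ω => out ω v).FactorsThrough (fun ω => A.run (inp ω) v) :=
      fun ω ω' e => hout v ω ω' (hA v ω ω' e)
    exact ⟨Function.extend (fun ω => A.run (inp ω) v) (fun ω => out ω v)
      (fun _ => Classical.arbitrary O), fun ω => hf.extend_apply _ ω⟩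
  choose g hg using key
  exact ⟨A.mapOutput g, ht, fun ω => funext fun v => (A.mapOutput_run g (inp ω) v).trans (hg v ω)⟩

/-- Calling a subroutine on inputs that the nodes know. -/
theorem Attains.call {J O : Type} (h : Attains b inp t R) (A₂ : Algorithm b n J O)
    (x : Ω → Fin n → J) (hx : ∀ v ω ω', R v ω ω' → x ω v = x ω' v) :
    Attains b inp (t + A₂.rounds) (fun v ω ω' => R v ω ω' ∧ A₂.run (x ω) v = A₂.run (x ω') v) := by
  obtain ⟨K, A, ht, hA⟩ := h
  rcases isEmpty_or_nonempty Ω with hΩ | ⟨⟨ω₀⟩⟩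
  · exact ⟨Unit, { State := Unit, init := fun _ _ => (), send := fun _ _ _ => false,
                     receive := fun _ _ => (), output := fun _ => (), rounds := t + A₂.rounds },
      rfl, fun _ ω => hΩ.elim ω⟩
  have key : ∀ v, ∃ g : K → J, ∀ ω, g (A.run (inp ω) v) = x ω v := by
    intro v
    have hf : (fun ω => x ω v).FactorsThrough (fun ω => A.run (inp ω) v) :=
      fun ω ω' e => hx v ω ω' (hA v ω ω' e)
    exact ⟨Function.extend (fun ω => A.run (inp ω) v) (fun ω => x ω v)
      (fun _ => x ω₀ v), fun ω => hf.extend_apply _ ω⟩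
  choose g hg using key
  refine ⟨K × O, A.andThen g A₂, by rw [← ht]; rfl, fun v ω ω' e => ?_⟩
  simp only [Algorithm.andThen_run, hg, Prod.mk.injEq] at e
  exact ⟨hA v ω ω' e.1, e.2⟩

/-- One round with messages from a type that fits into the bandwidth. -/
theorem Attains.round {W : Type} [Finite W] (h : Attains b inp t R)
    (hW : Nat.card W ≤ 2 ^ (b * Nat.clog 2 n)) (m : Ω → Fin n → Fin n → W)
    (hm : ∀ u ω ω', R u ω ω' → m ω u = m ω' u) :
    Attains b inp (t + 1) (fun v ω ω' => R v ω ω' ∧ ∀ u, m ω u v = m ω' u v) := by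
  have := Fintype.ofFinite W
  have hle : Fintype.card W ≤ Fintype.card (Message b n) := by
    simpa [Message, Nat.card_eq_fintype_card] using hW
  obtain ⟨e⟩ := Function.Embedding.nonempty_of_card_le hle
  refine (h.call (Algorithm.transpose b n) (fun ω u v => e (m ω u v)) ?_).weaken ?_
  · intro v ω ω' hR
    simp only [hm v ω ω' hR]
  · rintro v ω ω' ⟨h1, h2⟩
    refine ⟨h1, fun u => e.injective ?_⟩
    exact congrFun h2 u

theorem pow_le_two_pow_mul_clog (n e : ℕ) : n ^ e ≤ 2 ^ (e * Nat.clog 2 n) := by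
  rw [mul_comm, pow_mul]
  exact Nat.pow_le_pow_left (Nat.le_pow_clog one_lt_two n) e

/-- One round in which every node sends the same message to all nodes. -/
theorem Attains.broadcast {W : Type} [Finite W] (h : Attains b inp t R) {e : ℕ} (he : e ≤ b)
    (hW : Nat.card W ≤ n ^ e) (f : Ω → Fin n → W)
    (hf : ∀ u ω ω', R u ω ω' → f ω u = f ω' u) :
    Attains b inp (t + 1) (fun v ω ω' => R v ω ω' ∧ f ω = f ω') := by
  refine (h.round (hW.trans ((pow_le_two_pow_mul_clog n e).trans (Nat.pow_le_pow_right two_pos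
    (Nat.mul_le_mul_right _ he)))) (fun ω u _ => f ω u) ?_).weaken ?_
  · intro u ω ω' hR
    funext v
    exact hf u ω ω' hR
  · rintro v ω ω' ⟨h1, h2⟩
    exact ⟨h1, funext h2⟩

/-- There are few small sets of words, so a message can carry one. -/
theorem card_small_sets_le (W : Type) [Finite W] (c : ℕ) :
    Nat.card {S : Set W // S.ncard ≤ c} ≤ (Nat.card W + 1) ^ c := by
  have := Fintype.ofFinite W
  have hsurj : Function.Surjective
      (fun f : {f : Fin c → Option W // {w | some w ∈ Set.range f}.ncard ≤ c} =>
      (⟨{w | some w ∈ Set.range f.1}, f.2⟩ : {S : Set W // S.ncard ≤ c})) := by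
    rintro ⟨S, hS⟩
    have : ∃ f : Fin c → Option W, {w | some w ∈ Set.range f} = S := by
      obtain ⟨g⟩ : Nonempty (S ↪ Fin c) := by
        have := Fintype.ofFinite S
        apply Function.Embedding.nonempty_of_card_le
        rwa [Fintype.card_fin, ← Nat.card_eq_fintype_card, Nat.card_coe_set_eq]
      refine ⟨Function.extend g (fun w => some w.1) (fun _ => none), ?_⟩
      ext w
      simp only [Set.mem_range, Set.mem_ofPred_eq]
      constructor
      · rintro ⟨y, hy⟩
        by_cases hyr : ∃ z, g z = y
        · obtain ⟨z, rfl⟩ := hyr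
          rw [g.injective.extend_apply] at hy
          simp only [Option.some.injEq] at hy
          rw [← hy]; exact z.2
        · rw [Function.extend_apply' _ _ _ hyr] at hy
          simp at hy
      · intro hw
        exact ⟨g ⟨w, hw⟩, by rw [g.injective.extend_apply]⟩
    obtain ⟨f, hf⟩ := this
    exact ⟨⟨f, by rw [hf]; exact hS⟩, Subtype.ext hf⟩
  calc Nat.card {S : Set W // S.ncard ≤ c}
      ≤ Nat.card {f : Fin c → Option W // {w | some w ∈ Set.range f}.ncard ≤ c} :=
        Nat.card_le_card_of_surjective _ hsurj
    _ ≤ Nat.card (Fin c → Option W) := Nat.card_le_card_of_injective _ Subtype.val_injective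
    _ = (Nat.card W + 1) ^ c := by
        simp [Nat.card_eq_fintype_card]

/-- One round in which a message is a set of at most `c` words. -/
theorem Attains.hop {W : Type} [Finite W] (h : Attains b inp t R) {e c : ℕ}
    (hec : (e + 1) * c ≤ b) (hn : 2 ≤ n) (hW : Nat.card W ≤ n ^ e)
    (m : Ω → Fin n → Fin n → Set W) (hc : ∀ ω u v, (m ω u v).ncard ≤ c)
    (hm : ∀ u ω ω', R u ω ω' → m ω u = m ω' u) :
    Attains b inp (t + 1) (fun v ω ω' => R v ω ω' ∧ ∀ u, m ω u v = m ω' u v) := by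
  have hcard : Nat.card {S : Set W // S.ncard ≤ c} ≤ 2 ^ (b * Nat.clog 2 n) := by
    refine (card_small_sets_le W c).trans ?_
    have h1 : Nat.card W + 1 ≤ n ^ (e + 1) := by
      have : 1 ≤ n ^ e := Nat.one_le_pow _ _ (by omega)
      rw [pow_succ]; nlinarith
    calc (Nat.card W + 1) ^ c ≤ (n ^ (e + 1)) ^ c := Nat.pow_le_pow_left h1 c
      _ = n ^ ((e + 1) * c) := (pow_mul _ _ _).symm
      _ ≤ n ^ b := Nat.pow_le_pow_right (by omega) hec
      _ ≤ _ := pow_le_two_pow_mul_clog n b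
  refine (h.round hcard (fun ω u v => ⟨m ω u v, hc ω u v⟩) ?_).weaken ?_
  · intro u ω ω' hR
    funext v
    exact Subtype.ext (congrFun (hm u ω ω' hR) v)
  · rintro v ω ω' ⟨h1, h2⟩
    exact ⟨h1, fun u => congrArg Subtype.val (h2 u)⟩

end Knowledge

/-! ### Edge colourings and even distributions -/

section Combinatorics

/-- Greedy edge colouring: if `T` is the edge set of a bipartite multigraph of maximum degree `M`
(with `a` and `b` giving the two ends of an edge), then `2 * M` colours suffice. -/
theorem exists_greedy_edge_coloring {α : Type*} [DecidableEq α] (T : Finset α) (a b : α → ℕ) (M : ℕ)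
    (ha : ∀ x ∈ T, (T.filter (fun y => a y = a x)).card ≤ M)
    (hb : ∀ x ∈ T, (T.filter (fun y => b y = b x)).card ≤ M) :
    ∃ c : α → ℕ, (∀ x ∈ T, c x < 2 * M) ∧
      ∀ x ∈ T, ∀ y ∈ T, x ≠ y → (a x = a y ∨ b x = b y) → c x ≠ c y := by
  induction T using Finset.induction_on with
  | empty => exact ⟨fun _ => 0, by simp, by simp⟩
  | insert x T hx ih =>
    obtain ⟨c, hc1, hc2⟩ := ih
      (fun z hz => (Finset.card_le_card (Finset.filter_subset_filter _ (Finset.subset_insert x T))).trans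
        (ha z (Finset.mem_insert_of_mem hz)))
      (fun z hz => (Finset.card_le_card (Finset.filter_subset_filter _ (Finset.subset_insert x T))).trans
        (hb z (Finset.mem_insert_of_mem hz)))
    have hA := ha x (Finset.mem_insert_self x T)
    have hB := hb x (Finset.mem_insert_self x T)
    rw [Finset.filter_insert, if_pos rfl, Finset.card_insert_of_notMem (by simp [hx])] at hA hB
    set F := (T.filter (fun y => a y = a x) ∪ T.filter (fun y => b y = b x)).image c with hF
    have hFcard : F.card < (Finset.range (2 * M)).card := by
      rw [Finset.card_range]
      have h1 : F.card ≤ _ := Finset.card_image_le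
      have h2 := Finset.card_union_le (T.filter (fun y => a y = a x)) (T.filter (fun y => b y = b x))
      omega
    obtain ⟨k, hk1, hk2⟩ := Finset.exists_mem_notMem_of_card_lt_card hFcard
    have hk : ∀ y ∈ T, (a x = a y ∨ b x = b y) → k ≠ c y := by
      rintro y hy hxy rfl
      apply hk2
      rw [hF, Finset.mem_image]
      refine ⟨y, ?_, rfl⟩
      rw [Finset.mem_union, Finset.mem_filter, Finset.mem_filter]
      rcases hxy with h | h
      · exact Or.inl ⟨hy, h.symm⟩
      · exact Or.inr ⟨hy, h.symm⟩
    refine ⟨Function.update c x k, ?_, ?_⟩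
    · intro y hy'
      rcases Finset.mem_insert.1 hy' with rfl | hy
      · simpa using hk1
      · rw [Function.update_of_ne (by rintro rfl; exact hx hy)]
        exact hc1 y hy
    · intro y hy' z hz' hyz hor
      rcases Finset.mem_insert.1 hy' with rfl | hy <;> rcases Finset.mem_insert.1 hz' with rfl | hz
      · exact absurd rfl hyz
      · rw [Function.update_self, Function.update_of_ne hyz.symm]
        exact hk z hz hor
      · rw [Function.update_self, Function.update_of_ne hyz]
        exact (hk y hy (hor.imp Eq.symm Eq.symm)).symm
      · rw [Function.update_of_ne (by rintro rfl; exact hx hy),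
          Function.update_of_ne (by rintro rfl; exact hx hz)]
        exact hc2 y hy z hz hyz hor

theorem exists_rank {W : Type} [Finite W] (S : Set W) :
    ∃ r : W → ℕ, Set.InjOn r S ∧ (∀ w ∈ S, r w < S.ncard) ∧ ∀ i < S.ncard, ∃ w ∈ S, r w = i := by
  classical
  have := Fintype.ofFinite S
  have e : S ≃ Fin S.ncard := Fintype.equivFinOfCardEq
    (by rw [← Nat.card_eq_fintype_card, Nat.card_coe_set_eq])
  refine ⟨fun w => if h : w ∈ S then e ⟨w, h⟩ else 0, ?_, ?_, ?_⟩
  · intro x hx y hy hxy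
    simp only [hx, hy, dif_pos] at hxy
    simpa using e.injective (Fin.ext hxy)
  · intro w hw
    simp [hw]
  · intro i hi
    exact ⟨e.symm ⟨i, hi⟩, (e.symm ⟨i, hi⟩).2, by simp⟩

/-- The position of an element in a fixed enumeration of the set `S`. -/
noncomputable def rank {W : Type} [Finite W] (S : Set W) : W → ℕ := (exists_rank S).choose

theorem rank_injOn {W : Type} [Finite W] (S : Set W) : Set.InjOn (rank S) S :=
  (exists_rank S).choose_spec.1

theorem rank_lt {W : Type} [Finite W] {S : Set W} {w : W} (h : w ∈ S) : rank S w < S.ncard :=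
  (exists_rank S).choose_spec.2.1 w h

theorem exists_rank_eq {W : Type} [Finite W] {S : Set W} {i : ℕ} (h : i < S.ncard) :
    ∃ w ∈ S, rank S w = i :=
  (exists_rank S).choose_spec.2.2 i h

theorem ncard_mod_class_le {n k q : ℕ} (hn : 0 < n) : {c : ℕ | c < k * n ∧ c % n = q}.ncard ≤ k := by
  have : {c : ℕ | c < k * n ∧ c % n = q}.ncard ≤ (Set.Iio k).ncard := by
    refine Set.ncard_le_ncard_of_injOn (fun c => c / n) ?_ ?_ (Set.finite_Iio k)
    · rintro c ⟨h1, -⟩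
      exact (Nat.div_lt_iff_lt_mul hn).2 h1
    · rintro c ⟨-, h1⟩ d ⟨-, h2⟩ (h : c / n = d / n)
      rw [← Nat.div_add_mod c n, ← Nat.div_add_mod d n, h, h1, h2]
  simpa [Set.ncard_eq_toFinset_card'] using this

/-- A multigraph with `n` bundles of parallel edges, the bundle `p` with `f p` edges and the ends
`a p` and `b p`, of maximum degree `4 * n`: its edges can be distributed over `n` relays such that
every relay gets at most 8 edges at each vertex. -/
theorem exists_relays {n : ℕ} (hn : 0 < n) (f a b : Fin n → ℕ)
    (ha : ∀ g, {x : Fin n × ℕ | x.2 < f x.1 ∧ a x.1 = g}.ncard ≤ 4 * n)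
    (hb : ∀ g, {x : Fin n × ℕ | x.2 < f x.1 ∧ b x.1 = g}.ncard ≤ 4 * n) :
    ∃ κ : Fin n × ℕ → Fin n,
      (∀ g q, {x : Fin n × ℕ | x.2 < f x.1 ∧ a x.1 = g ∧ κ x = q}.ncard ≤ 8) ∧
      ∀ g q, {x : Fin n × ℕ | x.2 < f x.1 ∧ b x.1 = g ∧ κ x = q}.ncard ≤ 8 := by
  classical
  have hfin : {x : Fin n × ℕ | x.2 < f x.1}.Finite := by
    refine ((Set.finite_univ (α := Fin n)).prod (Set.finite_Iio (∑ p, f p))).subset ?_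
    intro x hx
    exact ⟨Set.mem_univ _, lt_of_lt_of_le hx
      (Finset.single_le_sum (f := f) (fun _ _ => Nat.zero_le _) (Finset.mem_univ x.1))⟩
  have hcard : ∀ e : Fin n → ℕ, (∀ g, {x : Fin n × ℕ | x.2 < f x.1 ∧ e x.1 = g}.ncard ≤ 4 * n) →
      ∀ x ∈ hfin.toFinset,
        (hfin.toFinset.filter (fun y => e y.1 = e x.1)).card ≤ 4 * n := by
    intro e he x _
    refine le_trans (le_of_eq ?_) (he (e x.1))
    rw [← Set.ncard_coe_finset]
    congr 1
    ext y
    simp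
  obtain ⟨c, hc1, hc2⟩ := exists_greedy_edge_coloring hfin.toFinset (fun x => a x.1)
    (fun x => b x.1) (4 * n) (hcard a ha) (hcard b hb)
  have hmem : ∀ x : Fin n × ℕ, x ∈ hfin.toFinset ↔ x.2 < f x.1 := by simp
  simp only [hmem] at hc1 hc2
  have key : ∀ e : Fin n → ℕ, (∀ x y : Fin n × ℕ, e x.1 = e y.1 → a x.1 = a y.1 ∨ b x.1 = b y.1) →
      ∀ g q, {x : Fin n × ℕ | x.2 < f x.1 ∧ e x.1 = g ∧
        (⟨c x % n, Nat.mod_lt _ hn⟩ : Fin n) = q}.ncard ≤ 8 := by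
    intro e he g q
    refine (Set.ncard_le_ncard_of_injOn c ?_ ?_ ?_).trans (ncard_mod_class_le (k := 8) (q := q.val) hn)
    · rintro x ⟨h1, -, h3⟩
      exact ⟨by have := hc1 x h1; omega, congrArg Fin.val h3⟩
    · rintro x ⟨h1, h2, -⟩ y ⟨h1', h2', -⟩ hxy
      by_contra hne
      exact hc2 x h1 y h1' hne (he x y (h2.trans h2'.symm)) hxy
    · exact (Set.finite_Iio (8 * n)).subset fun c hc => hc.1
  exact ⟨fun x => ⟨c x % n, Nat.mod_lt _ hn⟩, key a fun _ _ h => Or.inl h, key b fun _ _ h => Or.inr h⟩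

end Combinatorics

/-! ### The grid of nodes

The nodes below `s ^ 2` are arranged in an `s × s` grid, where `s = ⌊√n⌋`; the class of a node is
its residue modulo `s`. -/

section Grid

variable {n : ℕ}

/-- The node at the position `(a, j)` of the grid, with coordinates taken modulo `⌊√n⌋`. -/
def gridNode (hn : 0 < n) (a j : ℕ) : Fin n :=
  ⟨a % Nat.sqrt n + Nat.sqrt n * (j % Nat.sqrt n), by
    have hs : 0 < Nat.sqrt n := Nat.sqrt_pos.2 hn
    have h1 := Nat.mod_lt a hs
    have h2 := Nat.mod_lt j hs
    have h3 := Nat.sqrt_le n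
    nlinarith⟩

theorem gridNode_mod (hn : 0 < n) (a j : ℕ) :
    (gridNode hn a j).val % Nat.sqrt n = a % Nat.sqrt n := by
  simp [gridNode]

theorem gridNode_div (hn : 0 < n) (a j : ℕ) :
    (gridNode hn a j).val / Nat.sqrt n = j % Nat.sqrt n := by
  have hs : 0 < Nat.sqrt n := Nat.sqrt_pos.2 hn
  simp [gridNode, Nat.add_mul_div_left _ _ hs, Nat.div_eq_of_lt (Nat.mod_lt a hs)]

theorem gridNode_eq_iff (hn : 0 < n) {a j a' j' : ℕ} :
    gridNode hn a j = gridNode hn a' j' ↔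
      a % Nat.sqrt n = a' % Nat.sqrt n ∧ j % Nat.sqrt n = j' % Nat.sqrt n := by
  constructor
  · intro h
    rw [← gridNode_mod hn a j, ← gridNode_div hn a j, h, gridNode_mod, gridNode_div]
    exact ⟨rfl, rfl⟩
  · rintro ⟨h1, h2⟩
    simp [gridNode, h1, h2]

theorem lt_four_mul_sqrt_mul_sqrt (hn : 0 < n) : n < 4 * Nat.sqrt n * Nat.sqrt n := by
  have hs : 0 < Nat.sqrt n := Nat.sqrt_pos.2 hn
  have := Nat.lt_succ_sqrt n
  simp only [Nat.succ_eq_add_one] at this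
  nlinarith

theorem ncard_grid_class_le (hn : 0 < n) (g α : ℕ) :
    {w : Fin n | w.val % Nat.sqrt n = g ∧ w.val / Nat.sqrt n % Nat.sqrt n = α}.ncard ≤ 4 := by
  have hs : 0 < Nat.sqrt n := Nat.sqrt_pos.2 hn
  have h4 := lt_four_mul_sqrt_mul_sqrt hn
  refine (Set.ncard_le_ncard_of_injOn (fun w : Fin n => w.val / Nat.sqrt n) ?_ ?_ ?_).trans
    (ncard_mod_class_le (k := 4) (q := α) hs)
  · rintro w ⟨-, h⟩
    exact ⟨(Nat.div_lt_iff_lt_mul hs).2 (w.2.trans h4), h⟩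
  · rintro w ⟨h1, -⟩ w' ⟨h2, -⟩ (h : w.val / _ = w'.val / _)
    apply Fin.ext
    rw [← Nat.div_add_mod w.val (Nat.sqrt n), ← Nat.div_add_mod w'.val (Nat.sqrt n), h, h1, h2]
  · exact (Set.finite_Iio (4 * Nat.sqrt n)).subset fun c hc => hc.1

end Grid

/-! ### Relays for the pairs of a sparse relation -/

section Relays

variable {n : ℕ}

/-- The pairs of the relation `X` whose ends belong to the classes that are given by the coordinates
of `p`. -/
def bundle (hn : 0 < n) (X : Fin n → Set (Fin n)) (p : Fin n) : Set (Fin n × Fin n) :=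
  {e | e.2 ∈ X e.1 ∧ gridNode hn e.1 e.2 = p}

theorem ncard_class_pairs_le (hn : 0 < n) {X : Fin n → Set (Fin n)}
    (hX : ∀ v, (X v).ncard ≤ Nat.sqrt n) (g : ℕ) :
    {e : Fin n × Fin n | e.2 ∈ X e.1 ∧ e.1.val % Nat.sqrt n = g}.ncard ≤ 4 * n := by
  have hs : 0 < Nat.sqrt n := Nat.sqrt_pos.2 hn
  have h4 := lt_four_mul_sqrt_mul_sqrt hn
  have h1 : {e : Fin n × Fin n | e.2 ∈ X e.1 ∧ e.1.val % Nat.sqrt n = g}.ncard ≤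
      (((Finset.range (4 * Nat.sqrt n)) ×ˢ (Finset.range (Nat.sqrt n)) : Finset (ℕ × ℕ)) :
        Set (ℕ × ℕ)).ncard := by
    refine Set.ncard_le_ncard_of_injOn (fun e => (e.1.val / Nat.sqrt n, rank (X e.1) e.2)) ?_ ?_
      (Finset.finite_toSet _)
    · rintro ⟨w, d⟩ ⟨h, -⟩
      simp only [Finset.coe_product, Finset.coe_range, Set.mem_prod, Set.mem_Iio]
      exact ⟨(Nat.div_lt_iff_lt_mul hs).2 (w.2.trans h4), (rank_lt h).trans_le (hX w)⟩
    · rintro ⟨w, d⟩ ⟨h1, h2⟩ ⟨w', d'⟩ ⟨h1', h2'⟩ h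
      simp only [Prod.mk.injEq] at h h1 h2 h1' h2'
      have hw : w = w' := by
        apply Fin.ext
        rw [← Nat.div_add_mod w.val (Nat.sqrt n), ← Nat.div_add_mod w'.val (Nat.sqrt n), h.1, h2, h2']
      subst hw
      rw [rank_injOn (X w) h1 h1' h.2]
  rw [Set.ncard_coe_finset, Finset.card_product, Finset.card_range, Finset.card_range] at h1
  have := Nat.sqrt_le n
  nlinarith

theorem ncard_class_pairs_snd_le (hn : 0 < n) {X : Fin n → Set (Fin n)}
    (hX : ∀ v, (X v).ncard ≤ Nat.sqrt n) (hsymm : ∀ u v, u ∈ X v → v ∈ X u) (g : ℕ) :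
    {e : Fin n × Fin n | e.2 ∈ X e.1 ∧ e.2.val % Nat.sqrt n = g}.ncard ≤ 4 * n := by
  refine le_trans (Set.ncard_le_ncard_of_injOn Prod.swap ?_ Prod.swap_injective.injOn
    (Set.toFinite _)) (ncard_class_pairs_le hn hX g)
  rintro ⟨w, d⟩ ⟨h1, h2⟩
  exact ⟨hsymm _ _ h1, h2⟩

/-- `κ` distributes the edges of the multigraph with bundle sizes `f` evenly over the relays: the
bundle `p` joins the two classes that are the coordinates of the grid node `p`, and a relay gets at
most 8 edges at each class. -/
def IsBalanced (f : Fin n → ℕ) (κ : Fin n × ℕ → Fin n) : Prop :=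
  (∀ g q, {x : Fin n × ℕ | x.2 < f x.1 ∧ x.1.val % Nat.sqrt n = g ∧ κ x = q}.ncard ≤ 8) ∧
    ∀ g q, {x : Fin n × ℕ | x.2 < f x.1 ∧ x.1.val / Nat.sqrt n = g ∧ κ x = q}.ncard ≤ 8

open Classical in
/-- A balanced choice of relays; it depends on the sizes of the bundles only, so all nodes that know
these make the same choice. The value is arbitrary if there is no balanced choice. -/
noncomputable def balancedRelay (hn : 0 < n) (f : Fin n → ℕ) : Fin n × ℕ → Fin n :=
  if h : ∃ κ, IsBalanced f κ then h.choose else fun _ => ⟨0, hn⟩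

/-- The relay for the pair `e` of the relation `X`. -/
noncomputable def edgeRelay (hn : 0 < n) (X : Fin n → Set (Fin n)) (e : Fin n × Fin n) : Fin n :=
  balancedRelay hn (fun p => (bundle hn X p).ncard)
    (gridNode hn e.1 e.2, rank (bundle hn X (gridNode hn e.1 e.2)) e)

theorem isBalanced_balancedRelay (hn : 0 < n) {X : Fin n → Set (Fin n)}
    (hX : ∀ v, (X v).ncard ≤ Nat.sqrt n) (hsymm : ∀ u v, u ∈ X v → v ∈ X u) :
    IsBalanced (fun p => (bundle hn X p).ncard)
      (balancedRelay hn (fun p => (bundle hn X p).ncard)) := by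
  have hex : ∃ κ, IsBalanced (fun p => (bundle hn X p).ncard) κ := by
    have key : ∀ (a : Fin n → ℕ) (c : Fin n × Fin n → ℕ), (∀ e, a (gridNode hn e.1 e.2) = c e) →
        ∀ g, {e : Fin n × Fin n | e.2 ∈ X e.1 ∧ c e = g}.ncard ≤ 4 * n →
        {x : Fin n × ℕ | x.2 < (bundle hn X x.1).ncard ∧ a x.1 = g}.ncard ≤ 4 * n := by
      intro a c hac g hg
      refine le_trans ?_ hg
      refine le_trans (Set.ncard_le_ncard (t := (fun e : Fin n × Fin n =>
        (gridNode hn e.1 e.2, rank (bundle hn X (gridNode hn e.1 e.2)) e)) '' _) ?_ (Set.toFinite _))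
        (Set.ncard_image_le (Set.toFinite _))
      rintro ⟨p, m⟩ ⟨h1, h2⟩
      simp only at h1 h2
      obtain ⟨e, ⟨he1, he2⟩, he3⟩ := exists_rank_eq h1
      subst he2 he3
      exact ⟨e, ⟨he1, by rw [← hac]; exact h2⟩, rfl⟩
    refine exists_relays hn (fun p => (bundle hn X p).ncard) (fun p => p.val % Nat.sqrt n)
      (fun p => p.val / Nat.sqrt n) ?_ ?_
    · exact fun g => key (fun p => p.val % Nat.sqrt n) (fun e => e.1.val % Nat.sqrt n)
        (fun e => gridNode_mod hn _ _) g
        (ncard_class_pairs_le hn hX g)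
    · exact fun g => key (fun p => p.val / Nat.sqrt n) (fun e => e.2.val % Nat.sqrt n)
        (fun e => gridNode_div hn _ _) g
        (ncard_class_pairs_snd_le hn hX hsymm g)
  rw [balancedRelay, dif_pos hex]
  exact hex.choose_spec

theorem ncard_edgeRelay_le (hn : 0 < n) {X : Fin n → Set (Fin n)}
    (hX : ∀ v, (X v).ncard ≤ Nat.sqrt n) (hsymm : ∀ u v, u ∈ X v → v ∈ X u) (g : ℕ) (q : Fin n) :
    {e : Fin n × Fin n | e.2 ∈ X e.1 ∧ e.1.val % Nat.sqrt n = g ∧ edgeRelay hn X e = q}.ncard ≤ 8 ∧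
    {e : Fin n × Fin n | e.2 ∈ X e.1 ∧ e.2.val % Nat.sqrt n = g ∧ edgeRelay hn X e = q}.ncard ≤ 8 := by
  obtain ⟨h1, h2⟩ := isBalanced_balancedRelay hn hX hsymm
  have hfin : ∀ P : Fin n × ℕ → Prop,
      {x : Fin n × ℕ | x.2 < (bundle hn X x.1).ncard ∧ P x}.Finite := by
    intro P
    refine ((Set.finite_univ (α := Fin n)).prod
      (Set.finite_Iio (∑ p, (bundle hn X p).ncard))).subset ?_
    intro x hx
    exact ⟨Set.mem_univ _, lt_of_lt_of_le hx.1
      (Finset.single_le_sum (f := fun p => (bundle hn X p).ncard) (fun _ _ => Nat.zero_le _)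
        (Finset.mem_univ x.1))⟩
  have hinj : Set.InjOn (fun e : Fin n × Fin n =>
      (gridNode hn e.1 e.2, rank (bundle hn X (gridNode hn e.1 e.2)) e)) {e | e.2 ∈ X e.1} := by
    rintro e he e' he' h
    simp only [Prod.mk.injEq] at h
    obtain ⟨ha, hb⟩ := h
    rw [ha] at hb
    have h1 : e ∈ bundle hn X (gridNode hn e'.1 e'.2) := ⟨he, ha⟩
    have h2 : e' ∈ bundle hn X (gridNode hn e'.1 e'.2) := ⟨he', rfl⟩
    exact rank_injOn _ h1 h2 hb
  constructor
  · refine (Set.ncard_le_ncard_of_injOn _ ?_ (hinj.mono fun e he => he.1) (hfin _)).trans (h1 g q)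
    rintro e ⟨ha, hb, hc⟩
    exact ⟨rank_lt ⟨ha, rfl⟩, by rw [← hb]; exact gridNode_mod hn _ _, hc⟩
  · refine (Set.ncard_le_ncard_of_injOn _ ?_ (hinj.mono fun e he => he.1) (hfin _)).trans (h2 g q)
    rintro e ⟨ha, hb, hc⟩
    exact ⟨rank_lt ⟨ha, rfl⟩, by rw [← hb]; exact gridNode_div hn _ _, hc⟩

end Relays

/-! ### Preparing the exchange -/

section Exchange

variable {b n : ℕ} {Ω I : Type} {inp : Ω → Fin n → I} {t : ℕ} {R : Fin n → Ω → Ω → Prop}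

theorem rank_eq_of_mod_eq {W : Type} [Finite W] {S S' : Set W} {x y : W} {s : ℕ} (hx : x ∈ S)
    (hy : y ∈ S') (hS : S.ncard ≤ s) (hS' : S'.ncard ≤ s) (h : rank S x % s = rank S' y % s) :
    rank S x = rank S' y := by
  rwa [Nat.mod_eq_of_lt ((rank_lt hx).trans_le hS), Nat.mod_eq_of_lt ((rank_lt hy).trans_le hS')] at h

/-- Every grid node learns the sets `X w` of all nodes `w` in its class: `w` sends one element of
`X w` to each of at most `√n` grid nodes, which forward it to the whole class. -/
theorem Attains.collect (h : Attains b inp t R) (hb : 12 ≤ b) (hn : 0 < n) (hn2 : 2 ≤ n)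
    (X : Ω → Fin n → Set (Fin n)) (hX : ∀ v ω ω', R v ω ω' → X ω v = X ω' v)
    (hXs : ∀ ω v, (X ω v).ncard ≤ Nat.sqrt n) :
    Attains b inp (t + 2) (fun v ω ω' => R v ω ω' ∧
      ∀ w : Fin n, ∀ i, v = gridNode hn w i → X ω w = X ω' w) := by
  have hcard : Nat.card (Fin n × Fin n) ≤ n ^ 2 := by simp [pow_two]
  have h1 := h.hop (e := 2) (c := 1) (by omega) hn2 hcard
    (fun ω w q => {y | y.1 = w ∧ y.2 ∈ X ω w ∧
      q = gridNode hn (w.val / Nat.sqrt n) (rank (X ω w) y.2)}) ?_ ?_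
  · have h2 := h1.hop (e := 2) (c := 4) (by omega) hn2 hcard
      (fun ω q v => {y | y.2 ∈ X ω y.1 ∧
        q = gridNode hn (y.1.val / Nat.sqrt n) (rank (X ω y.1) y.2) ∧
        ∃ i, v = gridNode hn y.1 i}) ?_ ?_
    · refine h2.weaken ?_
      rintro v ω ω' ⟨⟨hR, -⟩, h2⟩
      refine ⟨hR, fun w i hv => ?_⟩
      have key : ∀ ω ω' : Ω, (∀ q, {y : Fin n × Fin n | y.2 ∈ X ω y.1 ∧
          q = gridNode hn (y.1.val / Nat.sqrt n) (rank (X ω y.1) y.2) ∧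
          ∃ i, v = gridNode hn y.1 i} = {y : Fin n × Fin n | y.2 ∈ X ω' y.1 ∧
          q = gridNode hn (y.1.val / Nat.sqrt n) (rank (X ω' y.1) y.2) ∧
          ∃ i, v = gridNode hn y.1 i}) → X ω w ⊆ X ω' w := by
        intro ω ω' hq x hx
        have := hq (gridNode hn (w.val / Nat.sqrt n) (rank (X ω w) x))
        have hmem : (w, x) ∈ {y : Fin n × Fin n | y.2 ∈ X ω y.1 ∧
          gridNode hn (w.val / Nat.sqrt n) (rank (X ω w) x) =
            gridNode hn (y.1.val / Nat.sqrt n) (rank (X ω y.1) y.2) ∧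
          ∃ i, v = gridNode hn y.1 i} := ⟨hx, rfl, i, hv⟩
        rw [this] at hmem
        exact hmem.1
      exact Set.Subset.antisymm (key ω ω' h2) (key ω' ω fun q => (h2 q).symm)
    · intro ω q v
      refine le_trans ?_ (ncard_grid_class_le hn (v.val % Nat.sqrt n) (q.val % Nat.sqrt n))
      refine Set.ncard_le_ncard_of_injOn Prod.fst ?_ ?_ (Set.toFinite _)
      · rintro ⟨w, x⟩ ⟨-, hq, i, hv⟩
        simp only at hq hv
        refine ⟨?_, ?_⟩
        · rw [hv, gridNode_mod]
        · rw [hq, gridNode_mod]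
      · rintro ⟨w, x⟩ ⟨ha, hb, -⟩ ⟨w', x'⟩ ⟨ha', hb', -⟩ (hw : w = w')
        subst hw
        simp only at ha hb ha' hb'
        have := (gridNode_eq_iff hn).1 (hb.symm.trans hb')
        rw [rank_injOn _ ha ha' (rank_eq_of_mod_eq ha ha' (hXs ω w) (hXs ω w) this.2)]
    · rintro q ω ω' ⟨-, hq⟩
      funext v
      ext ⟨w, x⟩
      have := Set.ext_iff.1 (hq w) (w, x)
      simp only [Set.mem_ofPred_eq, true_and] at this ⊢
      rw [← and_assoc, this, and_assoc]
  · intro ω w q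
    rw [Set.ncard_le_one]
    rintro ⟨w, x⟩ ⟨rfl, ha, hb⟩ ⟨w', x'⟩ ⟨hw, ha', hb'⟩
    simp only at hw ha hb ha' hb'
    subst hw
    have := (gridNode_eq_iff hn).1 (hb.symm.trans hb')
    rw [rank_injOn _ ha ha' (rank_eq_of_mod_eq ha ha' (hXs ω _) (hXs ω _) this.2)]
  · intro w ω ω' hR
    funext q
    simp only [hX w ω ω' hR]

/-- The words of every node are spread over the grid nodes in its class. -/
theorem Attains.spread {W : Type} [Finite W] (h : Attains b inp t R) (hb : 3 ≤ b) (hn : 0 < n)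
    (hn2 : 2 ≤ n) (hW : Nat.card W ≤ n ^ 2)
    (Y : Ω → Fin n → Set W) (hY : ∀ v ω ω', R v ω ω' → Y ω v = Y ω' v)
    (hYs : ∀ ω v, (Y ω v).ncard ≤ Nat.sqrt n) :
    Attains b inp (t + 1) (fun v ω ω' => R v ω ω' ∧
      ∀ w : Fin n, {y | y ∈ Y ω w ∧ v = gridNode hn w (rank (Y ω w) y)} =
        {y | y ∈ Y ω' w ∧ v = gridNode hn w (rank (Y ω' w) y)}) := by
  refine h.hop (e := 2) (c := 1) (by omega) hn2 hW
    (fun ω w v => {y | y ∈ Y ω w ∧ v = gridNode hn w (rank (Y ω w) y)}) ?_ ?_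
  · intro ω w q
    rw [Set.ncard_le_one]
    rintro x ⟨ha, hb⟩ x' ⟨ha', hb'⟩
    have := (gridNode_eq_iff hn).1 (hb.symm.trans hb')
    exact rank_injOn _ ha ha' (rank_eq_of_mod_eq ha ha' (hYs ω _) (hYs ω _) this.2)
  · intro w ω ω' hR
    funext q
    simp only [hY w ω ω' hR]

/-- All nodes learn the relays for the pairs in their class: the sizes of the bundles are
broadcast. -/
theorem Attains.agree_on_relays (h : Attains b inp t R) (hb : 3 ≤ b) (hn : 0 < n)
    (hn2 : 2 ≤ n) (X : Ω → Fin n → Set (Fin n))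
    (hX : ∀ v ω ω', R v ω ω' → ∀ w : Fin n, ∀ i, v = gridNode hn w i → X ω w = X ω' w) :
    Attains b inp (t + 1) (fun v ω ω' => R v ω ω' ∧
      ∀ w d : Fin n, ∀ i, v = gridNode hn w i →
        edgeRelay hn (X ω) (w, d) = edgeRelay hn (X ω') (w, d)) := by
  have hbound : ∀ ω p, (bundle hn (X ω) p).ncard < n ^ 2 + 1 := by
    intro ω p
    have := Set.ncard_le_ncard (Set.subset_univ (bundle hn (X ω) p)) (Set.toFinite _)
    rw [Set.ncard_univ] at this
    simp only [Nat.card_eq_fintype_card, Fintype.card_prod, Fintype.card_fin] at this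
    nlinarith
  have hbun : ∀ ω ω' (g : Fin n), (∀ w : Fin n, w.val % Nat.sqrt n = g % Nat.sqrt n → X ω w = X ω' w) →
      ∀ p : Fin n, p.val % Nat.sqrt n = g % Nat.sqrt n → bundle hn (X ω) p = bundle hn (X ω') p := by
    intro ω ω' g hg p hp
    ext ⟨w, d⟩
    simp only [bundle, Set.mem_ofPred_eq]
    constructor <;>
    · rintro ⟨h1, rfl⟩
      rw [gridNode_mod] at hp
      exact ⟨by simpa [hg w hp] using h1, rfl⟩
  have hclass : ∀ v ω ω', R v ω ω' → (∃ w : Fin n, ∃ i, v = gridNode hn w i) →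
      ∀ w : Fin n, w.val % Nat.sqrt n = v % Nat.sqrt n → X ω w = X ω' w := by
    rintro v ω ω' hR ⟨w, i, rfl⟩ w' hw'
    refine hX _ ω ω' hR w' i ?_
    rw [gridNode_mod] at hw'
    rw [gridNode_eq_iff]
    exact ⟨hw'.symm, rfl⟩
  refine (h.broadcast (W := Fin (n ^ 2 + 1)) (e := 3) hb ?_
    (fun ω p => ⟨(bundle hn (X ω) p).ncard, hbound ω p⟩) ?_).weaken ?_
  · simp only [Nat.card_eq_fintype_card, Fintype.card_fin]
    nlinarith [pow_pos hn 2]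
  · intro p ω ω' hR
    simp only [Fin.mk.injEq]
    by_cases hp : ∃ w : Fin n, ∃ i, p = gridNode hn w i
    · rw [hbun ω ω' p (hclass p ω ω' hR hp) p rfl]
    · have hempty : ∀ ω, bundle hn (X ω) p = ∅ := by
        intro ω
        ext ⟨w, d⟩
        simp only [bundle, Set.mem_ofPred_eq, Set.mem_empty_iff_false, iff_false]
        rintro ⟨-, h⟩
        exact hp ⟨w, d, h.symm⟩
      rw [hempty, hempty]
  · rintro v ω ω' ⟨hR, hf⟩
    refine ⟨hR, fun w d i hv => ?_⟩
    have hf' : (fun p => (bundle hn (X ω) p).ncard) = fun p => (bundle hn (X ω') p).ncard := by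
      funext p
      have := congrFun hf p
      simpa using this
    have : bundle hn (X ω) (gridNode hn w d) = bundle hn (X ω') (gridNode hn w d) := by
      refine hbun ω ω' v (hclass v ω ω' hR ⟨w, i, hv⟩) _ ?_
      rw [hv, gridNode_mod, gridNode_mod]
    simp only [edgeRelay, hf', this]

end Exchange

/-! ### Exchanging data along a sparse symmetric relation -/

section Exchange

variable {b n : ℕ} {Ω I : Type} {inp : Ω → Fin n → I} {t : ℕ} {R : Fin n → Ω → Ω → Prop}

/-- The words to be delivered: `(w, d, y)` stands for the word `y` that `w` has for `d`. -/
def words {W : Type} (X : Fin n → Set (Fin n)) (Y : Fin n → Set W) : Set (Fin n × Fin n × W) :=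
  {x | x.2.1 ∈ X x.1 ∧ x.2.2 ∈ Y x.1}

/-- Let `X` be a symmetric relation of degree at most `√n`, and let each node have at most `√n`
words. In a constant number of rounds each node learns the words of all nodes that are related
to it: a word of `w` for `d` goes from a grid node in the class of `w` to the relay of the pair
`(w, d)`, from there to a grid node in the class of `d`, and over one more grid node to `d`. At most
8 words have to pass between any two nodes in a round. -/
theorem Attains.exchange {W : Type} [Finite W] (h : Attains b inp t R) (hb : 40 ≤ b)
    (hn2 : 2 ≤ n) (hW : Nat.card W ≤ n ^ 2)
    (X : Ω → Fin n → Set (Fin n)) (hX : ∀ v ω ω', R v ω ω' → X ω v = X ω' v)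
    (hXs : ∀ ω v, (X ω v).ncard ≤ Nat.sqrt n) (hsymm : ∀ ω u v, u ∈ X ω v → v ∈ X ω u)
    (Y : Ω → Fin n → Set W) (hY : ∀ v ω ω', R v ω ω' → Y ω v = Y ω' v)
    (hYs : ∀ ω v, (Y ω v).ncard ≤ Nat.sqrt n) :
    Attains b inp (t + 8) (fun v ω ω' => R v ω ω' ∧ ∀ w ∈ X ω v, Y ω w = Y ω' w) := by
  have hn : 0 < n := by omega
  have hcard : Nat.card (Fin n × Fin n × W) ≤ n ^ 4 := by
    rw [Nat.card_prod, Nat.card_prod, Nat.card_eq_fintype_card, Fintype.card_fin]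
    calc n * (n * Nat.card W) ≤ n * (n * n ^ 2) := by gcongr
      _ = n ^ 4 := by ring
  -- the position of a word in the list of its owner, and the relay for the last leg of its way
  set ρ : Ω → Fin n × Fin n × W → ℕ := fun ω x => rank (Y ω x.1) x.2.2 with hρ
  set last : Ω → Fin n × Fin n × W → Fin n := fun ω x =>
    gridNode hn (x.2.1.val / Nat.sqrt n + ρ ω x) (rank (X ω x.2.1) x.1) with hlast
  have hρmod : ∀ ω ω' x x', x ∈ words (X ω) (Y ω) → x' ∈ words (X ω') (Y ω') →
      ρ ω x % Nat.sqrt n = ρ ω' x' % Nat.sqrt n → ρ ω x = ρ ω' x' := by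
    intro ω ω' x x' hx hx' h
    exact rank_eq_of_mod_eq hx.2 hx'.2 (hYs _ _) (hYs _ _) h
  have hfst : ∀ ω x x', x ∈ words (X ω) (Y ω) → x' ∈ words (X ω) (Y ω) → x.2.1 = x'.2.1 →
      rank (X ω x.2.1) x.1 % Nat.sqrt n = rank (X ω x'.2.1) x'.1 % Nat.sqrt n → x.1 = x'.1 := by
    intro ω x x' hx hx' h h'
    rw [← h] at h'
    have hx1 := hsymm ω _ _ hx.1
    have hx2 := hsymm ω _ _ hx'.1
    rw [← h] at hx2
    exact rank_injOn _ hx1 hx2 (rank_eq_of_mod_eq hx1 hx2 (hXs _ _) (hXs _ _) h')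
  have hsnd : ∀ ω x x', x ∈ words (X ω) (Y ω) → x' ∈ words (X ω) (Y ω) → x.1 = x'.1 →
      x.2.1 = x'.2.1 → ρ ω x = ρ ω x' → x = x' := by
    rintro ω ⟨w, d, y⟩ ⟨w', d', y'⟩ hx hx' h1 h2 h3
    simp only at h1 h2
    subst h1 h2
    simp only [Prod.mk.injEq, true_and]
    exact rank_injOn _ hx.2 hx'.2 h3
  have h3 := (((h.collect (by omega) hn hn2 X hX hXs).spread (by omega) hn hn2 hW Y
    (fun v ω ω' hR => hY v ω ω' hR.1) hYs).agree_on_relays (by omega) hn hn2 X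
    (fun v ω ω' hR => hR.1.2))
  -- the grid nodes in the class of `w` send the words of `w` to the relays
  have h4 := h3.hop (e := 4) (c := 8) (by omega) hn2 hcard
    (fun ω u p => {x | x ∈ words (X ω) (Y ω) ∧ u = gridNode hn x.1 (ρ ω x) ∧
      edgeRelay hn (X ω) (x.1, x.2.1) = p}) ?_ ?_
  rotate_left
  · intro ω u p
    refine le_trans ?_ (ncard_edgeRelay_le hn (hXs ω) (hsymm ω) (u.val % Nat.sqrt n) p).1
    refine Set.ncard_le_ncard_of_injOn (fun x => (x.1, x.2.1)) ?_ ?_ (Set.toFinite _)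
    · rintro x ⟨hx, hu, hp⟩
      exact ⟨hx.1, by rw [hu, gridNode_mod], hp⟩
    · rintro x ⟨hx, hu, hp⟩ x' ⟨hx', hu', hp'⟩ hxx
      simp only [Prod.mk.injEq] at hxx
      exact hsnd ω x x' hx hx' hxx.1 hxx.2
        (hρmod ω ω x x' hx hx' ((gridNode_eq_iff hn).1 (hu.symm.trans hu')).2)
  · rintro u ω ω' ⟨⟨⟨-, hX'⟩, hY'⟩, hE⟩
    have key : ∀ ω ω' : Ω, (∀ w : Fin n, ∀ i, u = gridNode hn w i → X ω w = X ω' w) →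
        (∀ w : Fin n, {y | y ∈ Y ω w ∧ u = gridNode hn w (rank (Y ω w) y)} =
          {y | y ∈ Y ω' w ∧ u = gridNode hn w (rank (Y ω' w) y)}) →
        (∀ w d : Fin n, ∀ i, u = gridNode hn w i →
          edgeRelay hn (X ω) (w, d) = edgeRelay hn (X ω') (w, d)) → ∀ p,
        {x | x ∈ words (X ω) (Y ω) ∧ u = gridNode hn x.1 (ρ ω x) ∧
          edgeRelay hn (X ω) (x.1, x.2.1) = p} ⊆
        {x | x ∈ words (X ω') (Y ω') ∧ u = gridNode hn x.1 (ρ ω' x) ∧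
          edgeRelay hn (X ω') (x.1, x.2.1) = p} := by
      rintro ω ω' h1 h2 h3 p ⟨w, d, y⟩ ⟨⟨hx1, hx2⟩, hu, hp⟩
      simp only at hx1 hx2 hu hp
      have : y ∈ {y | y ∈ Y ω w ∧ u = gridNode hn w (rank (Y ω w) y)} := ⟨hx2, hu⟩
      rw [h2] at this
      exact ⟨⟨by simpa [← h1 w _ hu] using hx1, this.1⟩, this.2, by rw [← h3 w d _ hu]; exact hp⟩
    funext p
    exact Set.Subset.antisymm (key ω ω' hX' hY' hE p)
      (key ω' ω (fun w i hi => (hX' w i hi).symm) (fun w => (hY' w).symm)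
        (fun w d i hi => (hE w d i hi).symm) p)
  -- the relays send them to the grid nodes in the class of the destination
  have h5 := h4.hop (e := 4) (c := 8) (by omega) hn2 hcard
    (fun ω p v => {x | x ∈ words (X ω) (Y ω) ∧ edgeRelay hn (X ω) (x.1, x.2.1) = p ∧
      v = gridNode hn x.2.1 (ρ ω x)}) ?_ ?_
  rotate_left
  · intro ω p v
    refine le_trans ?_ (ncard_edgeRelay_le hn (hXs ω) (hsymm ω) (v.val % Nat.sqrt n) p).2
    refine Set.ncard_le_ncard_of_injOn (fun x => (x.1, x.2.1)) ?_ ?_ (Set.toFinite _)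
    · rintro x ⟨hx, hp, hv⟩
      exact ⟨hx.1, by rw [hv, gridNode_mod], hp⟩
    · rintro x ⟨hx, hp, hv⟩ x' ⟨hx', hp', hv'⟩ hxx
      simp only [Prod.mk.injEq] at hxx
      exact hsnd ω x x' hx hx' hxx.1 hxx.2
        (hρmod ω ω x x' hx hx' ((gridNode_eq_iff hn).1 (hv.symm.trans hv')).2)
  · rintro p ω ω' ⟨-, hC⟩
    have key : ∀ ω ω' : Ω, (∀ u,
        {x | x ∈ words (X ω) (Y ω) ∧ u = gridNode hn x.1 (ρ ω x) ∧
          edgeRelay hn (X ω) (x.1, x.2.1) = p} =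
        {x | x ∈ words (X ω') (Y ω') ∧ u = gridNode hn x.1 (ρ ω' x) ∧
          edgeRelay hn (X ω') (x.1, x.2.1) = p}) → ∀ v,
        {x | x ∈ words (X ω) (Y ω) ∧ edgeRelay hn (X ω) (x.1, x.2.1) = p ∧
          v = gridNode hn x.2.1 (ρ ω x)} ⊆
        {x | x ∈ words (X ω') (Y ω') ∧ edgeRelay hn (X ω') (x.1, x.2.1) = p ∧
          v = gridNode hn x.2.1 (ρ ω' x)} := by
      rintro ω ω' hC v x ⟨hx, hp, hv⟩
      have hmem : x ∈ {x' | x' ∈ words (X ω) (Y ω) ∧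
        gridNode hn x.1 (ρ ω x) = gridNode hn x'.1 (ρ ω x') ∧
          edgeRelay hn (X ω) (x'.1, x'.2.1) = p} := ⟨hx, rfl, hp⟩
      rw [hC] at hmem
      obtain ⟨hx', hu, hp'⟩ := hmem
      exact ⟨hx', hp', by rw [← hρmod ω ω' x x hx hx' ((gridNode_eq_iff hn).1 hu).2]; exact hv⟩
    funext v
    exact Set.Subset.antisymm (key ω ω' hC v) (key ω' ω (fun u => (hC u).symm) v)
  have h6 := h5.hop (e := 4) (c := 4) (by omega) hn2 hcard
    (fun ω v q => {x | x ∈ words (X ω) (Y ω) ∧ v = gridNode hn x.2.1 (ρ ω x) ∧ q = last ω x}) ?_ ?_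
  rotate_left
  · intro ω v q
    -- the first coordinate of `q` and the second one of `v` determine the row of the destination
    rcases Set.eq_empty_or_nonempty {x | x ∈ words (X ω) (Y ω) ∧ v = gridNode hn x.2.1 (ρ ω x) ∧
      q = last ω x} with he | ⟨x₀, hx₀, hv₀, hq₀⟩
    · rw [he]; simp
    refine le_trans ?_ (ncard_grid_class_le hn (v.val % Nat.sqrt n)
      (x₀.2.1.val / Nat.sqrt n % Nat.sqrt n))
    refine Set.ncard_le_ncard_of_injOn (fun x => x.2.1) ?_ ?_ (Set.toFinite _)
    · rintro x ⟨hx, hv, hq⟩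
      refine ⟨by rw [hv, gridNode_mod], ?_⟩
      have h1 := hρmod ω ω x x₀ hx hx₀ ((gridNode_eq_iff hn).1 (hv.symm.trans hv₀)).2
      have h2 := ((gridNode_eq_iff hn).1 (hq.symm.trans hq₀)).1
      rw [h1] at h2
      exact Nat.ModEq.add_right_cancel' _ h2
    · rintro x ⟨hx, hv, hq⟩ x' ⟨hx', hv', hq'⟩ hxx
      have h1 := hρmod ω ω x x' hx hx' ((gridNode_eq_iff hn).1 (hv.symm.trans hv')).2
      have h2 := ((gridNode_eq_iff hn).1 (hq.symm.trans hq')).2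
      exact hsnd ω x x' hx hx' (hfst ω x x' hx hx' hxx h2) hxx h1
  · rintro v ω ω' ⟨⟨⟨⟨⟨-, hX'⟩, -⟩, -⟩, -⟩, hD⟩
    have key : ∀ ω ω' : Ω, (∀ w : Fin n, ∀ i, v = gridNode hn w i → X ω w = X ω' w) → (∀ p,
        {x | x ∈ words (X ω) (Y ω) ∧ edgeRelay hn (X ω) (x.1, x.2.1) = p ∧
          v = gridNode hn x.2.1 (ρ ω x)} =
        {x | x ∈ words (X ω') (Y ω') ∧ edgeRelay hn (X ω') (x.1, x.2.1) = p ∧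
          v = gridNode hn x.2.1 (ρ ω' x)}) → ∀ q,
        {x | x ∈ words (X ω) (Y ω) ∧ v = gridNode hn x.2.1 (ρ ω x) ∧ q = last ω x} ⊆
        {x | x ∈ words (X ω') (Y ω') ∧ v = gridNode hn x.2.1 (ρ ω' x) ∧ q = last ω' x} := by
      rintro ω ω' hX' hD q x ⟨hx, hv, hq⟩
      have hmem : x ∈ {x' | x' ∈ words (X ω) (Y ω) ∧
        edgeRelay hn (X ω) (x'.1, x'.2.1) = edgeRelay hn (X ω) (x.1, x.2.1) ∧
          v = gridNode hn x'.2.1 (ρ ω x')} := ⟨hx, rfl, hv⟩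
      rw [hD] at hmem
      obtain ⟨hx', -, hv'⟩ := hmem
      refine ⟨hx', hv', ?_⟩
      have h1 := hρmod ω ω' x x hx hx' ((gridNode_eq_iff hn).1 (hv.symm.trans hv')).2
      rw [hq]
      simp only [hlast, h1, hX' _ _ hv]
    funext q
    exact Set.Subset.antisymm (key ω ω' hX' hD q)
      (key ω' ω (fun w i hi => (hX' w i hi).symm) (fun p => (hD p).symm) q)
  have h7 := h6.hop (e := 4) (c := 1) (by omega) hn2 hcard
    (fun ω q d => {x | x ∈ words (X ω) (Y ω) ∧ q = last ω x ∧ d = x.2.1}) ?_ ?_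
  rotate_left
  · intro ω q d
    rw [Set.ncard_le_one]
    rintro x ⟨hx, hq, hd⟩ x' ⟨hx', hq', hd'⟩
    have hxx := hd.symm.trans hd'
    have h1 := (gridNode_eq_iff hn).1 (hq.symm.trans hq')
    refine hsnd ω x x' hx hx' (hfst ω x x' hx hx' hxx h1.2) hxx (hρmod ω ω x x' hx hx' ?_)
    have h2 := h1.1
    rw [hxx] at h2
    exact Nat.ModEq.add_left_cancel' _ h2
  · rintro q ω ω' ⟨-, hE⟩
    have key : ∀ ω ω' : Ω, (∀ v,
        {x | x ∈ words (X ω) (Y ω) ∧ v = gridNode hn x.2.1 (ρ ω x) ∧ q = last ω x} =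
        {x | x ∈ words (X ω') (Y ω') ∧ v = gridNode hn x.2.1 (ρ ω' x) ∧ q = last ω' x}) → ∀ d,
        {x | x ∈ words (X ω) (Y ω) ∧ q = last ω x ∧ d = x.2.1} ⊆
        {x | x ∈ words (X ω') (Y ω') ∧ q = last ω' x ∧ d = x.2.1} := by
      rintro ω ω' hE d x ⟨hx, hq, hd⟩
      have hmem : x ∈ {x' | x' ∈ words (X ω) (Y ω) ∧
        gridNode hn x.2.1 (ρ ω x) = gridNode hn x'.2.1 (ρ ω x') ∧ q = last ω x'} := ⟨hx, rfl, hq⟩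
      rw [hE] at hmem
      exact ⟨hmem.1, hmem.2.2, hd⟩
    funext d
    exact Set.Subset.antisymm (key ω ω' hE d) (key ω' ω (fun v => (hE v).symm) d)
  refine h7.weaken ?_
  rintro v ω ω' ⟨⟨⟨⟨⟨⟨⟨hR, -⟩, -⟩, -⟩, -⟩, -⟩, -⟩, hF⟩
  refine ⟨hR, fun w hw => ?_⟩
  have key : ∀ ω ω' : Ω, w ∈ X ω v → (∀ q,
      {x | x ∈ words (X ω) (Y ω) ∧ q = last ω x ∧ v = x.2.1} =
      {x | x ∈ words (X ω') (Y ω') ∧ q = last ω' x ∧ v = x.2.1}) → Y ω w ⊆ Y ω' w := by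
    intro ω ω' hw hF y hy
    have hmem : (w, v, y) ∈ {x | x ∈ words (X ω) (Y ω) ∧ last ω (w, v, y) = last ω x ∧ v = x.2.1} :=
      ⟨⟨hsymm _ _ _ hw, hy⟩, rfl, rfl⟩
    rw [hF] at hmem
    exact hmem.1.2
  have hw' : w ∈ X ω' v := by rw [← hX v ω ω' hR]; exact hw
  exact Set.Subset.antisymm (key ω ω' hw hF) (key ω' ω hw' fun q => (hF q).symm)

end Exchange

end CongestedClique

namespace DenseRegion

open CongestedClique

/-! ### Balls, distances and nearest centers -/

section Distances

theorem exists_edist_eq_of_le {V : Type*} {G : SimpleGraph V} {u v : V} {d : ℕ}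
    (h : G.edist u v ≤ (d : ℕ∞)) : ∃ e : ℕ, e ≤ d ∧ G.edist u v = (e : ℕ∞) := by
  obtain ⟨e, he, hle⟩ := ENat.le_natCast_iff.1 h
  exact ⟨e, hle, he⟩

theorem edist_le_add {V : Type*} {G : SimpleGraph V} {u v w : V} {d e : ℕ}
    (h : G.edist u v ≤ (d : ℕ∞)) (h' : G.edist v w ≤ (e : ℕ∞)) :
    G.edist u w ≤ ((d + e : ℕ) : ℕ∞) := by
  push_cast
  exact G.edist_triangle.trans (add_le_add h h')

theorem exists_edist_eq_and_edist_eq {V : Type*} {G : SimpleGraph V} {u v : V} {d i : ℕ}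
    (h : G.edist u v = (d : ℕ∞)) (hi : i ≤ d) :
    ∃ w, G.edist u w = (i : ℕ∞) ∧ G.edist w v = ((d - i : ℕ) : ℕ∞) := by
  obtain ⟨p, hp⟩ := SimpleGraph.exists_walk_of_edist_eq_coe h
  have h1 : G.edist u (p.getVert i) ≤ (i : ℕ∞) := by
    refine (SimpleGraph.edist_le (p.take i)).trans ?_
    rw [SimpleGraph.Walk.take_length, hp]
    exact_mod_cast min_le_left _ _
  have h2 : G.edist (p.getVert i) v ≤ ((d - i : ℕ) : ℕ∞) := by
    refine (SimpleGraph.edist_le (p.drop i)).trans ?_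
    rw [SimpleGraph.Walk.drop_length, hp]
  obtain ⟨e1, he1, h1'⟩ := exists_edist_eq_of_le h1
  obtain ⟨e2, he2, h2'⟩ := exists_edist_eq_of_le h2
  have h3 := edist_le_add h1'.le h2'.le
  rw [h, Nat.cast_le] at h3
  refine ⟨p.getVert i, ?_, ?_⟩
  · rw [h1', show e1 = i by omega]
  · rw [h2', show e2 = d - i by omega]

variable {n : ℕ}

theorem edist_lt_card {L : SimpleGraph (Fin n)} {u v : Fin n} {d : ℕ}
    (h : L.edist u v = (d : ℕ∞)) : d < n := by
  have hr : L.Reachable u v := SimpleGraph.edist_ne_top_iff_reachable.1 (by rw [h]; simp)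
  obtain ⟨p, hp, hl⟩ := hr.exists_path_of_dist
  have h1 := hr.coe_dist_eq_edist
  rw [h, Nat.cast_inj] at h1
  have := hp.length_lt
  rw [Fintype.card_fin] at this
  omega

/-- The vertices at distance at most `r` from `v`, with their distances. -/
def distSet (L : SimpleGraph (Fin n)) (v : Fin n) (r : ℕ) : Set (Fin n × Fin n) :=
  {p | L.edist v p.1 = (p.2.val : ℕ∞) ∧ p.2.val ≤ r}

theorem mem_ball_iff {V : Type} {G : SimpleGraph V} {u v : V} {r : ℕ} :
    u ∈ ball G v r ↔ G.edist v u ≤ (r : ℕ∞) := Iff.rfl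

theorem self_mem_ball {V : Type} (G : SimpleGraph V) (v : V) (r : ℕ) : v ∈ ball G v r := by
  simp [mem_ball_iff]

theorem mem_ball_comm {V : Type} {G : SimpleGraph V} {u v : V} {r : ℕ} :
    u ∈ ball G v r ↔ v ∈ ball G u r := by
  rw [mem_ball_iff, mem_ball_iff, SimpleGraph.edist_comm]

theorem ball_subset_ball {V : Type} {G : SimpleGraph V} {u v : V} {a r q : ℕ} (hw : u ∈ ball G v a)
    (h : a + r ≤ q) : ball G u r ⊆ ball G v q := fun x hx =>
  (edist_le_add (mem_ball_iff.1 hw) (mem_ball_iff.1 hx)).trans (by exact_mod_cast h)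

theorem ball_mono {V : Type} {G : SimpleGraph V} {v : V} {r q : ℕ} (h : r ≤ q) :
    ball G v r ⊆ ball G v q :=
  ball_subset_ball (self_mem_ball G v 0) (by omega)

theorem ncard_distSet_le (L : SimpleGraph (Fin n)) (v : Fin n) (r : ℕ) :
    (distSet L v r).ncard ≤ (ball L v r).ncard := by
  refine Set.ncard_le_ncard_of_injOn Prod.fst ?_ ?_ (Set.toFinite _)
  · rintro ⟨u, d⟩ ⟨h1, h2⟩
    rw [mem_ball_iff, h1]
    exact_mod_cast h2
  · rintro ⟨u, d⟩ ⟨h1, -⟩ ⟨u', d'⟩ ⟨h1', -⟩ (h : u = u')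
    subst h
    simp only at h1 h1'
    rw [h1, Nat.cast_inj] at h1'
    rw [Fin.ext h1']

theorem edist_eq_of_distSet_eq {L L' : SimpleGraph (Fin n)} {v u : Fin n} {r d : ℕ}
    (h : distSet L v r = distSet L' v r) (hd : d ≤ r) (hu : L.edist v u = (d : ℕ∞)) :
    L'.edist v u = (d : ℕ∞) := by
  have : (u, (⟨d, edist_lt_card hu⟩ : Fin n)) ∈ distSet L v r := ⟨hu, hd⟩
  rw [h] at this
  exact this.1

theorem ball_eq_of_distSet_eq {L L' : SimpleGraph (Fin n)} {v : Fin n} {r a : ℕ}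
    (h : distSet L v r = distSet L' v r) (ha : a ≤ r) : ball L v a = ball L' v a := by
  have key : ∀ L L' : SimpleGraph (Fin n), distSet L v r = distSet L' v r →
      ball L v a ⊆ ball L' v a := by
    intro L L' h u hu
    obtain ⟨d, hd, hu⟩ := exists_edist_eq_of_le hu
    rw [mem_ball_iff, edist_eq_of_distSet_eq h (hd.trans ha) hu]
    exact_mod_cast hd
  exact Set.Subset.antisymm (key L L' h) (key L' L h.symm)

theorem distSet_one_eq {L L' : SimpleGraph (Fin n)} {v : Fin n}
    (h : L.neighborSet v = L'.neighborSet v) : distSet L v 1 = distSet L' v 1 := by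
  have key : ∀ L : SimpleGraph (Fin n), distSet L v 1 =
      {p | (p.2.val = 0 ∧ v = p.1) ∨ (p.2.val = 1 ∧ p.1 ∈ L.neighborSet v)} := by
    intro L
    ext ⟨u, d⟩
    simp only [distSet, Set.mem_ofPred_eq, SimpleGraph.mem_neighborSet]
    constructor
    · rintro ⟨h1, h2⟩
      rcases Nat.le_one_iff_eq_zero_or_eq_one.1 h2 with h3 | h3
      · rw [h3] at h1
        exact Or.inl ⟨h3, SimpleGraph.edist_eq_zero_iff.1 h1⟩
      · rw [h3] at h1
        exact Or.inr ⟨h3, SimpleGraph.edist_eq_one_iff_adj.1 h1⟩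
    · rintro (⟨h1, rfl⟩ | ⟨h1, h2⟩)
      · rw [h1]; simp
      · rw [h1]; simpa using SimpleGraph.edist_eq_one_iff_adj.2 h2
  rw [key, key, h]

/-- Distances up to `a + r` are determined by those up to `r` from the vertices at distance at most
`a`. -/
theorem distSet_add_eq {L L' : SimpleGraph (Fin n)} {v : Fin n} {a r : ℕ} (har : a ≤ r)
    (hv : distSet L v r = distSet L' v r)
    (hw : ∀ w ∈ ball L v a, distSet L w r = distSet L' w r) :
    distSet L v (a + r) = distSet L' v (a + r) := by
  have key : ∀ L L' : SimpleGraph (Fin n), distSet L v r = distSet L' v r →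
      (∀ w ∈ ball L v a, distSet L w r = distSet L' w r) →
      ∀ u (d : ℕ), d ≤ a + r → L.edist v u = (d : ℕ∞) → L'.edist v u ≤ (d : ℕ∞) := by
    intro L L' hv hw u d hd hu
    obtain ⟨w, h1, h2⟩ := exists_edist_eq_and_edist_eq hu (min_le_right a d)
    have hwa : w ∈ ball L v a := by
      rw [mem_ball_iff, h1]
      exact_mod_cast min_le_left a d
    have h3 := edist_eq_of_distSet_eq hv (by omega) h1
    have h4 := edist_eq_of_distSet_eq (hw w hwa) (by omega) h2
    have := edist_le_add h3.le h4.le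
    rwa [show min a d + (d - min a d) = d by omega] at this
  have hw' : ∀ w ∈ ball L' v a, distSet L' w r = distSet L w r := fun w hwa =>
    (hw w (by rw [ball_eq_of_distSet_eq hv har]; exact hwa)).symm
  have key' : ∀ L L' : SimpleGraph (Fin n), distSet L v r = distSet L' v r →
      (∀ w ∈ ball L v a, distSet L w r = distSet L' w r) →
      (∀ w ∈ ball L' v a, distSet L' w r = distSet L w r) →
      distSet L v (a + r) ⊆ distSet L' v (a + r) := by
    rintro L L' hv hw hw' ⟨u, d⟩ ⟨h1, h2⟩
    simp only at h1 h2
    obtain ⟨e, he, h3⟩ := exists_edist_eq_of_le (key L L' hv hw u d h2 h1)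
    have h4 := key L' L hv.symm hw' u e (he.trans h2) h3
    rw [h1, Nat.cast_le] at h4
    exact ⟨by rw [h3, le_antisymm he h4], h2⟩
  exact Set.Subset.antisymm (key' L L' hv hw hw') (key' L' L hv.symm hw' hw)

/-- `p` consists of the element of `Z` that is nearest to `v`, the one of smallest ID if there are
several, and of its distance. -/
def IsNearest (L : SimpleGraph (Fin n)) (Z : Set (Fin n)) (v : Fin n) (p : Fin n × Fin n) : Prop :=
  p.1 ∈ Z ∧ L.edist v p.1 = (p.2.val : ℕ∞) ∧
    ∀ z ∈ Z, ∀ e : ℕ, L.edist v z = (e : ℕ∞) → p.2.val < e ∨ (p.2.val = e ∧ p.1 ≤ z)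

theorem IsNearest.unique {L : SimpleGraph (Fin n)} {Z : Set (Fin n)} {v : Fin n}
    {p q : Fin n × Fin n} (hp : IsNearest L Z v p) (hq : IsNearest L Z v q) : p = q := by
  have h1 := hp.2.2 q.1 hq.1 q.2 hq.2.1
  have h2 := hq.2.2 p.1 hp.1 p.2 hp.2.1
  have h3 : p.2 = q.2 := by apply Fin.ext; omega
  have h4 : p.1 = q.1 := le_antisymm (by rw [h3] at h1; simpa using h1) (by rw [h3] at h2; simpa using h2)
  exact Prod.ext h4 h3

theorem exists_isNearest {L : SimpleGraph (Fin n)} {Z : Set (Fin n)} {v z : Fin n} {d : ℕ}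
    (hz : z ∈ Z) (hd : L.edist v z = (d : ℕ∞)) : ∃ p, IsNearest L Z v p := by
  classical
  have hex : ∃ d : ℕ, ∃ z ∈ Z, L.edist v z = (d : ℕ∞) := ⟨d, z, hz, hd⟩
  obtain ⟨z₀, hz₀, hz₀'⟩ := Nat.find_spec hex
  obtain ⟨z₁, ⟨hz₁, hz₁'⟩, hmin⟩ :=
    Set.exists_min_image {z | z ∈ Z ∧ L.edist v z = (Nat.find hex : ℕ∞)} id (Set.toFinite _)
      ⟨z₀, hz₀, hz₀'⟩
  refine ⟨(z₁, ⟨Nat.find hex, edist_lt_card hz₁'⟩), hz₁, hz₁', fun z hz e he => ?_⟩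
  rcases lt_or_eq_of_le (Nat.find_min' hex ⟨z, hz, he⟩) with h | h
  · exact Or.inl h
  · exact Or.inr ⟨h, hmin z ⟨hz, by rw [he, h]⟩⟩

open Classical in
/-- The nearest element of `Z` and its distance. -/
noncomputable def nearest (L : SimpleGraph (Fin n)) (Z : Set (Fin n)) (v : Fin n) :
    Option (Fin n × Fin n) :=
  if h : ∃ p, IsNearest L Z v p then some h.choose else none

theorem nearest_eq_some_iff {L : SimpleGraph (Fin n)} {Z : Set (Fin n)} {v : Fin n}
    {p : Fin n × Fin n} : nearest L Z v = some p ↔ IsNearest L Z v p := by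
  rw [nearest]
  split_ifs with h
  · rw [Option.some.injEq]
    constructor
    · rintro rfl; exact h.choose_spec
    · exact fun hp => h.choose_spec.unique hp
  · simp only [false_iff]
    exact fun hp => h ⟨p, hp⟩

/-- The vertices of a shortest path to the nearest center have the same nearest center. -/
theorem IsNearest.exists_between {L : SimpleGraph (Fin n)} {Z : Set (Fin n)} {v : Fin n}
    {p : Fin n × Fin n} (hp : IsNearest L Z v p) {i : ℕ} (hi : i ≤ p.2.val) :
    ∃ w q, L.edist v w = (i : ℕ∞) ∧ IsNearest L Z w q ∧ q.1 = p.1 ∧ q.2.val = p.2.val - i := by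
  obtain ⟨w, h1, h2⟩ := exists_edist_eq_and_edist_eq hp.2.1 hi
  refine ⟨w, (p.1, ⟨p.2.val - i, edist_lt_card h2⟩), h1, ⟨hp.1, h2, fun z hz e he => ?_⟩, rfl, rfl⟩
  obtain ⟨f, hf, hvz⟩ := exists_edist_eq_of_le (edist_le_add h1.le he.le)
  simp only
  rcases hp.2.2 z hz f hvz with h | ⟨h, h'⟩
  · left; omega
  · rcases lt_or_eq_of_le (show p.2.val - i ≤ e by omega) with h3 | h3
    · exact Or.inl h3
    · exact Or.inr ⟨h3, h'⟩

/-- The distance to `Z` is at most `r`. -/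
def IsClose (L : SimpleGraph (Fin n)) (Z : Set (Fin n)) (r : ℕ) (v : Fin n) : Prop :=
  ∃ z ∈ Z, z ∈ ball L v r

theorem isClose_iff {L : SimpleGraph (Fin n)} {Z : Set (Fin n)} {r : ℕ} {v : Fin n} :
    IsClose L Z r v ↔ ∃ p, nearest L Z v = some p ∧ p.2.val ≤ r := by
  simp only [nearest_eq_some_iff]
  constructor
  · rintro ⟨z, hz, hzr⟩
    obtain ⟨e, he, hze⟩ := exists_edist_eq_of_le (mem_ball_iff.1 hzr)
    obtain ⟨p, hp⟩ := exists_isNearest hz hze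
    refine ⟨p, hp, ?_⟩
    have := hp.2.2 z hz e hze
    omega
  · rintro ⟨p, hp, hr⟩
    refine ⟨p.1, hp.1, ?_⟩
    rw [mem_ball_iff, hp.2.1]
    exact_mod_cast hr

theorem isClose_add_iff {L : SimpleGraph (Fin n)} {Z : Set (Fin n)} {a r : ℕ} {v : Fin n} :
    IsClose L Z (a + r) v ↔ ∃ w ∈ ball L v a, IsClose L Z r w := by
  constructor
  · rintro ⟨z, hz, hzr⟩
    obtain ⟨e, he, hze⟩ := exists_edist_eq_of_le (mem_ball_iff.1 hzr)
    obtain ⟨w, h1, h2⟩ := exists_edist_eq_and_edist_eq hze (min_le_right a e)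
    refine ⟨w, ?_, z, hz, ?_⟩
    · rw [mem_ball_iff, h1]; exact_mod_cast min_le_left a e
    · rw [mem_ball_iff, h2]
      exact_mod_cast (show e - min a e ≤ r by omega)
  · rintro ⟨w, hw, z, hz, hzr⟩
    exact ⟨z, hz, ball_subset_ball hw le_rfl hzr⟩

/-- The nearest center of `v` is determined by those of the vertices close to `v` that have one
at distance at most `r`. -/
theorem nearest_eq_of_add {L L' : SimpleGraph (Fin n)} {Z Z' : Set (Fin n)} {v : Fin n} {a r : ℕ}
    (har : a ≤ r) (hv : distSet L v r = distSet L' v r) (hnot : ¬ IsClose L Z r v)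
    (hnot' : ¬ IsClose L' Z' r v) (hcl : ∀ w, IsClose L Z r w ↔ IsClose L' Z' r w)
    (hlab : ∀ w, IsClose L Z r w → nearest L Z w = nearest L' Z' w)
    (hex : IsClose L Z (a + r) v) : nearest L Z v = nearest L' Z' v := by
  have hex' : IsClose L' Z' (a + r) v := by
    rw [isClose_add_iff] at hex ⊢
    obtain ⟨w, hw, hw'⟩ := hex
    exact ⟨w, by rw [← ball_eq_of_distSet_eq hv har]; exact hw, (hcl w).1 hw'⟩
  have key : ∀ (L L' : SimpleGraph (Fin n)) (Z Z' : Set (Fin n)),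
      distSet L v r = distSet L' v r → ¬ IsClose L Z r v →
      (∀ w, IsClose L Z r w → nearest L Z w = nearest L' Z' w) →
      ∀ p q, nearest L Z v = some p → p.2.val ≤ a + r → nearest L' Z' v = some q →
        q.2.val < p.2.val ∨ (q.2.val = p.2.val ∧ q.1 ≤ p.1) := by
    intro L L' Z Z' hv hnot hlab p q hp hpr hq
    have hrp : r < p.2.val := by
      by_contra h
      exact hnot (isClose_iff.2 ⟨p, hp, by omega⟩)
    rw [nearest_eq_some_iff] at hp hq
    obtain ⟨w, u, h1, h2, h3, h4⟩ := hp.exists_between (i := a) (by omega)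
    have hw : nearest L' Z' w = some u := by
      rw [← hlab w (isClose_iff.2 ⟨u, nearest_eq_some_iff.2 h2, by omega⟩)]
      exact nearest_eq_some_iff.2 h2
    rw [nearest_eq_some_iff] at hw
    have h5 := edist_le_add (edist_eq_of_distSet_eq hv har h1).le hw.2.1.le
    obtain ⟨f, hf, h6⟩ := exists_edist_eq_of_le h5
    have := hq.2.2 u.1 hw.1 f h6
    rw [h3] at this
    omega
  obtain ⟨p, hp, hpr⟩ := isClose_iff.1 hex
  obtain ⟨q, hq, hqr⟩ := isClose_iff.1 hex'
  have h1 := key L L' Z Z' hv hnot hlab p q hp hpr hq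
  have h2 := key L' L Z' Z hv.symm hnot' (fun w hw => (hlab w ((hcl w).2 hw)).symm) q p hq hqr hp
  rw [hp, hq]
  have h3 : p.2 = q.2 := by apply Fin.ext; omega
  have h4 : p.1 = q.1 := by
    apply le_antisymm <;> omega
  rw [Prod.ext h4 h3]

end Distances

/-! ### Distributed doubling of distances -/

section Doubling

variable {b n : ℕ} {Ω I : Type} {inp : Ω → Fin n → I} {t : ℕ} {R : Fin n → Ω → Ω → Prop}

/-- Some of the nodes are closed, and the others know the at most `√n` vertices at distance at
most `r`. Then
all nodes can learn which nodes are closed, and the labels of these, and an open node without a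
closed one at distance at most `a` can learn its distances up to `a + r`. The open nodes at distance
at most `a` from each other form a sparse symmetric relation, along which they exchange their balls. -/
theorem Attains.extend_balls {W : Type} [Finite W] (h : Attains b inp t R) (hb : 40 ≤ b)
    (hn : 2 ≤ n) (hW : Nat.card W ≤ n ^ 3) (L : Ω → SimpleGraph (Fin n)) (Cl : Ω → Fin n → Prop)
    (lab : Ω → Fin n → W) {a r : ℕ} (har : a ≤ r)
    (hCl : ∀ v ω ω', R v ω ω' → (Cl ω v ↔ Cl ω' v))
    (hlab : ∀ v ω ω', R v ω ω' → Cl ω v → lab ω v = lab ω' v)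
    (hD : ∀ v ω ω', R v ω ω' → ¬ Cl ω v → distSet (L ω) v r = distSet (L ω') v r)
    (hsmall : ∀ ω v, ¬ Cl ω v → (ball (L ω) v r).ncard ≤ Nat.sqrt n) :
    Attains b inp (t + 9) (fun v ω ω' => R v ω ω' ∧ (∀ w, Cl ω w ↔ Cl ω' w) ∧
      (∀ w, Cl ω w → lab ω w = lab ω' w) ∧
      (¬ Cl ω v → (∀ w ∈ ball (L ω) v a, ¬ Cl ω w) →
        distSet (L ω) v (a + r) = distSet (L ω') v (a + r))) := by
  classical
  have hcardO : Nat.card (Option W) ≤ n ^ 4 := by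
    rw [Finite.card_option]
    nlinarith [pow_pos (show 0 < n by omega) 3]
  have h1 := h.broadcast (e := 4) (by omega) hcardO
    (fun ω v => if Cl ω v then some (lab ω v) else none) (by
      intro v ω ω' hR
      by_cases hc : Cl ω v
      · rw [if_pos hc, if_pos ((hCl v ω ω' hR).1 hc), hlab v ω ω' hR hc]
      · rw [if_neg hc, if_neg (fun h' => hc ((hCl v ω ω' hR).2 h'))])
  have h2 : Attains b inp (t + 1) (fun v ω ω' => R v ω ω' ∧ (∀ w, Cl ω w ↔ Cl ω' w) ∧
      ∀ w, Cl ω w → lab ω w = lab ω' w) := by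
    refine h1.weaken ?_
    rintro v ω ω' ⟨hR, hf⟩
    have hf' : ∀ w, (if Cl ω w then some (lab ω w) else none) =
      if Cl ω' w then some (lab ω' w) else none := fun w => congrFun hf w
    refine ⟨hR, fun w => ?_, fun w hw => ?_⟩
    · have := hf' w
      by_cases hc : Cl ω w <;> by_cases hc' : Cl ω' w <;> simp_all
    · have := hf' w
      by_cases hc' : Cl ω' w <;> simp_all
  have h3 := h2.exchange (W := Fin n × Fin n) hb hn (by simp [pow_two])
    (fun ω v => {w | w ∈ ball (L ω) v a ∧ ¬ Cl ω v ∧ ¬ Cl ω w}) ?_ ?_ ?_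
    (fun ω v => if Cl ω v then ∅ else distSet (L ω) v r) ?_ ?_
  · refine h3.weaken ?_
    rintro v ω ω' ⟨⟨hR, hc, hl⟩, hx⟩
    refine ⟨hR, hc, hl, fun hv hw => distSet_add_eq har (hD v ω ω' hR hv) fun w hwa => ?_⟩
    have := hx w ⟨hwa, hv, hw w hwa⟩
    rwa [if_neg (hw w hwa), if_neg (fun h' => hw w hwa ((hc w).2 h'))] at this
  · rintro v ω ω' ⟨hR, hc, -⟩
    ext w
    simp only [Set.mem_ofPred_eq, ← hc]
    refine ⟨fun ⟨h1, h2, h3⟩ => ⟨?_, h2, h3⟩, fun ⟨h1, h2, h3⟩ => ⟨?_, h2, h3⟩⟩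
    · rwa [← ball_eq_of_distSet_eq (hD v ω ω' hR h2) har]
    · rwa [ball_eq_of_distSet_eq (hD v ω ω' hR h2) har]
  · intro ω v
    by_cases hv : Cl ω v
    · simp [hv]
    · refine le_trans (Set.ncard_le_ncard ?_ (Set.toFinite _)) (hsmall ω v hv)
      exact fun w hw => ball_mono har hw.1
  · rintro ω u v ⟨h1, h2, h3⟩
    exact ⟨mem_ball_comm.1 h1, h3, h2⟩
  · rintro v ω ω' ⟨hR, hc, -⟩
    by_cases hv : Cl ω v
    · simp only [if_pos hv, if_pos ((hc v).1 hv)]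
    · simp only [if_neg hv, if_neg (fun h' => hv ((hc v).2 h')), hD v ω ω' hR hv]
  · intro ω v
    by_cases hv : Cl ω v
    · simp [hv]
    · simp only [if_neg hv]
      exact (ncard_distSet_le _ _ _).trans (hsmall ω v hv)

end Doubling

/-! ### Big balls, their witnesses, and nearest centers in logarithmically many steps -/

section Plans

/-- `Plan m h Q`: the radius `h` is reached from 1 in `m` steps, each of which adds to the current
radius one that is not larger; `Q` consists of the radii on the way. -/
inductive Plan : ℕ → ℕ → Set ℕ → Prop
  | one : Plan 0 1 {1}
  | step {m r : ℕ} {Q : Set ℕ} (a : ℕ) (har : a ≤ r) (hp : Plan m r Q) :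
      Plan (m + 1) (a + r) (insert (a + r) Q)

theorem Plan.mem {m h : ℕ} {Q : Set ℕ} (hp : Plan m h Q) : h ∈ Q := by
  cases hp with
  | one => rfl
  | step a har hp => exact Set.mem_insert _ _

/-- Doubling, with an additional step for each binary digit 1. -/
theorem exists_plan (h : ℕ) (hh : 1 ≤ h) : ∃ m Q, Plan m h Q ∧ m ≤ 2 * Nat.log 2 h := by
  induction h using Nat.strong_induction_on with
  | _ h ih =>
    rcases Nat.lt_or_ge h 2 with h2 | h2
    · obtain rfl : h = 1 := by omega
      exact ⟨0, {1}, Plan.one, by simp⟩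
    · obtain ⟨m, Q, hp, hm⟩ := ih (h / 2) (by omega) (by omega)
      have hlog : Nat.log 2 h = Nat.log 2 (h / 2) + 1 := Nat.log_of_one_lt_of_le one_lt_two h2
      have hp1 := Plan.step (h / 2) le_rfl hp
      rcases Nat.mod_two_eq_zero_or_one h with h0 | h0
      · rw [show h / 2 + h / 2 = h by omega] at hp1
        exact ⟨m + 1, _, hp1, by omega⟩
      · have hp2 := Plan.step 1 (by omega) hp1
        rw [show 1 + (h / 2 + h / 2) = h by omega] at hp2
        exact ⟨m + 1 + 1, _, hp2, by omega⟩

variable {b n : ℕ} {Ω I : Type} {inp : Ω → Fin n → I} {t : ℕ} {R : Fin n → Ω → Ω → Prop}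

/-- The ball of radius `r` around `v` is big: it has more than `D` elements. -/
def IsBig (D : ℝ) (L : SimpleGraph (Fin n)) (r : ℕ) (v : Fin n) : Prop :=
  D < ((ball L v r).ncard : ℝ)

theorem ncard_le_sqrt_of_not_isBig {D : ℝ} (hD : D ≤ Real.sqrt n) {L : SimpleGraph (Fin n)} {r : ℕ}
    {v : Fin n} (h : ¬ IsBig D L r v) : (ball L v r).ncard ≤ Nat.sqrt n := by
  have h1 : ((ball L v r).ncard : ℝ) ≤ Real.sqrt n := (not_lt.1 h).trans hD
  rw [Nat.le_sqrt', ← Nat.cast_le (α := ℝ)]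
  push_cast
  exact (Real.le_sqrt' (by
    have : 0 < (ball L v r).ncard := (Set.ncard_pos (Set.toFinite _)).2 ⟨v, self_mem_ball _ _ _⟩
    exact_mod_cast this)).1 h1

theorem IsBig.of_mem {D : ℝ} {L : SimpleGraph (Fin n)} {a r q : ℕ} {v w : Fin n}
    (hw : w ∈ ball L v a) (haq : a + r ≤ q) (h : IsBig D L r w) : IsBig D L q v :=
  lt_of_lt_of_le h (by exact_mod_cast Set.ncard_le_ncard (ball_subset_ball hw haq) (Set.toFinite _))

/-- In `9 * m` rounds all nodes find out whether their ball of radius `h` is big. A node whose ball is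
small learns it; some of the others, the witnesses, learn a big ball around them, and every big ball
around any node, with a radius from the plan, contains the big ball of a witness. -/
theorem Plan.exists_witnesses {m h : ℕ} {Q : Set ℕ} (hp : Plan m h Q) (D : ℝ)
    (hD : D ≤ Real.sqrt n) (hn : 2 ≤ n) (hb : 40 ≤ b) :
    ∃ S : SimpleGraph (Fin n) → Fin n → Option (Set (Fin n)),
      (∀ L v X, S L v = some X → D < (X.ncard : ℝ) ∧ X ⊆ ball L v h) ∧
      (∀ L, ∀ r ∈ Q, ∀ v, IsBig D L r v → ∃ w X, S L w = some X ∧ X ⊆ ball L v r) ∧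
      ∀ {Ω I : Type} {inp : Ω → Fin n → I} {t : ℕ} {R : Fin n → Ω → Ω → Prop}
        (L : Ω → SimpleGraph (Fin n)), Attains b inp t R →
        (∀ v ω ω', R v ω ω' → (L ω).neighborSet v = (L ω').neighborSet v) →
        Attains b inp (t + 9 * m) (fun v ω ω' => R v ω ω' ∧
          (IsBig D (L ω) h v ↔ IsBig D (L ω') h v) ∧
          (¬ IsBig D (L ω) h v → distSet (L ω) v h = distSet (L ω') v h) ∧
          S (L ω) v = S (L ω') v) := by
  classical
  induction hp with
  | one =>
    refine ⟨fun L v => if IsBig D L 1 v then some (ball L v 1) else none, ?_, ?_, ?_⟩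
    · intro L v X h
      by_cases hv : IsBig D L 1 v
      · simp only [if_pos hv, Option.some.injEq] at h
        rw [← h]
        exact ⟨hv, subset_rfl⟩
      · simp [hv] at h
    · rintro L r rfl v hv
      exact ⟨v, ball L v 1, by simp only [if_pos hv], subset_rfl⟩
    · intro Ω I inp t R L h hL
      refine h.weaken fun v ω ω' hR => ?_
      have h1 := distSet_one_eq (hL v ω ω' hR)
      have h2 := ball_eq_of_distSet_eq h1 le_rfl
      have h3 : IsBig D (L ω) 1 v ↔ IsBig D (L ω') 1 v := by rw [IsBig, IsBig, h2]
      refine ⟨hR, h3, fun _ => h1, ?_⟩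
      beta_reduce
      by_cases hv : IsBig D (L ω) 1 v
      · rw [if_pos hv, if_pos (h3.1 hv), h2]
      · rw [if_neg hv, if_neg (fun h' => hv (h3.2 h'))]
  | @step m r Q a har hp ih =>
    obtain ⟨S, hS1, hS2, hS3⟩ := ih
    -- a new witness has a big ball, but no ball of the previous radius close to it was big
    set New : SimpleGraph (Fin n) → Fin n → Prop := fun L v =>
      S L v = none ∧ ¬ IsBig D L r v ∧ (∀ w ∈ ball L v a, ¬ IsBig D L r w) ∧ IsBig D L (a + r) v
      with hNew
    refine ⟨fun L v => if New L v then some (ball L v (a + r)) else S L v, ?_, ?_, ?_⟩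
    · intro L v X h
      by_cases hv : New L v
      · simp only [if_pos hv, Option.some.injEq] at h
        rw [← h]
        exact ⟨hv.2.2.2, subset_rfl⟩
      · simp only [if_neg hv] at h
        exact ⟨(hS1 L v X h).1, (hS1 L v X h).2.trans (ball_mono (by omega))⟩
    · have hold : ∀ L w X, S L w = some X →
          (if New L w then some (ball L w (a + r)) else S L w) = some X := by
        intro L w X h
        rw [if_neg, h]
        rintro ⟨h', -⟩
        rw [h] at h'
        exact absurd h' (by simp)
      intro L q hq v hv
      rcases Set.mem_insert_iff.1 hq with rfl | hq
      · by_cases hw : ∃ w ∈ ball L v a, IsBig D L r w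
        · obtain ⟨w, hwa, hw⟩ := hw
          obtain ⟨u, X, hu, hX⟩ := hS2 L r hp.mem w hw
          exact ⟨u, X, hold L u X hu, hX.trans (ball_subset_ball hwa le_rfl)⟩
        · push Not at hw
          rcases hSv : S L v with _ | X
          · have : New L v := ⟨hSv, hw v (self_mem_ball _ _ _), hw, hv⟩
            exact ⟨v, _, if_pos this, subset_rfl⟩
          · exact ⟨v, X, hold L v X hSv, (hS1 L v X hSv).2.trans (ball_mono (by omega))⟩
      · obtain ⟨w, X, hw, hX⟩ := hS2 L q hq v hv
        exact ⟨w, X, hold L w X hw, hX⟩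
    · intro Ω I inp t R L h hL
      have h1 := Attains.extend_balls (W := Fin 1) (hS3 L h hL) hb hn
        (by simpa using Nat.one_le_pow _ _ (by omega)) L (fun ω v => IsBig D (L ω) r v)
        (fun _ _ => 0) har (fun v ω ω' hR => hR.2.1) (fun _ _ _ _ _ => rfl)
        (fun v ω ω' hR => hR.2.2.1) (fun ω v => ncard_le_sqrt_of_not_isBig hD)
      refine Attains.weaken (by rw [Nat.mul_succ, ← add_assoc]; exact h1) ?_
      rintro v ω ω' ⟨⟨hR, hbig, hdist, hSv⟩, hcl, -, hext⟩
      have hbig' : IsBig D (L ω) (a + r) v ↔ IsBig D (L ω') (a + r) v := by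
        by_cases hv : IsBig D (L ω) r v
        · exact iff_of_true (hv.of_mem (self_mem_ball _ _ a) le_rfl)
            ((hbig.1 hv).of_mem (self_mem_ball _ _ a) le_rfl)
        · have hball := ball_eq_of_distSet_eq (hdist hv) har
          by_cases hw : ∃ w ∈ ball (L ω) v a, IsBig D (L ω) r w
          · obtain ⟨w, hwa, hw⟩ := hw
            exact iff_of_true (hw.of_mem hwa le_rfl)
              (((hcl w).1 hw).of_mem (by rw [← hball]; exact hwa) le_rfl)
          · push Not at hw
            rw [IsBig, IsBig, ball_eq_of_distSet_eq (hext hv hw) le_rfl]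
      have hsmall : ¬ IsBig D (L ω) (a + r) v → ¬ IsBig D (L ω) r v ∧
          ∀ w ∈ ball (L ω) v a, ¬ IsBig D (L ω) r w := fun hv =>
        ⟨fun h' => hv (h'.of_mem (self_mem_ball _ _ a) le_rfl),
          fun w hw h' => hv (h'.of_mem hw le_rfl)⟩
      refine ⟨hR, hbig', fun hv => hext (hsmall hv).1 (hsmall hv).2, ?_⟩
      have hnew : New (L ω) v ↔ New (L ω') v := by
        simp only [hNew, ← hSv, ← hbig', ← hcl]
        refine and_congr_right fun _ => and_congr_right fun hv => ?_
        rw [ball_eq_of_distSet_eq (hdist hv) har]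
      beta_reduce
      by_cases hv : New (L ω) v
      · rw [if_pos hv, if_pos (hnew.1 hv), ball_eq_of_distSet_eq (hext hv.2.1 hv.2.2.1) le_rfl]
      · rw [if_neg hv, if_neg (fun h' => hv (hnew.2 h')), hSv]

/-- If every ball with a radius from the plan that does not meet `Z` is small, then in `9 * m` rounds
each node learns its nearest element of `Z` up to the distance `h`. -/
theorem Plan.attains_nearest {m h : ℕ} {Q : Set ℕ} (hp : Plan m h Q) (hn : 2 ≤ n) (hb : 40 ≤ b)
    (L : Ω → SimpleGraph (Fin n)) (Z : Ω → Set (Fin n)) (hA : Attains b inp t R)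
    (hL : ∀ v ω ω', R v ω ω' → (L ω).neighborSet v = (L ω').neighborSet v)
    (hZ : ∀ v ω ω', R v ω ω' → Z ω = Z ω')
    (hsmall : ∀ ω, ∀ r ∈ Q, ∀ v, ¬ IsClose (L ω) (Z ω) r v → (ball (L ω) v r).ncard ≤ Nat.sqrt n) :
    Attains b inp (t + 9 * m) (fun v ω ω' => R v ω ω' ∧
      (IsClose (L ω) (Z ω) h v ↔ IsClose (L ω') (Z ω') h v) ∧
      (IsClose (L ω) (Z ω) h v → nearest (L ω) (Z ω) v = nearest (L ω') (Z ω') v) ∧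
      (¬ IsClose (L ω) (Z ω) h v → distSet (L ω) v h = distSet (L ω') v h)) := by
  classical
  induction hp with
  | one =>
    refine hA.weaken fun v ω ω' hR => ?_
    have h1 := distSet_one_eq (hL v ω ω' hR)
    have h3 : IsClose (L ω) (Z ω) 1 v ↔ IsClose (L ω') (Z ω') 1 v := by
      rw [IsClose, IsClose, ball_eq_of_distSet_eq h1 le_rfl, hZ v ω ω' hR]
    refine ⟨hR, h3, fun hv => ?_, fun _ => h1⟩
    have key : ∀ ω ω', R v ω ω' → ∀ p q, nearest (L ω) (Z ω) v = some p → p.2.val ≤ 1 →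
        nearest (L ω') (Z ω') v = some q → distSet (L ω) v 1 = distSet (L ω') v 1 →
        q.2.val < p.2.val ∨ (q.2.val = p.2.val ∧ q.1 ≤ p.1) := by
      intro ω ω' hR p q hp hpr hq h1
      rw [nearest_eq_some_iff] at hp hq
      refine hq.2.2 p.1 (by rw [← hZ v ω ω' hR]; exact hp.1) p.2.val ?_
      exact edist_eq_of_distSet_eq h1 hpr hp.2.1
    obtain ⟨p, hp, hp1⟩ := isClose_iff.1 hv
    obtain ⟨q, hq, hq1⟩ := isClose_iff.1 (h3.1 hv)
    have h4 := key ω ω' hR p q hp hp1 hq h1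
    rw [hp, hq]
    have h5 : q.2.val < p.2.val ∨ (q.2.val = p.2.val ∧ q.1 ≤ p.1) := h4
    rw [nearest_eq_some_iff] at hp hq
    have h6 := hp.2.2 q.1 (by rw [hZ v ω ω' hR]; exact hq.1) q.2.val
      (edist_eq_of_distSet_eq h1.symm hq1 hq.2.1)
    have h7 : p.2 = q.2 := by apply Fin.ext; omega
    have h8 : p.1 = q.1 := by apply le_antisymm <;> omega
    rw [Prod.ext h8 h7]
  | @step m r Q a har hp ih =>
    have ih' := ih (fun ω r hr => hsmall ω r (Set.mem_insert_of_mem _ hr))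
    have h1 := Attains.extend_balls (W := Option (Fin n × Fin n)) (t := t + 9 * m)
      (ih'.weaken (R' := fun v ω ω' => R v ω ω' ∧
        (IsClose (L ω) (Z ω) r v ↔ IsClose (L ω') (Z ω') r v) ∧
        (IsClose (L ω) (Z ω) r v → nearest (L ω) (Z ω) v = nearest (L ω') (Z ω') v) ∧
        (¬ IsClose (L ω) (Z ω) r v → distSet (L ω) v r = distSet (L ω') v r)) fun _ _ _ h => h)
      hb hn ?_ L (fun ω v => IsClose (L ω) (Z ω) r v) (fun ω v => nearest (L ω) (Z ω) v)
      har (fun v ω ω' hR => hR.2.1) (fun v ω ω' hR => hR.2.2.1) (fun v ω ω' hR => hR.2.2.2)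
      (fun ω v => hsmall ω r (Set.mem_insert_of_mem _ hp.mem) v)
    · refine Attains.weaken (by rw [Nat.mul_succ, ← add_assoc]; exact h1) ?_
      rintro v ω ω' ⟨⟨hR, hbig, hnear, hdist⟩, hcl, hlab, hext⟩
      have hclose : IsClose (L ω) (Z ω) (a + r) v ↔ IsClose (L ω') (Z ω') (a + r) v := by
        by_cases hv : IsClose (L ω) (Z ω) r v
        · rw [isClose_add_iff, isClose_add_iff]
          exact iff_of_true ⟨v, self_mem_ball _ _ _, hv⟩ ⟨v, self_mem_ball _ _ _, hbig.1 hv⟩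
        · rw [isClose_add_iff, isClose_add_iff, ball_eq_of_distSet_eq (hdist hv) har]
          simp only [hcl]
      refine ⟨hR, hclose, fun hv => ?_, fun hv => ?_⟩
      · by_cases hvr : IsClose (L ω) (Z ω) r v
        · exact hnear hvr
        · exact nearest_eq_of_add har (hdist hvr) hvr (fun h' => hvr (hbig.2 h')) hcl hlab hv
      · rw [isClose_add_iff] at hv
        push Not at hv
        exact hext (hv v (self_mem_ball _ _ _)) hv
    · rw [Finite.card_option]
      simp only [Nat.card_eq_fintype_card, Fintype.card_prod, Fintype.card_fin]
      nlinarith [pow_pos (show 0 < n by omega) 2]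

end Plans

/-! ### Trees of bounded depth -/

section Trees

/-- A breadth-first search tree. -/
theorem hasRootedTree_of_edist_le {V : Type} [Finite V] {H : SimpleGraph V} {ℓ : ℕ} {s : V} {X : Set V}
    (hX : ∀ x ∈ X, H.edist s x ≤ (ℓ : ℕ∞)) : HasRootedTree H ℓ s X := by
  classical
  have hpar : ∀ x, x ∈ ball H s ℓ ∧ x ≠ s →
      ∃ y, H.Adj x y ∧ ∃ d : ℕ, H.edist s y = (d : ℕ∞) ∧ H.edist s x = ((d + 1 : ℕ) : ℕ∞) := by
    rintro x ⟨hx, hxs⟩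
    obtain ⟨d, hd, hsx⟩ := exists_edist_eq_of_le (mem_ball_iff.1 hx)
    have hd0 : d ≠ 0 := by
      rintro rfl
      exact hxs (SimpleGraph.edist_eq_zero_iff.1 hsx).symm
    obtain ⟨y, h1, h2⟩ := exists_edist_eq_and_edist_eq hsx (Nat.sub_le d 1)
    rw [show d - (d - 1) = 1 by omega, Nat.cast_one, SimpleGraph.edist_eq_one_iff_adj] at h2
    exact ⟨y, h2.symm, d - 1, h1, by rw [hsx, show d - 1 + 1 = d by omega]⟩
  set par : V → V := fun x => if hx : x ∈ ball H s ℓ ∧ x ≠ s then (hpar x hx).choose else x with hpardef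
  have hparspec : ∀ x, x ∈ ball H s ℓ → x ≠ s → H.Adj x (par x) ∧
      ∃ d : ℕ, H.edist s (par x) = (d : ℕ∞) ∧ H.edist s x = ((d + 1 : ℕ) : ℕ∞) := by
    intro x hx hxs
    simp only [hpardef, dif_pos (And.intro hx hxs)]
    exact (hpar x ⟨hx, hxs⟩).choose_spec
  have hparball : ∀ x, x ∈ ball H s ℓ → x ≠ s → par x ∈ ball H s ℓ := by
    intro x hx hxs
    obtain ⟨-, d, h1, h2⟩ := hparspec x hx hxs
    rw [mem_ball_iff, h2, Nat.cast_le] at hx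
    rw [mem_ball_iff, h1, Nat.cast_le]
    omega
  let T : H.Subgraph :=
    { verts := ball H s ℓ
      Adj := fun x y => (x ∈ ball H s ℓ ∧ x ≠ s ∧ par x = y) ∨ (y ∈ ball H s ℓ ∧ y ≠ s ∧ par y = x)
      adj_sub := by
        rintro x y (⟨h1, h2, rfl⟩ | ⟨h1, h2, rfl⟩)
        · exact (hparspec x h1 h2).1
        · exact (hparspec y h1 h2).1.symm
      edge_vert := by
        rintro x y (⟨h1, h2, rfl⟩ | ⟨h1, h2, rfl⟩)
        · exact h1
        · exact hparball y h1 h2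
      symm := ⟨fun x y h => h.symm⟩ }
  have hs : s ∈ T.verts := self_mem_ball H s ℓ
  have hdist : ∀ (d : ℕ) (x : T.verts), H.edist s x = (d : ℕ∞) → T.coe.edist ⟨s, hs⟩ x ≤ (d : ℕ∞) := by
    intro d
    induction d with
    | zero =>
      intro x hx
      have : (⟨s, hs⟩ : T.verts) = x := Subtype.ext (SimpleGraph.edist_eq_zero_iff.1 hx)
      rw [this]
      simp
    | succ d ih =>
      intro x hx
      have hxs : x.1 ≠ s := by
        intro h
        rw [h, SimpleGraph.edist_self] at hx
        exact absurd hx.symm (by exact_mod_cast Nat.succ_ne_zero d)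
      obtain ⟨-, e, h1, h2⟩ := hparspec x.1 x.2 hxs
      rw [hx, Nat.cast_inj] at h2
      obtain rfl : d = e := by omega
      have h3 := ih ⟨par x.1, hparball x.1 x.2 hxs⟩ h1
      have hadj : T.coe.Adj ⟨par x.1, hparball x.1 x.2 hxs⟩ x :=
        Or.inr ⟨x.2, hxs, rfl⟩
      have h4 : T.coe.edist ⟨par x.1, hparball x.1 x.2 hxs⟩ x ≤ ((1 : ℕ) : ℕ∞) := by
        rw [SimpleGraph.edist_eq_one_iff_adj.2 hadj, Nat.cast_one]
      exact edist_le_add h3 h4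
  have hall : ∀ x : T.verts, T.coe.edist ⟨s, hs⟩ x ≤ (ℓ : ℕ∞) := by
    intro x
    obtain ⟨d, hd, hx⟩ := exists_edist_eq_of_le (mem_ball_iff.1 x.2)
    exact (hdist d x hx).trans (by exact_mod_cast hd)
  have hconn : T.coe.Connected := by
    have hreach : ∀ x : T.verts, T.coe.Reachable ⟨s, hs⟩ x := fun x =>
      SimpleGraph.edist_ne_top_iff_reachable.1 (ne_top_of_le_ne_top (ENat.natCast_ne_top ℓ) (hall x))
    have : Nonempty T.verts := ⟨⟨s, hs⟩⟩
    exact ⟨fun x y => (hreach x).symm.trans (hreach y)⟩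
  refine ⟨T, hs, ?_, fun x => ?_, fun x hx => hX x hx⟩
  · rw [SimpleGraph.isTree_iff_connected_and_card]
    refine ⟨hconn, le_antisymm ?_ hconn.card_vert_le_card_edgeSet_add_one⟩
    -- every edge joins a vertex other than the root to its parent
    let f : {x : T.verts // x ≠ ⟨s, hs⟩} → T.coe.edgeSet := fun x =>
      ⟨s(x.1, ⟨par x.1.1, hparball x.1.1 x.1.2 fun h => x.2 (Subtype.ext h)⟩),
        Or.inl ⟨x.1.2, fun h => x.2 (Subtype.ext h), rfl⟩⟩
    have hf : Function.Surjective f := by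
      rintro ⟨e, he⟩
      induction e using Sym2.ind with
      | _ x y =>
        rcases he with ⟨h1, h2, h3⟩ | ⟨h1, h2, h3⟩
        · refine ⟨⟨x, fun h => h2 (congrArg Subtype.val h)⟩, Subtype.ext ?_⟩
          simp only [f]
          congr 1
          exact Subtype.ext h3
        · refine ⟨⟨y, fun h => h2 (congrArg Subtype.val h)⟩, Subtype.ext ?_⟩
          simp only [f]
          rw [Sym2.eq_swap]
          congr 1
          exact Subtype.ext h3
    have h1 := Nat.card_le_card_of_surjective f hf
    have h2 : Nat.card {x : T.verts // x ≠ ⟨s, hs⟩} + 1 = Nat.card T.verts := by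
      have := Fintype.ofFinite T.verts
      rw [Nat.card_eq_fintype_card, Nat.card_eq_fintype_card, Fintype.card_subtype_compl,
        Fintype.card_subtype_eq]
      have : 0 < Fintype.card T.verts := Fintype.card_pos_iff.2 ⟨⟨s, hs⟩⟩
      omega
    omega
  · exact ENat.toNat_le_of_le_natCast (hall x)

end Trees

/-! ### The two clusterings and the spanner -/

section Construction

variable {n : ℕ}

open Classical in
/-- A fixed element of the set `S`, if there is one. All local choices are made with `pick`, so that
nodes that know the same set choose the same element. -/
noncomputable def pick {α : Type} (S : Set α) : Option α :=
  if h : S.Nonempty then some h.some else none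

theorem mem_of_pick {α : Type} {S : Set α} {x : α} (h : pick S = some x) : x ∈ S := by
  rw [pick] at h
  split_ifs at h with hS
  rw [← Option.some.inj h]
  exact hS.some_mem

theorem exists_pick {α : Type} {S : Set α} (h : S.Nonempty) : ∃ x, pick S = some x :=
  ⟨h.some, dif_pos h⟩

theorem light_adj {G : SimpleGraph (Fin n)} {u v : Fin n} :
    (light G).Adj u v ↔ G.Adj u v ∧ ¬ IsHeavy G u ∧ ¬ IsHeavy G v := by
  simp only [light, SimpleGraph.map_adj, SimpleGraph.comap_adj, Function.Embedding.subtype_apply]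
  constructor
  · rintro ⟨a, b, h, rfl, rfl⟩
    exact ⟨h, a.2, b.2⟩
  · rintro ⟨h, hu, hv⟩
    exact ⟨⟨u, hu⟩, ⟨v, hv⟩, h, rfl, rfl⟩

theorem light_le (G : SimpleGraph (Fin n)) : light G ≤ G := fun _ _ h => (light_adj.1 h).1

/-- Heavy vertices are isolated in the light graph. -/
theorem eq_of_isHeavy_of_edist {G : SimpleGraph (Fin n)} {u v : Fin n} {d : ℕ} (hu : IsHeavy G u)
    (h : (light G).edist u v = (d : ℕ∞)) : u = v := by
  obtain ⟨p, -⟩ := SimpleGraph.exists_walk_of_edist_eq_coe h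
  cases p with
  | nil => rfl
  | cons hadj _ => exact absurd hu (light_adj.1 hadj).2.1

variable (k : ℕ) (G : SimpleGraph (Fin n)) (Z Z' : Set (Fin n))

open Classical in
/-- The center of the vertices that have a center close by in the light graph, which is the nearest
one, and of the other heavy vertices, which is a neighbour. -/
noncomputable def coreCenter (v : Fin n) : Option (Fin n) :=
  if IsClose (light G) Z (depth k) v then (nearest (light G) Z v).map Prod.fst
  else if IsHeavy G v then pick {z | z ∈ Z ∧ G.Adj v z} else none

/-- A heavy neighbour of `v`. -/
noncomputable def heavyNeighbor (v : Fin n) : Option (Fin n) := pick {u | G.Adj v u ∧ IsHeavy G u}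

/-- The center map of the first clustering. The vertices without a core center join the cluster of a
heavy neighbour. -/
noncomputable def firstCenter (v : Fin n) : Option (Fin n) :=
  (coreCenter k G Z v).or ((heavyNeighbor G v).bind (coreCenter k G Z))

open Classical in
/-- The next vertex on the path from `v` to its center in the first clustering. -/
noncomputable def parent (v : Fin n) : Option (Fin n) :=
  if IsClose (light G) Z (depth k) v then
    pick {u | (light G).Adj v u ∧ ∃ p q, nearest (light G) Z v = some p ∧
      nearest (light G) Z u = some q ∧ q.1 = p.1 ∧ q.2.val + 1 = p.2.val}
  else (coreCenter k G Z v).or (heavyNeighbor G v)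

/-- The dense vertices that are adjacent to many clusters of the first clustering. -/
def IsCrowded (v : Fin n) : Prop :=
  IsDense k G v ∧ (n : ℝ) ^ (1 / (k : ℝ)) * Real.logb 2 n <
    ((adjacentCenters G (firstCenter k G Z) v).ncard : ℝ)

open Classical in
/-- The center map of the second clustering: for even `k` a crowded vertex joins an adjacent cluster
with center in `Z'`; for odd `k` it is the first clustering. -/
noncomputable def secondCenter (v : Fin n) : Option (Fin n) :=
  if Even k then
    if IsCrowded k G Z v then pick (Z' ∩ adjacentCenters G (firstCenter k G Z) v) else none
  else firstCenter k G Z v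

/-- A neighbour of `v` in the first cluster of `s`. -/
noncomputable def contact (v s : Fin n) : Option (Fin n) :=
  pick {u | G.Adj v u ∧ firstCenter k G Z u = some s}

/-- The vertex of the second cluster of `s₂` that is responsible for the edge to the first cluster
of `s₁`. -/
noncomputable def delegate (s₁ s₂ : Fin n) : Option (Fin n) :=
  pick {v | secondCenter k G Z Z' v = some s₂ ∧ s₁ ∈ adjacentCenters G (firstCenter k G Z) v}

/-- The centers of the first clusters to which `v` chooses an edge: its own second center, all
adjacent ones if `v` is dense and outside the second clustering, and those for which `v` is the
delegate of its second cluster. -/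
def targets (v : Fin n) : Set (Fin n) :=
  {s | s ∈ adjacentCenters G (firstCenter k G Z) v ∧
    (secondCenter k G Z Z' v = some s ∨
      (IsDense k G v ∧ secondCenter k G Z Z' v = none) ∨
      ∃ s₂, secondCenter k G Z Z' v = some s₂ ∧ delegate k G Z Z' s s₂ = some v)}

/-- The other ends of the edges that `v` chooses. -/
def chosen (v : Fin n) : Set (Fin n) :=
  {u | parent k G Z v = some u ∨ ∃ s ∈ targets k G Z Z' v, contact k G Z v s = some u}

variable {k G Z Z'}

theorem mem_adjacentCenters {c : Fin n → Option (Fin n)} {v s : Fin n} :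
    s ∈ adjacentCenters G c v ↔ ∃ u, G.Adj v u ∧ c u = some s := by
  constructor
  · rintro ⟨x, rfl, u, hu, h⟩
    exact ⟨u, h, hu⟩
  · rintro ⟨u, h, hu⟩
    exact ⟨v, rfl, u, hu, h⟩

theorem adj_of_contact {v s u : Fin n} (h : contact k G Z v s = some u) :
    G.Adj v u ∧ firstCenter k G Z u = some s :=
  mem_of_pick (S := {u | G.Adj v u ∧ firstCenter k G Z u = some s}) h

theorem exists_contact {v s : Fin n} (h : s ∈ adjacentCenters G (firstCenter k G Z) v) :
    ∃ u, contact k G Z v s = some u :=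
  exists_pick (mem_adjacentCenters.1 h)

theorem coreCenter_of_isClose {v : Fin n} {p : Fin n × Fin n}
    (hv : IsClose (light G) Z (depth k) v) (hp : nearest (light G) Z v = some p) :
    coreCenter k G Z v = some p.1 := by
  rw [coreCenter, if_pos hv, hp]
  rfl

theorem coreCenter_mem {v s : Fin n} (h : coreCenter k G Z v = some s) : s ∈ Z := by
  rw [coreCenter] at h
  split_ifs at h with h1 h2
  · obtain ⟨p, hp, rfl⟩ := Option.map_eq_some_iff.1 h
    exact (nearest_eq_some_iff.1 hp).1
  · exact (mem_of_pick h).1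

theorem firstCenter_mem {v s : Fin n} (h : firstCenter k G Z v = some s) : s ∈ Z := by
  rw [firstCenter, Option.or_eq_some_iff] at h
  rcases h with h | ⟨-, h⟩
  · exact coreCenter_mem h
  · obtain ⟨u, -, hu⟩ := Option.bind_eq_some_iff.1 h
    exact coreCenter_mem hu

theorem adjacentCenters_subset (v : Fin n) : adjacentCenters G (firstCenter k G Z) v ⊆ Z := by
  intro s hs
  obtain ⟨u, -, hu⟩ := mem_adjacentCenters.1 hs
  exact firstCenter_mem hu

theorem adj_of_parent {v u : Fin n} (h : parent k G Z v = some u) : G.Adj v u := by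
  rw [parent] at h
  split_ifs at h with h1
  · exact light_le G (mem_of_pick h).1
  · rw [Option.or_eq_some_iff] at h
    rcases h with h | ⟨-, h⟩
    · rw [coreCenter, if_neg h1] at h
      split_ifs at h
      exact (mem_of_pick h).2
    · exact (mem_of_pick h).1

theorem adj_of_mem_chosen {v u : Fin n} (h : u ∈ chosen k G Z Z' v) : G.Adj v u := by
  rcases h with h | ⟨s, -, h⟩
  · exact adj_of_parent h
  · exact (adj_of_contact h).1

variable (k G Z Z') in
/-- The spanner of the dense region. -/
def denseSpanner : SimpleGraph (Fin n) where
  Adj u v := v ∈ chosen k G Z Z' u ∨ u ∈ chosen k G Z Z' v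
  symm := ⟨fun _ _ h => h.symm⟩
  loopless := ⟨fun _ h => (adj_of_mem_chosen (h.elim id id)).ne rfl⟩

theorem denseSpanner_le : denseSpanner k G Z Z' ≤ G := by
  rintro u v (h | h)
  · exact adj_of_mem_chosen h
  · exact (adj_of_mem_chosen h).symm

theorem two_le_depth (hk : 6 ≤ k) : 2 ≤ depth k := by
  rw [depth]
  split_ifs <;> omega

/-- Along the parents, the distance to the nearest center decreases and the center does not change. -/
theorem edist_le_of_nearest {H : SimpleGraph (Fin n)}
    (hH : ∀ v u, parent k G Z v = some u → H.Adj v u) :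
    ∀ (d : ℕ) (v : Fin n) (p : Fin n × Fin n), nearest (light G) Z v = some p → p.2.val = d →
      d ≤ depth k → H.edist v p.1 ≤ (d : ℕ∞) := by
  intro d
  induction d with
  | zero =>
    intro v p hp hd _
    have h := (nearest_eq_some_iff.1 hp).2.1
    rw [hd, Nat.cast_zero, SimpleGraph.edist_eq_zero_iff] at h
    rw [← h]; simp
  | succ d ih =>
    intro v p hp hd hle
    have hclose : IsClose (light G) Z (depth k) v := isClose_iff.2 ⟨p, hp, by omega⟩
    obtain ⟨w, q, h1, h2, h3, h4⟩ := (nearest_eq_some_iff.1 hp).exists_between (i := 1) (by omega)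
    rw [Nat.cast_one, SimpleGraph.edist_eq_one_iff_adj] at h1
    obtain ⟨u, hu⟩ := exists_pick (S := {u | (light G).Adj v u ∧ ∃ p q, nearest (light G) Z v = some p ∧
      nearest (light G) Z u = some q ∧ q.1 = p.1 ∧ q.2.val + 1 = p.2.val})
      ⟨w, h1, p, q, hp, nearest_eq_some_iff.2 h2, h3, by omega⟩
    obtain ⟨-, p', q', hp', hq', h5, h6⟩ := mem_of_pick hu
    rw [hp, Option.some.injEq] at hp'
    subst hp'
    have hpar : parent k G Z v = some u := by rw [parent, if_pos hclose, hu]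
    have h7 := ih u q' hq' (by omega) (by omega)
    have h8 : H.edist v u ≤ ((1 : ℕ) : ℕ∞) := by
      rw [SimpleGraph.edist_eq_one_iff_adj.2 (hH v u hpar), Nat.cast_one]
    rw [← h5, Nat.add_comm]
    exact edist_le_add h8 h7

theorem edist_le_one_of_isHeavy {H : SimpleGraph (Fin n)}
    (hH : ∀ v u, parent k G Z v = some u → H.Adj v u) {v s : Fin n}
    (hv : IsHeavy G v ∨ ¬ IsClose (light G) Z (depth k) v)
    (h : coreCenter k G Z v = some s) : H.edist v s ≤ ((1 : ℕ) : ℕ∞) := by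
  by_cases hc : IsClose (light G) Z (depth k) v
  · -- heavy vertices are isolated in the light graph
    obtain ⟨p, hp, -⟩ := isClose_iff.1 hc
    rw [coreCenter_of_isClose hc hp, Option.some.injEq] at h
    have := eq_of_isHeavy_of_edist (hv.resolve_right (not_not.2 hc)) (nearest_eq_some_iff.1 hp).2.1
    rw [← h, ← this]
    simp
  · have hpar : parent k G Z v = some s := by rw [parent, if_neg hc, h, Option.some_or]
    rw [SimpleGraph.edist_eq_one_iff_adj.2 (hH v s hpar), Nat.cast_one]

/-- The first clustering has depth `depth k`. A vertex that joins over a heavy neighbour is at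
distance at most 2 from its center, and `2 ≤ depth k`. -/
theorem edist_firstCenter_le {H : SimpleGraph (Fin n)} (hk : 6 ≤ k)
    (hH : ∀ v u, parent k G Z v = some u → H.Adj v u) {v s : Fin n}
    (h : firstCenter k G Z v = some s) : H.edist v s ≤ (depth k : ℕ∞) := by
  have h2 := two_le_depth hk
  by_cases hc : IsClose (light G) Z (depth k) v
  · obtain ⟨p, hp, hpd⟩ := isClose_iff.1 hc
    rw [firstCenter, coreCenter_of_isClose hc hp, Option.some_or, Option.some.injEq] at h
    rw [← h]
    exact (edist_le_of_nearest hH _ v p hp rfl hpd).trans (by exact_mod_cast hpd)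
  rw [firstCenter, Option.or_eq_some_iff] at h
  rcases h with h | ⟨hnone, h⟩
  · exact (edist_le_one_of_isHeavy hH (Or.inr hc) h).trans (by exact_mod_cast (by omega : 1 ≤ depth k))
  · obtain ⟨u, hu, hus⟩ := Option.bind_eq_some_iff.1 h
    have hpar : parent k G Z v = some u := by rw [parent, if_neg hc, hnone, Option.none_or, hu]
    have h3 : H.edist v u ≤ ((1 : ℕ) : ℕ∞) := by
      rw [SimpleGraph.edist_eq_one_iff_adj.2 (hH v u hpar), Nat.cast_one]
    have h4 := edist_le_add h3 (edist_le_one_of_isHeavy hH (Or.inl (mem_of_pick hu).2) hus)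
    exact h4.trans (by exact_mod_cast h2)

theorem parent_adj {v u : Fin n} (h : parent k G Z v = some u) : (denseSpanner k G Z Z').Adj v u :=
  Or.inl (Or.inl h)

/-- A vertex is joined to the first cluster of each of its targets. -/
theorem exists_adj_of_mem_targets {v s : Fin n} (h : s ∈ targets k G Z Z' v) :
    ∃ u, (denseSpanner k G Z Z').Adj v u ∧ firstCenter k G Z u = some s := by
  obtain ⟨u, hu⟩ := exists_contact h.1
  exact ⟨u, Or.inl (Or.inr ⟨s, h, hu⟩), (adj_of_contact hu).2⟩

theorem isDepthClustering_of_edist_le {H : SimpleGraph (Fin n)} {ℓ : ℕ} {Y : Set (Fin n)}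
    {c : Fin n → Option (Fin n)} (hc : ∀ v s, c v = some s → s ∈ Y ∧ H.edist v s ≤ (ℓ : ℕ∞)) :
    IsDepthClustering H ℓ Y c :=
  ⟨fun v s h => (hc v s h).1, fun s _ => hasRootedTree_of_edist_le fun x hx => by
    rw [SimpleGraph.edist_comm]; exact (hc x s hx).2⟩

theorem secondCenter_of_odd (hk : Odd k) : secondCenter k G Z Z' = firstCenter k G Z := by
  funext v
  rw [secondCenter, if_neg (Nat.not_even_iff_odd.2 hk)]

theorem secondCenter_mem_of_even (hk : Even k) {v s : Fin n} (h : secondCenter k G Z Z' v = some s) :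
    IsCrowded k G Z v ∧ s ∈ Z' ∧ s ∈ adjacentCenters G (firstCenter k G Z) v := by
  rw [secondCenter, if_pos hk] at h
  split_ifs at h with hv
  exact ⟨hv, mem_of_pick (S := Z' ∩ adjacentCenters G (firstCenter k G Z) v) h⟩

theorem edist_secondCenter_le (hk6 : 6 ≤ k) (hk : Even k) {v s : Fin n}
    (h : secondCenter k G Z Z' v = some s) :
    (denseSpanner k G Z Z').edist v s ≤ ((k / 2 : ℕ) : ℕ∞) := by
  obtain ⟨u, hu, hus⟩ := exists_adj_of_mem_targets (k := k) (G := G) (Z := Z) (Z' := Z') (v := v)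
    (s := s) ⟨(secondCenter_mem_of_even hk h).2.2, Or.inl h⟩
  have h1 : (denseSpanner k G Z Z').edist v u ≤ ((1 : ℕ) : ℕ∞) := by
    rw [SimpleGraph.edist_eq_one_iff_adj.2 hu, Nat.cast_one]
  have h2 := edist_le_add h1 (edist_firstCenter_le hk6 (fun v u => parent_adj (Z' := Z')) hus)
  have h3 : 1 + depth k = k / 2 := by
    rw [depth, if_pos hk]; omega
  rwa [h3] at h2

theorem connected_clusters {s₁ s₂ : Fin n}
    (h : Adjacent G (cluster (firstCenter k G Z) s₁) (cluster (secondCenter k G Z Z') s₂)) :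
    Adjacent (denseSpanner k G Z Z') (cluster (firstCenter k G Z) s₁)
      (cluster (secondCenter k G Z Z') s₂) := by
  obtain ⟨x, hx, y, hy, hxy⟩ := h
  obtain ⟨v, hv⟩ := exists_pick
    (S := {v | secondCenter k G Z Z' v = some s₂ ∧ s₁ ∈ adjacentCenters G (firstCenter k G Z) v})
    ⟨y, hy, mem_adjacentCenters.2 ⟨x, hxy.symm, hx⟩⟩
  have hv' := mem_of_pick hv
  obtain ⟨u, hu, hus⟩ := exists_adj_of_mem_targets (k := k) (G := G) (Z := Z) (Z' := Z') (v := v)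
    (s := s₁) ⟨hv'.2, Or.inr (Or.inr ⟨s₂, hv'.1, hv⟩)⟩
  exact ⟨u, hus, v, hv'.1, hu.symm⟩

/-- Between two clusters there is a path over the edge that joins them. -/
theorem edist_le_of_adjacent {H : SimpleGraph (Fin n)} {X Y : Set (Fin n)} {u v s₁ s₂ : Fin n}
    {a e : ℕ} (hu : u ∈ X) (hv : v ∈ Y) (hX : ∀ x ∈ X, H.edist x s₁ ≤ (a : ℕ∞))
    (hY : ∀ y ∈ Y, H.edist y s₂ ≤ (e : ℕ∞)) (h : Adjacent H X Y) :
    H.edist u v ≤ ((a + a + 1 + e + e : ℕ) : ℕ∞) := by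
  obtain ⟨x, hx, y, hy, hxy⟩ := h
  have h1 : H.edist x y ≤ ((1 : ℕ) : ℕ∞) := by
    rw [SimpleGraph.edist_eq_one_iff_adj.2 hxy, Nat.cast_one]
  have h2 := hX x hx
  rw [SimpleGraph.edist_comm] at h2
  have h3 := hY v hv
  rw [SimpleGraph.edist_comm] at h3
  exact edist_le_add (edist_le_add (edist_le_add (edist_le_add (hX u hu) h2) h1) (hY y hy)) h3

/-- The stretch: a dense edge `uv` is replaced by two paths to and from the center of `u`, of length at
most `h = depth k`, an edge to the second cluster of `v`, and two paths in that one. For even `k`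
this is `2 * h + 1 + 2 * (k / 2) = 2 * k - 1`, and for odd `k` it is `4 * h + 1 = 2 * k - 1`. -/
theorem edist_le_of_isDense (hk : 6 ≤ k) (hcov : ∀ v, IsDense k G v → firstCenter k G Z v ≠ none)
    {u v : Fin n} (huv : G.Adj u v) (hu : IsDense k G u) (hv : IsDense k G v) :
    (denseSpanner k G Z Z').edist u v ≤ ((2 * k - 1 : ℕ) : ℕ∞) := by
  obtain ⟨s₁, hs₁⟩ := Option.ne_none_iff_exists'.1 (hcov u hu)
  have hpar := fun v u => parent_adj (k := k) (G := G) (Z := Z) (Z' := Z') (v := v) (u := u)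
  have hfirst : ∀ x ∈ cluster (firstCenter k G Z) s₁,
      (denseSpanner k G Z Z').edist x s₁ ≤ (depth k : ℕ∞) := fun x hx =>
    edist_firstCenter_le hk hpar hx
  rcases h2 : secondCenter k G Z Z' v with _ | s₂
  · obtain ⟨x, hx, hxs⟩ := exists_adj_of_mem_targets (k := k) (G := G) (Z := Z) (Z' := Z') (v := v)
      (s := s₁) ⟨mem_adjacentCenters.2 ⟨u, huv.symm, hs₁⟩, Or.inr (Or.inl ⟨hv, h2⟩)⟩
    have h3 := edist_le_of_adjacent (Y := {v}) (s₂ := v) (e := 0) hs₁ rfl hfirst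
      (by rintro y rfl; simp) ⟨x, hxs, v, rfl, hx.symm⟩
    refine h3.trans (Nat.cast_le.2 ?_)
    rw [depth]
    split_ifs <;> omega
  · have hadj := connected_clusters (k := k) (G := G) (Z := Z) (Z' := Z') (s₁ := s₁) (s₂ := s₂)
      ⟨u, hs₁, v, h2, huv⟩
    rcases Nat.even_or_odd k with hk2 | hk2
    · have h3 := edist_le_of_adjacent (s₂ := s₂) (e := k / 2) hs₁ h2 hfirst
        (fun y hy => edist_secondCenter_le hk hk2 hy) hadj
      refine h3.trans (Nat.cast_le.2 ?_)
      rw [depth, if_pos hk2]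
      omega
    · rw [secondCenter_of_odd hk2] at h2 hadj
      have h3 := edist_le_of_adjacent (s₂ := s₂) (e := depth k) hs₁ h2 hfirst
        (fun y hy => edist_firstCenter_le hk hpar hy) hadj
      refine h3.trans (Nat.cast_le.2 ?_)
      rw [depth, if_neg (Nat.not_even_iff_odd.2 hk2)]
      obtain ⟨j, rfl⟩ := hk2
      omega

end Construction

/-! ### Counting centers and edges -/

section Counting

variable {n k : ℕ} {G : SimpleGraph (Fin n)} {Z Z' : Set (Fin n)}

/-- The first clustering covers all dense vertices. -/
theorem firstCenter_ne_none (hheavy : ∀ v, IsHeavy G v → ∃ z ∈ Z, G.Adj v z)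
    (hbig : ∀ v, IsBig ((n : ℝ) ^ ((depth k : ℝ) / (k : ℝ))) (light G) (depth k) v →
      IsClose (light G) Z (depth k) v) (v : Fin n) (hv : IsDense k G v) :
    firstCenter k G Z v ≠ none := by
  have hclose : ∀ u, IsClose (light G) Z (depth k) u → coreCenter k G Z u ≠ none := by
    intro u hu
    obtain ⟨p, hp, -⟩ := isClose_iff.1 hu
    rw [coreCenter_of_isClose hu hp]
    simp
  have hcore : ∀ u, IsHeavy G u → coreCenter k G Z u ≠ none := by
    intro u hu
    by_cases hc : IsClose (light G) Z (depth k) u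
    · exact hclose u hc
    · obtain ⟨z, hz, hadj⟩ := hheavy u hu
      obtain ⟨x, hx⟩ := exists_pick (S := {z | z ∈ Z ∧ G.Adj u z}) ⟨z, hz, hadj⟩
      rw [coreCenter, if_neg hc, if_pos hu, hx]
      simp
  have hor : coreCenter k G Z v ≠ none → firstCenter k G Z v ≠ none := by
    intro h h'
    rw [firstCenter, Option.or_eq_none_iff] at h'
    exact h h'.1
  rcases hv with hv | ⟨u, hu, hu'⟩ | hv
  · exact hor (hcore v hv)
  · obtain ⟨w, hw⟩ := exists_pick (S := {u | G.Adj v u ∧ IsHeavy G u}) ⟨u, hu, hu'⟩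
    intro h'
    rw [firstCenter, Option.or_eq_none_iff, heavyNeighbor, hw, Option.bind_some] at h'
    exact hcore w (mem_of_pick hw).2 h'.2
  · exact hor (hclose v (hbig v hv))

theorem ncard_pairs_le (B : Fin n → Set (Fin n)) {M : ℝ} (hB : ∀ v, ((B v).ncard : ℝ) ≤ M) :
    (({x : Fin n × Fin n | x.2 ∈ B x.1}.ncard : ℕ) : ℝ) ≤ n * M := by
  have h1 : {x : Fin n × Fin n | x.2 ∈ B x.1}.ncard ≤ ∑ v, (B v).ncard := by
    rw [← Nat.card_coe_set_eq]
    refine (Nat.card_le_card_of_injective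
      (fun x : {x : Fin n × Fin n | x.2 ∈ B x.1} => (⟨x.1.1, x.1.2, x.2⟩ : Σ v, B v)) ?_).trans
      (le_of_eq ?_)
    · rintro ⟨⟨a, c⟩, h⟩ ⟨⟨a', c'⟩, h'⟩ he
      simp only [Sigma.mk.injEq] at he
      obtain ⟨rfl, he⟩ := he
      simpa using he
    · rw [Nat.card_sigma]
      simp only [Nat.card_coe_set_eq]
  calc (({x : Fin n × Fin n | x.2 ∈ B x.1}.ncard : ℕ) : ℝ) ≤ ∑ v, ((B v).ncard : ℝ) := by
        exact_mod_cast h1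
    _ ≤ ∑ _v : Fin n, M := Finset.sum_le_sum fun v _ => hB v
    _ = n * M := by simp

theorem ncard_partial_image_le {α β : Type} [Finite α] [Nonempty β] (f : α → Option β) (A : Set α) :
    {y | ∃ x ∈ A, f x = some y}.ncard ≤ A.ncard := by
  refine (Set.ncard_le_ncard (t := (fun x => (f x).getD (Classical.arbitrary β)) '' A) ?_
    (Set.toFinite _)).trans (Set.ncard_image_le (Set.toFinite _))
  rintro y ⟨x, hx, hy⟩
  exact ⟨x, hx, by simp [hy]⟩

/-- Each vertex chooses at most two edges, apart from those for the dense vertices outside the second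
clustering and the one for each pair of clusters of the two levels. -/
theorem ncard_edgeSet_le {Y : Set (Fin n)} {M : ℝ} (hM : 0 ≤ M)
    (hY : ∀ v s, secondCenter k G Z Z' v = some s → s ∈ Y)
    (hfew : ∀ v, IsDense k G v → secondCenter k G Z Z' v = none →
      ((adjacentCenters G (firstCenter k G Z) v).ncard : ℝ) ≤ M) :
    ((denseSpanner k G Z Z').edgeSet.ncard : ℝ) ≤ 2 * n + n * M + Z.ncard * Y.ncard := by
  rcases Nat.eq_zero_or_pos n with rfl | hn
  · have : (denseSpanner k G Z Z').edgeSet = ∅ := by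
      ext e
      induction e using Sym2.ind with
      | _ x y => exact x.elim0
    rw [this]
    simp
    positivity
  have : Nonempty (Fin n) := ⟨⟨0, hn⟩⟩
  set A₁ : Set (Fin n × Fin n) := {x | ∃ v ∈ (Set.univ : Set (Fin n)),
    (parent k G Z v).map (fun u => (v, u)) = some x} with hA₁
  set A₂ : Set (Fin n × Fin n) := {x | ∃ v ∈ (Set.univ : Set (Fin n)),
    ((secondCenter k G Z Z' v).bind (contact k G Z v)).map (fun u => (v, u)) = some x} with hA₂
  set B : Fin n → Set (Fin n) := fun v => {s | s ∈ adjacentCenters G (firstCenter k G Z) v ∧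
    IsDense k G v ∧ secondCenter k G Z Z' v = none} with hB
  set A₃ : Set (Fin n × Fin n) := {x | ∃ y ∈ {y : Fin n × Fin n | y.2 ∈ B y.1},
    (contact k G Z y.1 y.2).map (fun u => (y.1, u)) = some x} with hA₃
  set A₄ : Set (Fin n × Fin n) := {x | ∃ y ∈ Z ×ˢ Y,
    (delegate k G Z Z' y.1 y.2).bind (fun v => (contact k G Z v y.1).map (fun u => (v, u))) = some x}
    with hA₄
  have hsub : (denseSpanner k G Z Z').edgeSet ⊆
      (fun x : Fin n × Fin n => s(x.1, x.2)) '' (A₁ ∪ A₂ ∪ A₃ ∪ A₄) := by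
    have key : ∀ v u, u ∈ chosen k G Z Z' v → (v, u) ∈ A₁ ∪ A₂ ∪ A₃ ∪ A₄ := by
      rintro v u (h | ⟨s, ⟨hs, h⟩, hu⟩)
      · exact Or.inl (Or.inl (Or.inl ⟨v, trivial, by rw [h]; rfl⟩))
      · rcases h with h | h | ⟨s₂, h, h'⟩
        · exact Or.inl (Or.inl (Or.inr ⟨v, trivial, by rw [h, Option.bind_some, hu]; rfl⟩))
        · exact Or.inl (Or.inr ⟨(v, s), ⟨hs, h⟩, by simp only; rw [hu]; rfl⟩)
        · exact Or.inr ⟨(s, s₂), ⟨adjacentCenters_subset v hs, hY v s₂ h⟩,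
            by simp only; rw [h', Option.bind_some, hu]; rfl⟩
    intro e he
    induction e using Sym2.ind with
    | _ x y =>
      rcases he with h | h
      · exact ⟨(x, y), key x y h, rfl⟩
      · exact ⟨(y, x), key y x h, Sym2.eq_swap⟩
  have h0 : (denseSpanner k G Z Z').edgeSet.ncard ≤ A₁.ncard + A₂.ncard + A₃.ncard + A₄.ncard := by
    refine (Set.ncard_le_ncard hsub (Set.toFinite _)).trans
      ((Set.ncard_image_le (Set.toFinite _)).trans ?_)
    have e1 := Set.ncard_union_le (A₁ ∪ A₂ ∪ A₃) A₄
    have e2 := Set.ncard_union_le (A₁ ∪ A₂) A₃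
    have e3 := Set.ncard_union_le A₁ A₂
    omega
  have h1 : A₁.ncard ≤ n := (ncard_partial_image_le _ _).trans (by simp [Set.ncard_univ])
  have h2 : A₂.ncard ≤ n := (ncard_partial_image_le _ _).trans (by simp [Set.ncard_univ])
  have h3 : (A₃.ncard : ℝ) ≤ n * M := by
    refine le_trans (by exact_mod_cast ncard_partial_image_le _ _) (ncard_pairs_le B (M := M) ?_)
    intro v
    by_cases hv : IsDense k G v ∧ secondCenter k G Z Z' v = none
    · refine le_trans ?_ (hfew v hv.1 hv.2)
      exact_mod_cast Set.ncard_le_ncard (fun s (hs : s ∈ B v) => hs.1) (Set.toFinite _)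
    · have : B v = ∅ := by
        ext s
        simp only [hB, Set.mem_ofPred_eq, Set.mem_empty_iff_false, iff_false]
        exact fun h => hv h.2
      rw [this]
      simpa using hM
  have h4 : A₄.ncard ≤ Z.ncard * Y.ncard :=
    (ncard_partial_image_le _ _).trans (le_of_eq Set.ncard_prod)
  have h0' : ((denseSpanner k G Z Z').edgeSet.ncard : ℝ) ≤
      A₁.ncard + A₂.ncard + A₃.ncard + A₄.ncard := by exact_mod_cast h0
  have h1' : (A₁.ncard : ℝ) ≤ n := by exact_mod_cast h1
  have h2' : (A₂.ncard : ℝ) ≤ n := by exact_mod_cast h2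
  have h4' : (A₄.ncard : ℝ) ≤ Z.ncard * Y.ncard := by exact_mod_cast h4
  linarith

theorem depth_div_of_even (hk : 6 ≤ k) (h : Even k) :
    (depth k : ℝ) / (k : ℝ) = 1 / 2 - 1 / (k : ℝ) := by
  obtain ⟨j, rfl⟩ := h
  have hj : (j : ℝ) ≠ 0 := by
    have : j ≠ 0 := by omega
    exact_mod_cast this
  have : depth (j + j) = j - 1 := by
    rw [depth, if_pos ⟨j, rfl⟩]; omega
  rw [this, Nat.cast_sub (by omega)]
  push_cast
  rw [← two_mul]
  field_simp

theorem depth_div_of_odd (h : Odd k) :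
    (depth k : ℝ) / (k : ℝ) = 1 / 2 - 1 / (2 * (k : ℝ)) := by
  obtain ⟨j, rfl⟩ := h
  have : depth (2 * j + 1) = j := by
    rw [depth, if_neg (Nat.not_even_iff_odd.2 ⟨j, rfl⟩)]; omega
  have hk0 : (2 * (j : ℝ) + 1) ≠ 0 := by positivity
  rw [this]
  push_cast
  field_simp
  ring

theorem depth_div_le (hk : 6 ≤ k) : (depth k : ℝ) / (k : ℝ) ≤ 1 / 2 := by
  have hk0 : (0 : ℝ) < k := by positivity
  rcases Nat.even_or_odd k with h | h
  · rw [depth_div_of_even hk h]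
    have : 0 < 1 / (k : ℝ) := by positivity
    linarith
  · rw [depth_div_of_odd h]
    have : 0 < 1 / (2 * (k : ℝ)) := by positivity
    linarith

theorem one_le_logb (hn : 2 ≤ n) : 1 ≤ Real.logb 2 n := by
  rw [Real.le_logb_iff_rpow_le one_lt_two (by positivity), Real.rpow_one]
  exact_mod_cast hn

/-- The constant in the bounds for the numbers of centers and edges: for even `k` the edges need
`2 + 1 + c * (c + c ^ 2)`, the first center set needs `c` and the second one `c + c ^ 2`. -/
noncomputable def sizeConstant (c : ℝ) : ℝ := 3 + c + 2 * c ^ 2 + c ^ 3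

/-- If `Z` and `Z'` are small hitting sets, the edges that the vertices choose form a spanner of the
dense region. -/
theorem isDenseSpanner_of_hitting {c : ℝ} (hc : 0 < c) (hk : 6 ≤ k) (hn : 2 ≤ n)
    (hheavy : ∀ v, IsHeavy G v → ∃ z ∈ Z, G.Adj v z)
    (hbig : ∀ v, IsBig ((n : ℝ) ^ ((depth k : ℝ) / (k : ℝ))) (light G) (depth k) v →
      IsClose (light G) Z (depth k) v)
    (hcard : (Z.ncard : ℝ) ≤ c * n * Real.logb 2 n / (n : ℝ) ^ ((depth k : ℝ) / (k : ℝ)))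
    (hsub : Z' ⊆ Z)
    (hhit : ∀ v, IsCrowded k G Z v → (Z' ∩ adjacentCenters G (firstCenter k G Z) v).Nonempty)
    (hcard' : (Z'.ncard : ℝ) ≤ c * Z.ncard * Real.logb 2 n /
      min ((n : ℝ) ^ (1 / (k : ℝ)) * Real.logb 2 n) n)
    {out : Fin n → Set (Fin n)}
    (hout : ∀ v, out v = {u | u ∈ chosen k G Z Z' v ∨ v ∈ chosen k G Z Z' u}) :
    IsDenseSpanner (sizeConstant c) k G out := by
  have hcov := firstCenter_ne_none hheavy hbig
  have hn0 : (0 : ℝ) < n := by positivity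
  have hn1 : (1 : ℝ) ≤ n := by exact_mod_cast (by omega : 1 ≤ n)
  have hk0 : (0 : ℝ) < k := by positivity
  have hlog := one_le_logb hn
  have hlog0 : 0 < Real.logb 2 n := by linarith
  have hlog2 : Real.logb 2 n ≤ Real.logb 2 n ^ 2 := by nlinarith
  have hC0 : 0 ≤ sizeConstant c := by rw [sizeConstant]; positivity
  have hcC : c ≤ sizeConstant c := by
    rw [sizeConstant]; nlinarith [pow_pos hc 2, pow_pos hc 3]
  have hcC2 : c + c ^ 2 ≤ sizeConstant c := by
    rw [sizeConstant]; nlinarith [pow_pos hc 2, pow_pos hc 3]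
  -- the sizes of the center sets
  have hZ : (Z.ncard : ℝ) ≤ c * (n : ℝ) ^ (1 - (depth k : ℝ) / (k : ℝ)) * Real.logb 2 n := by
    refine hcard.trans (le_of_eq ?_)
    rw [Real.rpow_sub hn0, Real.rpow_one]
    ring
  have hZn : (Z.ncard : ℝ) ≤ n := by
    have := Set.ncard_le_ncard (Set.subset_univ Z) (Set.toFinite _)
    rw [Set.ncard_univ, Nat.card_eq_fintype_card, Fintype.card_fin] at this
    exact_mod_cast this
  have hZ' : Even k → (Z'.ncard : ℝ) ≤ (c + c ^ 2) * (n : ℝ) ^ (1 / 2 : ℝ) * Real.logb 2 n := by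
    intro hk2
    have hp := Real.one_le_rpow hn1 (show (0 : ℝ) ≤ 1 / 2 by norm_num)
    have hpk : 0 < (n : ℝ) ^ (1 / (k : ℝ)) := by positivity
    refine hcard'.trans ?_
    rcases min_choice ((n : ℝ) ^ (1 / (k : ℝ)) * Real.logb 2 n) (n : ℝ) with h | h <;> rw [h]
    · rw [div_le_iff₀ (by positivity)]
      have h1 : (n : ℝ) ^ (1 - (depth k : ℝ) / (k : ℝ)) =
          (n : ℝ) ^ (1 / 2 : ℝ) * (n : ℝ) ^ (1 / (k : ℝ)) := by
        rw [← Real.rpow_add hn0, depth_div_of_even hk hk2]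
        congr 1
        ring
      rw [h1] at hZ
      calc c * Z.ncard * Real.logb 2 n
          ≤ c * (c * ((n : ℝ) ^ (1 / 2 : ℝ) * (n : ℝ) ^ (1 / (k : ℝ))) * Real.logb 2 n) *
            Real.logb 2 n := by gcongr
        _ = c ^ 2 * ((n : ℝ) ^ (1 / 2 : ℝ) * Real.logb 2 n *
            ((n : ℝ) ^ (1 / (k : ℝ)) * Real.logb 2 n)) := by ring
        _ ≤ (c + c ^ 2) * ((n : ℝ) ^ (1 / 2 : ℝ) * Real.logb 2 n *
            ((n : ℝ) ^ (1 / (k : ℝ)) * Real.logb 2 n)) := by gcongr; linarith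
        _ = _ := by ring
    · rw [div_le_iff₀ hn0]
      calc c * Z.ncard * Real.logb 2 n ≤ c * n * Real.logb 2 n := by gcongr
        _ ≤ (c + c ^ 2) * n * Real.logb 2 n := by
            gcongr
            nlinarith [pow_pos hc 2]
        _ = (c + c ^ 2) * 1 * Real.logb 2 n * n := by ring
        _ ≤ _ := by gcongr
  have hpow : (n : ℝ) ≤ (n : ℝ) ^ (1 + 1 / (k : ℝ)) := by
    conv_lhs => rw [← Real.rpow_one (n : ℝ)]
    exact Real.rpow_le_rpow_of_exponent_le hn1 (by have : 0 < 1 / (k : ℝ) := by positivity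
                                                   linarith)
  have hpow0 : 0 < (n : ℝ) ^ (1 + 1 / (k : ℝ)) := by positivity
  have h2n : 2 * (n : ℝ) ≤ 2 * (n : ℝ) ^ (1 + 1 / (k : ℝ)) * Real.logb 2 n ^ 2 := by
    nlinarith [mul_le_mul hpow (hlog.trans hlog2) zero_le_one hpow0.le]
  refine ⟨denseSpanner k G Z Z', ?_, denseSpanner_le,
    fun u v huv hu hv => edist_le_of_isDense hk hcov huv hu hv, ?_,
    Z, if Even k then Z' else Z, firstCenter k G Z, secondCenter k G Z Z', ?_⟩
  · intro v
    rw [hout]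
    ext u
    exact Iff.rfl
  · rcases Nat.even_or_odd k with hk2 | hk2
    · have h1 := ncard_edgeSet_le (k := k) (G := G) (Z := Z) (Z' := Z') (Y := Z')
        (M := (n : ℝ) ^ (1 / (k : ℝ)) * Real.logb 2 n) (by positivity)
        (fun v s h => (secondCenter_mem_of_even hk2 h).2.1) (by
          intro v hv hnone
          by_contra hlt
          obtain ⟨x, hx⟩ := exists_pick (hhit v ⟨hv, not_le.1 hlt⟩)
          rw [secondCenter, if_pos hk2, if_pos ⟨hv, not_le.1 hlt⟩, hx] at hnone
          exact absurd hnone (by simp))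
      refine h1.trans ?_
      have h3 : (n : ℝ) * ((n : ℝ) ^ (1 / (k : ℝ)) * Real.logb 2 n) ≤
          (n : ℝ) ^ (1 + 1 / (k : ℝ)) * Real.logb 2 n ^ 2 := by
        rw [Real.rpow_add hn0, Real.rpow_one, ← mul_assoc]
        gcongr
      have h4 : (Z.ncard : ℝ) * Z'.ncard ≤
          (c ^ 2 + c ^ 3) * ((n : ℝ) ^ (1 + 1 / (k : ℝ)) * Real.logb 2 n ^ 2) := by
        calc (Z.ncard : ℝ) * Z'.ncard
            ≤ (c * (n : ℝ) ^ (1 - (depth k : ℝ) / (k : ℝ)) * Real.logb 2 n) *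
              ((c + c ^ 2) * (n : ℝ) ^ (1 / 2 : ℝ) * Real.logb 2 n) := by
              gcongr; exact hZ' hk2
          _ = (c ^ 2 + c ^ 3) * (((n : ℝ) ^ (1 - (depth k : ℝ) / (k : ℝ)) * (n : ℝ) ^ (1 / 2 : ℝ)) *
              Real.logb 2 n ^ 2) := by ring
          _ = _ := by
              rw [← Real.rpow_add hn0, depth_div_of_even hk hk2,
                show (1 : ℝ) - (1 / 2 - 1 / (k : ℝ)) + 1 / 2 = 1 + 1 / k by ring]
      have h5 : 0 ≤ (c + c ^ 2) * ((n : ℝ) ^ (1 + 1 / (k : ℝ)) * Real.logb 2 n ^ 2) := by positivity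
      rw [sizeConstant]
      linarith
    · have h1 := ncard_edgeSet_le (k := k) (G := G) (Z := Z) (Z' := Z') (Y := Z) (M := 0) le_rfl
        (fun v s h => firstCenter_mem (by rwa [secondCenter_of_odd hk2] at h)) (by
          intro v hv hnone
          rw [secondCenter_of_odd hk2] at hnone
          exact absurd hnone (hcov v hv))
      refine h1.trans ?_
      have h4 : (Z.ncard : ℝ) * Z.ncard ≤
          c ^ 2 * ((n : ℝ) ^ (1 + 1 / (k : ℝ)) * Real.logb 2 n ^ 2) := by
        calc (Z.ncard : ℝ) * Z.ncard
            ≤ (c * (n : ℝ) ^ (1 - (depth k : ℝ) / (k : ℝ)) * Real.logb 2 n) *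
              (c * (n : ℝ) ^ (1 - (depth k : ℝ) / (k : ℝ)) * Real.logb 2 n) := by gcongr
          _ = c ^ 2 * (((n : ℝ) ^ (1 - (depth k : ℝ) / (k : ℝ)) *
              (n : ℝ) ^ (1 - (depth k : ℝ) / (k : ℝ))) * Real.logb 2 n ^ 2) := by ring
          _ = _ := by
              rw [← Real.rpow_add hn0, depth_div_of_odd hk2,
                show (1 : ℝ) - (1 / 2 - 1 / (2 * (k : ℝ))) + (1 - (1 / 2 - 1 / (2 * (k : ℝ)))) =
                  1 + 1 / k by ring]
      have h5 : 0 ≤ (1 + c + c ^ 2 + c ^ 3) * ((n : ℝ) ^ (1 + 1 / (k : ℝ)) * Real.logb 2 n ^ 2) := by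
        positivity
      rw [sizeConstant]
      linarith
  · refine ⟨isDepthClustering_of_edist_le fun v s h => ⟨firstCenter_mem h,
      edist_firstCenter_le hk (fun v u => parent_adj) h⟩, hcov, hZ.trans (by gcongr), ?_, ?_, ?_, ?_⟩
    · intro hk2
      rw [if_pos hk2]
      refine ⟨hsub, isDepthClustering_of_edist_le fun v s h =>
        ⟨(secondCenter_mem_of_even hk2 h).2.1, edist_secondCenter_le hk hk2 h⟩, fun v => ?_,
        fun v s h => (secondCenter_mem_of_even hk2 h).2.2, (hZ' hk2).trans (by gcongr)⟩
      constructor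
      · intro h
        obtain ⟨s, hs⟩ := Option.ne_none_iff_exists'.1 h
        exact (secondCenter_mem_of_even hk2 hs).1
      · intro h
        obtain ⟨x, hx⟩ := exists_pick (hhit v h)
        rw [secondCenter, if_pos hk2, if_pos (show IsCrowded k G Z v from h), hx]
        simp
    · intro hk2
      exact ⟨if_neg (Nat.not_even_iff_odd.2 hk2), secondCenter_of_odd hk2⟩
    · intro v hv hnone s hs
      obtain ⟨u, hu, hus⟩ := exists_adj_of_mem_targets (k := k) (G := G) (Z := Z) (Z' := Z') (v := v)
        (s := s) ⟨hs, Or.inr (Or.inl ⟨hv, hnone⟩)⟩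
      exact ⟨v, rfl, u, hus, hu⟩
    · intro s₁ _ s₂ _ h
      exact connected_clusters h

end Counting

/-! ### The two hitting-set instances -/

section Instances

variable {n k : ℕ}

theorem rpow_depth_le_sqrt (hk : 6 ≤ k) (hn : 2 ≤ n) :
    (n : ℝ) ^ ((depth k : ℝ) / (k : ℝ)) ≤ Real.sqrt n := by
  rw [Real.sqrt_eq_rpow]
  exact Real.rpow_le_rpow_of_exponent_le (by exact_mod_cast (by omega : 1 ≤ n)) (depth_div_le hk)

theorem one_le_rpow_depth (hn : 2 ≤ n) : 1 ≤ (n : ℝ) ^ ((depth k : ℝ) / (k : ℝ)) :=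
  Real.one_le_rpow (by exact_mod_cast (by omega : 1 ≤ n)) (by positivity)

/-- The first instance: the heavy vertices have to be hit in their neighbourhoods, the witnesses
in the big balls that they know. -/
noncomputable def firstInstance (hk : 6 ≤ k) (hn : 2 ≤ n) (G : SimpleGraph (Fin n))
    (S : Fin n → Option (Set (Fin n)))
    (hS : ∀ v X, S v = some X → (n : ℝ) ^ ((depth k : ℝ) / (k : ℝ)) < (X.ncard : ℝ)) :
    HittingInstance n where
  Δ := (n : ℝ) ^ ((depth k : ℝ) / (k : ℝ))
  owners := {v | IsHeavy G v ∨ ∃ X, S v = some X}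
  ground := Set.univ
  S v := (S v).getD (G.neighborSet v)
  one_le := one_le_rpow_depth hn
  le_card := (rpow_depth_le_sqrt hk hn).trans (by
    rw [Real.sqrt_le_left (by positivity)]
    exact_mod_cast Nat.le_self_pow two_ne_zero n)
  large := by
    intro v hv
    rcases h : S v with _ | X
    · have hv' : IsHeavy G v := hv.resolve_right (by rintro ⟨X, hX⟩; rw [h] at hX; simp at hX)
      exact (rpow_depth_le_sqrt hk hn).trans hv'
    · exact (hS v X h).le
  sub := fun _ _ => Set.subset_univ _

/-- The second instance: the crowded vertices have to be hit among the centers of their adjacent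
clusters. The minimum with `n` does not exclude any owner. -/
noncomputable def secondInstance (k : ℕ) (hn : 2 ≤ n) (G : SimpleGraph (Fin n)) (Z : Set (Fin n)) :
    HittingInstance n where
  Δ := min ((n : ℝ) ^ (1 / (k : ℝ)) * Real.logb 2 n) n
  owners := {v | IsCrowded k G Z v}
  ground := Z
  S v := adjacentCenters G (firstCenter k G Z) v
  one_le := by
    have hn1 : (1 : ℝ) ≤ n := by exact_mod_cast (by omega : 1 ≤ n)
    refine le_min ?_ hn1
    have h1 := Real.one_le_rpow hn1 (show (0 : ℝ) ≤ 1 / (k : ℝ) by positivity)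
    have h2 := one_le_logb hn
    nlinarith
  le_card := min_le_right _ _
  large := fun v hv => (min_le_left _ _).trans hv.2.le
  sub := fun v _ => adjacentCenters_subset v

end Instances

/-! ### Calling the hitting-set algorithm -/

section Subroutine

variable {b n : ℕ} {Ω I : Type} {inp : Ω → Fin n → I} {t : ℕ} {R : Fin n → Ω → Ω → Prop}

theorem card_prop_le (hn : 2 ≤ n) : Nat.card Prop ≤ n ^ 1 := by
  simpa using hn

/-- Calling the hitting-set algorithm: the nodes first tell each other who owns a set, and in the end
who belongs to the hitting set. -/
theorem Attains.call_hittingSet {b' : ℕ} {Seed : ℕ → Type} {A : HittingSetAlgorithm b Seed} {r : ℕ → ℕ}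
    (hA : HittingSetAlgorithm.RunsIn A r) (hbb : b ≤ b') (hb : 1 ≤ b') (hn : 2 ≤ n)
    (h : Attains b' inp t R) (P : Ω → HittingInstance n) (ρ : Ω → Fin n → Seed n)
    (Δ : ℝ) (hΔ : ∀ ω, (P ω).Δ = Δ)
    (hown : ∀ v ω ω', R v ω ω' → (v ∈ (P ω).owners ↔ v ∈ (P ω').owners))
    (hground : ∀ v ω ω', R v ω ω' → (P ω).ground = (P ω').ground)
    (hS : ∀ v ω ω', R v ω ω' → (P ω).S v = (P ω').S v)
    (hρ : ∀ v ω ω', R v ω ω' → ρ ω v = ρ ω' v) :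
    Attains b' inp (t + (r n + 2)) (fun v ω ω' => R v ω ω' ∧
      HittingSetAlgorithm.result A (P ω) (ρ ω) = HittingSetAlgorithm.result A (P ω') (ρ ω')) := by
  have h1 := h.broadcast (e := 1) hb (card_prop_le hn) (fun ω v => v ∈ (P ω).owners)
    (fun v ω ω' hR => propext (hown v ω ω' hR))
  have h2 := h1.call ((Algorithm.ofFamily (fun p : Set (Fin n) × Set (Fin n) => A n Δ p.1 p.2)
    (r n)).widen hbb) (fun ω v => (((P ω).owners, (P ω).ground), ((P ω).localSet v, ρ ω v))) (by
      rintro v ω ω' ⟨hR, ho⟩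
      have ho' : (P ω).owners = (P ω').owners := by
        ext u
        exact iff_of_eq (congrFun ho u)
      simp only [HittingInstance.localSet, ho', hground v ω ω' hR, hS v ω ω' hR, hρ v ω ω' hR])
  have hrun : ∀ ω, ((Algorithm.ofFamily (fun p : Set (Fin n) × Set (Fin n) => A n Δ p.1 p.2)
      (r n)).widen hbb).run (fun v => (((P ω).owners, (P ω).ground), ((P ω).localSet v, ρ ω v))) =
      (HittingSetAlgorithm.on A (P ω)).run (fun v => ((P ω).localSet v, ρ ω v)) := by
    intro ω
    have hon : HittingSetAlgorithm.on A (P ω) = A n Δ (P ω).owners (P ω).ground := by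
      rw [HittingSetAlgorithm.on, hΔ]
    rw [Algorithm.widen_run, hon]
    refine Algorithm.ofFamily_run (fun p : Set (Fin n) × Set (Fin n) => A n Δ p.1 p.2)
      (p := ((P ω).owners, (P ω).ground)) ?_ (fun v => ((P ω).localSet v, ρ ω v))
    have := hA n hn (P ω)
    rwa [hon] at this
  have h3 := h2.broadcast (e := 1) hb (card_prop_le hn)
    (fun ω v => v ∈ HittingSetAlgorithm.result A (P ω) (ρ ω)) (by
      rintro v ω ω' ⟨-, hv⟩
      rw [hrun, hrun] at hv
      simp only [HittingSetAlgorithm.result, Set.mem_ofPred_eq, hv])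
  refine Attains.weaken (by
    rw [show t + (r n + 2) = t + 1 + r n + 1 by omega]
    exact h3) ?_
  rintro v ω ω' ⟨⟨⟨hR, -⟩, -⟩, hf⟩
  exact ⟨hR, Set.ext fun u => iff_of_eq (congrFun hf u)⟩

end Subroutine

/-! ### What the nodes know -/

section Determined

variable {n k : ℕ} {G G' : SimpleGraph (Fin n)} {Z Z' Y Y' : Set (Fin n)} {v : Fin n}

/-! The objects above are determined by what a node has learnt: they agree for two graphs and center
sets that the node cannot tell apart. -/

theorem adj_iff_of_neighborSet_eq (hN : G.neighborSet v = G'.neighborSet v) (u : Fin n) :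
    G.Adj v u ↔ G'.Adj v u :=
  Set.ext_iff.1 hN u

theorem light_neighborSet_eq (hN : G.neighborSet v = G'.neighborSet v)
    (hH : ∀ u, IsHeavy G u ↔ IsHeavy G' u) :
    (light G).neighborSet v = (light G').neighborSet v := by
  ext u
  simp only [SimpleGraph.mem_neighborSet, light_adj, hH, adj_iff_of_neighborSet_eq hN]

theorem isDense_iff (hN : G.neighborSet v = G'.neighborSet v) (hH : ∀ u, IsHeavy G u ↔ IsHeavy G' u)
    (hB : IsBig ((n : ℝ) ^ ((depth k : ℝ) / (k : ℝ))) (light G) (depth k) v ↔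
      IsBig ((n : ℝ) ^ ((depth k : ℝ) / (k : ℝ))) (light G') (depth k) v) :
    IsDense k G v ↔ IsDense k G' v := by
  have h1 : (∃ u, G.Adj v u ∧ IsHeavy G u) ↔ ∃ u, G'.Adj v u ∧ IsHeavy G' u := by
    simp only [hH, adj_iff_of_neighborSet_eq hN]
  exact or_congr (hH v) (or_congr h1 hB)

theorem coreCenter_eq (hN : G.neighborSet v = G'.neighborSet v) (hH : IsHeavy G v ↔ IsHeavy G' v)
    (hZ : Z = Z')
    (hC : IsClose (light G) Z (depth k) v ↔ IsClose (light G') Z' (depth k) v)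
    (hnear : IsClose (light G) Z (depth k) v → nearest (light G) Z v = nearest (light G') Z' v) :
    coreCenter k G Z v = coreCenter k G' Z' v := by
  rw [coreCenter, coreCenter]
  by_cases hc : IsClose (light G) Z (depth k) v
  · rw [if_pos hc, if_pos (hC.1 hc), hnear hc]
  · rw [if_neg hc, if_neg (fun h => hc (hC.2 h))]
    by_cases hh : IsHeavy G v
    · rw [if_pos hh, if_pos (hH.1 hh)]
      simp only [hZ, adj_iff_of_neighborSet_eq hN]
    · rw [if_neg hh, if_neg (fun h => hh (hH.2 h))]

theorem heavyNeighbor_eq (hN : G.neighborSet v = G'.neighborSet v)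
    (hH : ∀ u, IsHeavy G u ↔ IsHeavy G' u) : heavyNeighbor G v = heavyNeighbor G' v := by
  simp only [heavyNeighbor, hH, adj_iff_of_neighborSet_eq hN]

theorem parent_eq (hN : G.neighborSet v = G'.neighborSet v)
    (hH : ∀ u, IsHeavy G u ↔ IsHeavy G' u)
    (hC : ∀ u, IsClose (light G) Z (depth k) u ↔ IsClose (light G') Z' (depth k) u)
    (hnear : ∀ u, IsClose (light G) Z (depth k) u → nearest (light G) Z u = nearest (light G') Z' u)
    (hcore : coreCenter k G Z v = coreCenter k G' Z' v) : parent k G Z v = parent k G' Z' v := by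
  rw [parent, parent, hcore, heavyNeighbor_eq hN hH]
  by_cases hc : IsClose (light G) Z (depth k) v
  · rw [if_pos hc, if_pos ((hC v).1 hc)]
    congr 1
    ext u
    have hL : (light G).Adj v u ↔ (light G').Adj v u :=
      adj_iff_of_neighborSet_eq (light_neighborSet_eq hN hH) u
    obtain ⟨p₀, hp₀, hle⟩ := isClose_iff.1 hc
    have hle' : ∀ p, nearest (light G) Z v = some p → p.2.val ≤ depth k := by
      intro p hp
      rw [hp₀, Option.some.injEq] at hp
      rwa [← hp]
    constructor
    · rintro ⟨h1, p, q, hp, hq, h2, h3⟩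
      have hu : IsClose (light G) Z (depth k) u :=
        isClose_iff.2 ⟨q, hq, by have := hle' p hp; omega⟩
      exact ⟨hL.1 h1, p, q, by rw [← hnear v hc, hp], by rw [← hnear u hu, hq], h2, h3⟩
    · rintro ⟨h1, p, q, hp, hq, h2, h3⟩
      rw [← hnear v hc] at hp
      have hu : IsClose (light G) Z (depth k) u :=
        (hC u).2 (isClose_iff.2 ⟨q, hq, by have := hle' p hp; omega⟩)
      exact ⟨hL.2 h1, p, q, hp, by rw [hnear u hu, hq], h2, h3⟩
  · rw [if_neg hc, if_neg (fun h => hc ((hC v).2 h))]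

theorem firstCenter_eq (hN : G.neighborSet v = G'.neighborSet v)
    (hH : ∀ u, IsHeavy G u ↔ IsHeavy G' u)
    (hcore : ∀ u, coreCenter k G Z u = coreCenter k G' Z' u) :
    firstCenter k G Z v = firstCenter k G' Z' v := by
  rw [firstCenter, firstCenter, heavyNeighbor_eq hN hH, hcore, funext hcore]

theorem adjacentCenters_eq {c c' : Fin n → Option (Fin n)} (hN : G.neighborSet v = G'.neighborSet v)
    (hc : c = c') : adjacentCenters G c v = adjacentCenters G' c' v := by
  ext s
  simp only [mem_adjacentCenters, hc, adj_iff_of_neighborSet_eq hN]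

theorem isCrowded_iff (hd : IsDense k G v ↔ IsDense k G' v)
    (ha : adjacentCenters G (firstCenter k G Z) v = adjacentCenters G' (firstCenter k G' Z') v) :
    IsCrowded k G Z v ↔ IsCrowded k G' Z' v := by
  rw [IsCrowded, IsCrowded, hd, ha]

theorem secondCenter_eq (hcr : IsCrowded k G Z v ↔ IsCrowded k G' Z' v) (hY : Y = Y')
    (hf : firstCenter k G Z v = firstCenter k G' Z' v)
    (ha : adjacentCenters G (firstCenter k G Z) v = adjacentCenters G' (firstCenter k G' Z') v) :
    secondCenter k G Z Y v = secondCenter k G' Z' Y' v := by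
  rw [secondCenter, secondCenter, hY, hf, ha]
  by_cases hc : IsCrowded k G Z v
  · rw [if_pos hc, if_pos (hcr.1 hc)]
  · rw [if_neg hc, if_neg (fun h => hc (hcr.2 h))]

theorem chosen_eq (hN : G.neighborSet v = G'.neighborSet v)
    (hp : parent k G Z v = parent k G' Z' v)
    (hd : IsDense k G v ↔ IsDense k G' v)
    (hf : firstCenter k G Z = firstCenter k G' Z')
    (hs : secondCenter k G Z Y v = secondCenter k G' Z' Y' v)
    (hdel : ∀ s, (∃ s₂, secondCenter k G Z Y v = some s₂ ∧ delegate k G Z Y s s₂ = some v) ↔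
      ∃ s₂, secondCenter k G' Z' Y' v = some s₂ ∧ delegate k G' Z' Y' s s₂ = some v) :
    chosen k G Z Y v = chosen k G' Z' Y' v := by
  have ha := adjacentCenters_eq hN hf
  have ht : targets k G Z Y v = targets k G' Z' Y' v := by
    ext s
    simp only [targets, Set.mem_ofPred_eq, hdel]
    rw [ha, hs, hd]
  have hcon : ∀ s, contact k G Z v s = contact k G' Z' v s := by
    intro s
    simp only [contact, hf, adj_iff_of_neighborSet_eq hN]
  simp only [chosen, hp, ht, hcon]

end Determined

/-! ### The algorithm -/

section Main

variable {b n k : ℕ} {Seed : ℕ → Type} {A : HittingSetAlgorithm b Seed} {c : ℝ}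

/-- A set that hits the first instance is adjacent to all heavy vertices and meets all big balls. -/
theorem hits_of_firstInstance {h : ℕ} {Q : Set ℕ} (hk : 6 ≤ k) (hn : 2 ≤ n)
    {G : SimpleGraph (Fin n)} {S : Fin n → Option (Set (Fin n))}
    (hS : ∀ v X, S v = some X → (n : ℝ) ^ ((depth k : ℝ) / (k : ℝ)) < (X.ncard : ℝ))
    (hball : ∀ v X, S v = some X → X ⊆ ball (light G) v h)
    (hwit : ∀ q ∈ Q, ∀ v, IsBig ((n : ℝ) ^ ((depth k : ℝ) / (k : ℝ))) (light G) q v →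
      ∃ w X, S w = some X ∧ X ⊆ ball (light G) v q)
    {ρ : Fin n → Seed n} (hsuc : HittingSetAlgorithm.Succeeds A c (firstInstance hk hn G S hS) ρ) :
    (∀ v, IsHeavy G v → ∃ z ∈ HittingSetAlgorithm.result A (firstInstance hk hn G S hS) ρ,
      G.Adj v z) ∧
    ∀ q ∈ Q, ∀ v, IsBig ((n : ℝ) ^ ((depth k : ℝ) / (k : ℝ))) (light G) q v →
      IsClose (light G) (HittingSetAlgorithm.result A (firstInstance hk hn G S hS) ρ) q v := by
  obtain ⟨-, hhit, -⟩ := hsuc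
  constructor
  · intro v hv
    obtain ⟨z, hz, hzZ⟩ := hhit v (Or.inl hv)
    rcases hSv : S v with _ | X
    · change z ∈ (S v).getD (G.neighborSet v) at hz
      rw [hSv] at hz
      exact ⟨z, hzZ, hz⟩
    · -- a heavy vertex is alone in its ball in the light graph, so it is not a witness
      have hX : X ⊆ {v} := by
        intro u hu
        obtain ⟨d, -, hd⟩ := exists_edist_eq_of_le (mem_ball_iff.1 (hball v X hSv hu))
        exact (eq_of_isHeavy_of_edist hv hd).symm
      have h1 := Set.ncard_le_ncard hX (Set.toFinite _)
      rw [Set.ncard_singleton] at h1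
      have h2 := (one_le_rpow_depth (k := k) hn).trans_lt (hS v X hSv)
      rw [Nat.one_lt_cast] at h2
      omega
  · intro q hq v hv
    obtain ⟨w, X, hw, hX⟩ := hwit q hq v hv
    obtain ⟨z, hz, hzZ⟩ := hhit w (Or.inr ⟨X, hw⟩)
    change z ∈ (S w).getD (G.neighborSet w) at hz
    rw [hw] at hz
    exact ⟨z, hzZ, hX hz⟩

/-- The algorithm for given `k` and `n`: it takes `18 * m + 2 * r n + 12` rounds, where `m` is the
length of a plan for the radius `depth k`. The worlds are those in which both calls succeed, so the
guarantees of the hitting sets can be used for the bounds on the messages. -/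
theorem exists_algorithm_denseSpanner {r : ℕ → ℕ} (hA : HittingSetAlgorithm.RunsIn A r) (hc : 0 < c)
    (hk : 6 ≤ k) (hn : 2 ≤ n) :
    ∃ B : Algorithm (max b 40) n (Set (Fin n) × Seed n × Seed n) (Set (Fin n)),
      (B.rounds : ℝ) ≤ 48 * (Real.logb 2 k + r n) ∧
      ∀ G : SimpleGraph (Fin n), ∃ P₁ : HittingInstance n,
        ∀ ρ₁ : Fin n → Seed n, HittingSetAlgorithm.Succeeds A c P₁ ρ₁ →
        ∃ P₂ : HittingInstance n,
        ∀ ρ₂ : Fin n → Seed n, HittingSetAlgorithm.Succeeds A c P₂ ρ₂ →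
          IsDenseSpanner (sizeConstant c) k G (B.run (fun v => (G.neighborSet v, ρ₁ v, ρ₂ v))) := by
  classical
  have hb : 40 ≤ max b 40 := le_max_right _ _
  have hdepth := two_le_depth hk
  obtain ⟨m, Q, hplan, hm⟩ := exists_plan (depth k) (by omega)
  set D : ℝ := (n : ℝ) ^ ((depth k : ℝ) / (k : ℝ)) with hD
  have hDs : D ≤ Real.sqrt n := rpow_depth_le_sqrt hk hn
  obtain ⟨S, hS1, hS2, hS3⟩ := hplan.exists_witnesses (b := max b 40) D hDs hn hb
  set P₁ : SimpleGraph (Fin n) → HittingInstance n := fun G =>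
    firstInstance hk hn G (S (light G)) (fun v X h => (hS1 (light G) v X h).1) with hP₁
  set P₂ : SimpleGraph (Fin n) → (Fin n → Seed n) → HittingInstance n := fun G ρ =>
    secondInstance k hn G (HittingSetAlgorithm.result A (P₁ G) ρ) with hP₂
  -- the worlds are the graphs and coin tosses for which both calls succeed
  set Ω : Type := {x : SimpleGraph (Fin n) × (Fin n → Seed n) × (Fin n → Seed n) //
    HittingSetAlgorithm.Succeeds A c (P₁ x.1) x.2.1 ∧
    HittingSetAlgorithm.Succeeds A c (P₂ x.1 x.2.1) x.2.2} with hΩ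
  set gr : Ω → SimpleGraph (Fin n) := fun ω => ω.1.1 with hgr
  set inp : Ω → Fin n → Set (Fin n) × Seed n × Seed n :=
    fun ω v => ((gr ω).neighborSet v, ω.1.2.1 v, ω.1.2.2 v) with hinp
  set Z : Ω → Set (Fin n) := fun ω => HittingSetAlgorithm.result A (P₁ (gr ω)) ω.1.2.1 with hZ
  set Y : Ω → Set (Fin n) := fun ω =>
    HittingSetAlgorithm.result A (P₂ (gr ω) ω.1.2.1) ω.1.2.2 with hY
  have hhits : ∀ ω, _ := fun ω : Ω => hits_of_firstInstance (Q := Q) hk hn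
    (fun v X h => (hS1 (light (gr ω)) v X h).1) (fun v X h => (hS1 (light (gr ω)) v X h).2)
    (hS2 (light (gr ω))) ω.2.1
  -- the heavy vertices are announced
  have K₁ := ((attains_input (max b 40) inp).broadcast (e := 1) (by omega) (card_prop_le hn)
    (fun ω v => IsHeavy (gr ω) v) (by
      intro v ω ω' h
      have h1 : (gr ω).neighborSet v = (gr ω').neighborSet v := congrArg Prod.fst h
      simp only [IsHeavy, h1])).weaken
    (R' := fun v ω ω' => inp ω v = inp ω' v ∧ (gr ω).neighborSet v = (gr ω').neighborSet v ∧
      ∀ u, IsHeavy (gr ω) u ↔ IsHeavy (gr ω') u) (by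
      rintro v ω ω' ⟨h, h'⟩
      exact ⟨h, congrArg Prod.fst h, fun u => iff_of_eq (congrFun h' u)⟩)
  -- the nodes find out whether they are dense, and the witnesses for the first instance
  have K₂ := (hS3 (fun ω => light (gr ω)) K₁ (fun v ω ω' h => light_neighborSet_eq h.2.1 h.2.2)).weaken
    (R' := fun v ω ω' => (inp ω v = inp ω' v ∧ (gr ω).neighborSet v = (gr ω').neighborSet v ∧
      ∀ u, IsHeavy (gr ω) u ↔ IsHeavy (gr ω') u) ∧ (IsDense k (gr ω) v ↔ IsDense k (gr ω') v) ∧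
      S (light (gr ω)) v = S (light (gr ω')) v) (by
      rintro v ω ω' ⟨h, h1, -, h3⟩
      exact ⟨h, isDense_iff h.2.1 h.2.2 h1, h3⟩)
  -- the first call
  have K₃ := (Attains.call_hittingSet hA (le_max_left b 40) (by omega) hn K₂ (fun ω => P₁ (gr ω))
    (fun ω => ω.1.2.1) D (fun ω => rfl)
    (by
      rintro v ω ω' ⟨⟨-, -, hH⟩, -, h3⟩
      change (IsHeavy (gr ω) v ∨ ∃ X, S (light (gr ω)) v = some X) ↔
        (IsHeavy (gr ω') v ∨ ∃ X, S (light (gr ω')) v = some X)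
      rw [hH, h3])
    (fun v ω ω' _ => rfl)
    (by
      rintro v ω ω' ⟨⟨-, hN, -⟩, -, h3⟩
      change (S (light (gr ω)) v).getD ((gr ω).neighborSet v) =
        (S (light (gr ω')) v).getD ((gr ω').neighborSet v)
      rw [hN, h3])
    (fun v ω ω' h => congrArg (fun x => x.2.1) h.1.1)).weaken
    (R' := fun v ω ω' => (inp ω v = inp ω' v ∧ (gr ω).neighborSet v = (gr ω').neighborSet v ∧
      ∀ u, IsHeavy (gr ω) u ↔ IsHeavy (gr ω') u) ∧ (IsDense k (gr ω) v ↔ IsDense k (gr ω') v) ∧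
      Z ω = Z ω') (by
      rintro v ω ω' ⟨⟨h, h1, -⟩, h2⟩
      exact ⟨h, h1, h2⟩)
  -- the nearest centers
  have K₄ := hplan.attains_nearest hn hb (fun ω => light (gr ω)) Z K₃
    (fun v ω ω' h => light_neighborSet_eq h.1.2.1 h.1.2.2) (fun v ω ω' h => h.2.2)
    (fun ω q hq v hv => ncard_le_sqrt_of_not_isBig hDs fun hbig => hv ((hhits ω).2 q hq v hbig))
  have K₅ := K₄.broadcast (e := 3) (W := Option (Fin n × Fin n)) (by omega) (by
      rw [Finite.card_option]
      simp only [Nat.card_eq_fintype_card, Fintype.card_prod, Fintype.card_fin]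
      nlinarith [pow_pos (show 0 < n by omega) 2])
    (fun ω v => if IsClose (light (gr ω)) (Z ω) (depth k) v then nearest (light (gr ω)) (Z ω) v
      else none) (by
      rintro v ω ω' ⟨-, h1, h2, -⟩
      by_cases hcl : IsClose (light (gr ω)) (Z ω) (depth k) v
      · simp only [if_pos hcl, if_pos (h1.1 hcl), h2 hcl]
      · simp only [if_neg hcl, if_neg (fun h => hcl (h1.2 h))])
  have K₆ := (K₅.broadcast (e := 2) (W := Option (Fin n)) (by omega) (by
      rw [Finite.card_option]
      simp only [Nat.card_eq_fintype_card, Fintype.card_fin]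
      nlinarith)
    (fun ω v => coreCenter k (gr ω) (Z ω) v) (by
      rintro v ω ω' ⟨⟨⟨⟨-, hN, hH⟩, -, hZZ⟩, h1, h2, -⟩, -⟩
      exact coreCenter_eq hN (hH v) hZZ h1 h2)).weaken
    (R' := fun v ω ω' => ((inp ω v = inp ω' v ∧ (gr ω).neighborSet v = (gr ω').neighborSet v ∧
      ∀ u, IsHeavy (gr ω) u ↔ IsHeavy (gr ω') u) ∧ (IsDense k (gr ω) v ↔ IsDense k (gr ω') v) ∧
      Z ω = Z ω') ∧ parent k (gr ω) (Z ω) v = parent k (gr ω') (Z ω') v ∧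
      firstCenter k (gr ω) (Z ω) v = firstCenter k (gr ω') (Z ω') v) (by
      rintro v ω ω' ⟨⟨⟨h, -, -, -⟩, hnear⟩, hcore⟩
      have key : ∀ u, (if IsClose (light (gr ω)) (Z ω) (depth k) u then nearest (light (gr ω)) (Z ω) u
        else none) = (if IsClose (light (gr ω')) (Z ω') (depth k) u then
          nearest (light (gr ω')) (Z ω') u else none) := fun u => congrFun hnear u
      have hsome : ∀ ω u, IsClose (light (gr ω)) (Z ω) (depth k) u →
          nearest (light (gr ω)) (Z ω) u ≠ none := by
        intro ω u hcl
        obtain ⟨p, hp, -⟩ := isClose_iff.1 hcl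
        rw [hp]; simp
      have h1 : ∀ u, IsClose (light (gr ω)) (Z ω) (depth k) u ↔
          IsClose (light (gr ω')) (Z ω') (depth k) u := by
        intro u
        have := key u
        by_cases hcl : IsClose (light (gr ω)) (Z ω) (depth k) u <;>
        by_cases hcl' : IsClose (light (gr ω')) (Z ω') (depth k) u
        · exact iff_of_true hcl hcl'
        · rw [if_pos hcl, if_neg hcl'] at this
          exact absurd this (hsome ω u hcl)
        · rw [if_neg hcl, if_pos hcl'] at this
          exact absurd this.symm (hsome ω' u hcl')
        · exact iff_of_false hcl hcl'
      have h2 : ∀ u, IsClose (light (gr ω)) (Z ω) (depth k) u →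
          nearest (light (gr ω)) (Z ω) u = nearest (light (gr ω')) (Z ω') u := by
        intro u hcl
        have := key u
        rwa [if_pos hcl, if_pos ((h1 u).1 hcl)] at this
      exact ⟨h, parent_eq h.1.2.1 h.1.2.2 h1 h2 (congrFun hcore v),
        firstCenter_eq h.1.2.1 h.1.2.2 (congrFun hcore)⟩)
  have K₇ := (K₆.broadcast (e := 2) (W := Option (Fin n)) (by omega) (by
      rw [Finite.card_option]
      simp only [Nat.card_eq_fintype_card, Fintype.card_fin]
      nlinarith)
    (fun ω v => firstCenter k (gr ω) (Z ω) v) (fun v ω ω' h => h.2.2)).weaken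
    (R' := fun v ω ω' => (inp ω v = inp ω' v ∧ (gr ω).neighborSet v = (gr ω').neighborSet v ∧
      (IsDense k (gr ω) v ↔ IsDense k (gr ω') v) ∧ Z ω = Z ω') ∧
      parent k (gr ω) (Z ω) v = parent k (gr ω') (Z ω') v ∧
      firstCenter k (gr ω) (Z ω) = firstCenter k (gr ω') (Z ω') ∧
      adjacentCenters (gr ω) (firstCenter k (gr ω) (Z ω)) v =
        adjacentCenters (gr ω') (firstCenter k (gr ω') (Z ω')) v ∧
      (IsCrowded k (gr ω) (Z ω) v ↔ IsCrowded k (gr ω') (Z ω') v)) (by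
      rintro v ω ω' ⟨⟨⟨h, hd, hZZ⟩, hp, -⟩, hf⟩
      have ha := adjacentCenters_eq h.2.1 hf
      exact ⟨⟨h.1, h.2.1, hd, hZZ⟩, hp, hf, ha, isCrowded_iff hd ha⟩)
  -- the second call
  have K₈ := Attains.call_hittingSet hA (le_max_left b 40) (by omega) hn K₇
    (fun ω => P₂ (gr ω) ω.1.2.1) (fun ω => ω.1.2.2)
    (min ((n : ℝ) ^ (1 / (k : ℝ)) * Real.logb 2 n) n) (fun ω => rfl)
    (fun v ω ω' h => h.2.2.2.2) (fun v ω ω' h => h.1.2.2.2) (fun v ω ω' h => h.2.2.2.1)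
    (fun v ω ω' h => congrArg (fun x => x.2.2) h.1.1)
  have K₉ := K₈.broadcast (e := 2) (W := Option (Fin n)) (by omega) (by
      rw [Finite.card_option]
      simp only [Nat.card_eq_fintype_card, Fintype.card_fin]
      nlinarith)
    (fun ω v => secondCenter k (gr ω) (Z ω) (Y ω) v) (by
      rintro v ω ω' ⟨⟨-, -, hf, ha, hcr⟩, hYY⟩
      exact secondCenter_eq hcr hYY (congrFun hf v) ha)
  have hW2 : Nat.card Prop ≤ 2 ^ (max b 40 * Nat.clog 2 n) :=
    (card_prop_le hn).trans ((pow_le_two_pow_mul_clog n 1).trans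
      (Nat.pow_le_pow_right two_pos (Nat.mul_le_mul_right _ (by omega))))
  -- a center learns which vertices are adjacent to its cluster, and tells its delegates
  have K₁₀ := K₉.round hW2
    (fun ω v s => s ∈ adjacentCenters (gr ω) (firstCenter k (gr ω) (Z ω)) v) (by
      rintro v ω ω' ⟨⟨⟨-, -, -, ha, -⟩, -⟩, -⟩
      simp only [ha])
  have K₁₁ := K₁₀.round hW2
    (fun ω s v => ∃ s₂, secondCenter k (gr ω) (Z ω) (Y ω) v = some s₂ ∧
      delegate k (gr ω) (Z ω) (Y ω) s s₂ = some v) (by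
      rintro s ω ω' ⟨⟨-, hsec⟩, hadj⟩
      have hsec' : ∀ v, secondCenter k (gr ω) (Z ω) (Y ω) v =
        secondCenter k (gr ω') (Z ω') (Y ω') v := fun v => congrFun hsec v
      have hdel : ∀ s₂, delegate k (gr ω) (Z ω) (Y ω) s s₂ = delegate k (gr ω') (Z ω') (Y ω') s s₂ := by
        intro s₂
        simp only [delegate, hsec', hadj]
      simp only [hsec', hdel])
  -- the other ends of the chosen edges are informed
  have hchosen : ∀ v ω ω', _ → chosen k (gr ω) (Z ω) (Y ω) v = chosen k (gr ω') (Z ω') (Y ω') v :=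
    fun v ω ω' (h : (((((inp ω v = inp ω' v ∧ (gr ω).neighborSet v = (gr ω').neighborSet v ∧
      (IsDense k (gr ω) v ↔ IsDense k (gr ω') v) ∧ Z ω = Z ω') ∧
      parent k (gr ω) (Z ω) v = parent k (gr ω') (Z ω') v ∧
      firstCenter k (gr ω) (Z ω) = firstCenter k (gr ω') (Z ω') ∧
      adjacentCenters (gr ω) (firstCenter k (gr ω) (Z ω)) v =
        adjacentCenters (gr ω') (firstCenter k (gr ω') (Z ω')) v ∧
      (IsCrowded k (gr ω) (Z ω) v ↔ IsCrowded k (gr ω') (Z ω') v)) ∧ Y ω = Y ω') ∧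
      (fun v => secondCenter k (gr ω) (Z ω) (Y ω) v) =
        fun v => secondCenter k (gr ω') (Z ω') (Y ω') v) ∧
      ∀ u, (v ∈ adjacentCenters (gr ω) (firstCenter k (gr ω) (Z ω)) u) =
        (v ∈ adjacentCenters (gr ω') (firstCenter k (gr ω') (Z ω')) u)) ∧
      ∀ s, (∃ s₂, secondCenter k (gr ω) (Z ω) (Y ω) v = some s₂ ∧
        delegate k (gr ω) (Z ω) (Y ω) s s₂ = some v) =
        ∃ s₂, secondCenter k (gr ω') (Z ω') (Y ω') v = some s₂ ∧
        delegate k (gr ω') (Z ω') (Y ω') s s₂ = some v) => by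
      obtain ⟨⟨⟨⟨⟨⟨-, hN, hd, -⟩, hp, hf, -, -⟩, -⟩, hsec⟩, -⟩, hdel⟩ := h
      exact chosen_eq hN hp hd hf (congrFun hsec v) fun s => iff_of_eq (hdel s)
  have K₁₂ := K₁₁.round hW2 (fun ω v u => u ∈ chosen k (gr ω) (Z ω) (Y ω) v) (by
      intro v ω ω' h
      simp only [hchosen v ω ω' h])
  obtain ⟨B, hB, hrun⟩ := K₁₂.exists_algorithm
    (fun ω v => {u | u ∈ chosen k (gr ω) (Z ω) (Y ω) v ∨ v ∈ chosen k (gr ω) (Z ω) (Y ω) u}) (by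
      rintro v ω ω' ⟨h, hin⟩
      simp only [hchosen v ω ω' h, hin])
  refine ⟨B, ?_, fun G => ⟨P₁ G, fun ρ₁ h₁ => ⟨P₂ G ρ₁, fun ρ₂ h₂ => ?_⟩⟩⟩
  · have hlogk : (1 : ℝ) ≤ Real.logb 2 k := one_le_logb (by omega)
    have hdk : depth k ≤ k := by
      rw [depth]
      split_ifs <;> omega
    have hmk : (m : ℝ) ≤ 2 * Real.logb 2 k := by
      have h1 : (Nat.log 2 (depth k) : ℝ) ≤ Real.logb 2 k := by
        refine le_trans ?_ (Real.natLog_le_logb k 2)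
        exact_mod_cast Nat.log_mono_right hdk
      have h2 : (m : ℝ) ≤ 2 * Nat.log 2 (depth k) := by exact_mod_cast hm
      linarith
    have hr0 : (0 : ℝ) ≤ r n := Nat.cast_nonneg _
    have hB' : B.rounds = 18 * m + 2 * r n + 12 := by
      rw [hB]; ring
    rw [hB']
    push_cast
    linarith
  · set ω : Ω := ⟨(G, ρ₁, ρ₂), h₁, h₂⟩ with hω
    refine isDenseSpanner_of_hitting (Z := Z ω) (Z' := Y ω) hc hk hn (hhits ω).1
      ((hhits ω).2 _ hplan.mem) ?_ h₂.1 (fun v hv => ?_) h₂.2.2 (fun v => congrFun (hrun ω) v)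
    · have hcard : ((Z ω).ncard : ℝ) ≤
          c * ((Set.univ : Set (Fin n)).ncard : ℝ) * Real.logb 2 n / D := h₁.2.2
      rwa [Set.ncard_univ, Nat.card_fin] at hcard
    · have hhit : (adjacentCenters G (firstCenter k G (Z ω)) v ∩ Y ω).Nonempty := h₂.2.1 v hv
      rwa [Set.inter_comm] at hhit

end Main

end DenseRegion

theorem mainTheorem7 :
    ∃ (β : ℕ) (K : ℝ), ∀ c : ℝ, 0 < c → ∃ C : ℝ,
      ∀ (b : ℕ) (Seed : ℕ → Type) (A : CongestedClique.HittingSetAlgorithm b Seed) (r : ℕ → ℕ),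
        CongestedClique.HittingSetAlgorithm.RunsIn A r →
        ∃ B : (k n : ℕ) → CongestedClique.Algorithm (max b β) n
            (Set (Fin n) × Seed n × Seed n) (Set (Fin n)),
          ∀ k : ℕ, 6 ≤ k → ∀ n : ℕ, 2 ≤ n →
            -- the number of rounds
            ((B k n).rounds : ℝ) ≤ K * (Real.logb 2 k + r n) ∧
            -- correctness, if the hitting-set algorithm is always correct
            ((∀ (P : CongestedClique.HittingInstance n) (ρ : Fin n → Seed n),
                CongestedClique.HittingSetAlgorithm.Succeeds A c P ρ) →
              ∀ (G : SimpleGraph (Fin n)) (ρ₁ ρ₂ : Fin n → Seed n),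
                DenseRegion.IsDenseSpanner C k G
                  ((B k n).run (fun v => (G.neighborSet v, ρ₁ v, ρ₂ v)))) ∧
            -- correctness, whenever both calls of the hitting-set algorithm succeed
            (∀ G : SimpleGraph (Fin n), ∃ P₁ : CongestedClique.HittingInstance n,
              ∀ ρ₁ : Fin n → Seed n, CongestedClique.HittingSetAlgorithm.Succeeds A c P₁ ρ₁ →
              ∃ P₂ : CongestedClique.HittingInstance n,
              ∀ ρ₂ : Fin n → Seed n, CongestedClique.HittingSetAlgorithm.Succeeds A c P₂ ρ₂ →
                DenseRegion.IsDenseSpanner C k G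
                  ((B k n).run (fun v => (G.neighborSet v, ρ₁ v, ρ₂ v)))) := by
  refine ⟨40, 48, fun c hc => ⟨DenseRegion.sizeConstant c, fun b Seed A r hA => ?_⟩⟩
  have hex : ∀ k n : ℕ, ∃ B : CongestedClique.Algorithm (max b 40) n
      (Set (Fin n) × Seed n × Seed n) (Set (Fin n)), 6 ≤ k → 2 ≤ n →
      (B.rounds : ℝ) ≤ 48 * (Real.logb 2 k + r n) ∧
      ∀ G : SimpleGraph (Fin n), ∃ P₁ : CongestedClique.HittingInstance n,
        ∀ ρ₁ : Fin n → Seed n, CongestedClique.HittingSetAlgorithm.Succeeds A c P₁ ρ₁ →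
        ∃ P₂ : CongestedClique.HittingInstance n,
        ∀ ρ₂ : Fin n → Seed n, CongestedClique.HittingSetAlgorithm.Succeeds A c P₂ ρ₂ →
          DenseRegion.IsDenseSpanner (DenseRegion.sizeConstant c) k G
            (B.run (fun v => (G.neighborSet v, ρ₁ v, ρ₂ v))) := by
    intro k n
    by_cases h : 6 ≤ k ∧ 2 ≤ n
    · obtain ⟨B, hB⟩ := DenseRegion.exists_algorithm_denseSpanner hA hc h.1 h.2
      exact ⟨B, fun _ _ => hB⟩
    · -- nothing is asked for such `k` and `n`
      exact ⟨⟨Unit, fun _ _ => (), fun _ _ _ => false, fun _ _ => (), fun _ => ∅, 0⟩,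
        fun hk hn => absurd ⟨hk, hn⟩ h⟩
  choose B hB using hex
  refine ⟨B, fun k hk n hn => ⟨(hB k n hk hn).1, fun hall G ρ₁ ρ₂ => ?_, (hB k n hk hn).2⟩⟩
  obtain ⟨P₁, h₁⟩ := (hB k n hk hn).2 G
  obtain ⟨P₂, h₂⟩ := h₁ ρ₁ (hall P₁ ρ₁)
  exact h₂ ρ₂ (hall P₂ ρ₂)
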